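/- **LCL problems on unrooted regular trees.** Such a problem is a tuple $\Pi=(\Delta,\Sigma,\mathcal V,\mathcal E)$, where $\Delta\ge 1$, $\Sigma$ is a finite non-empty set of labels, $\mathcal V$ is a set of multisets of $\Delta$ labels (node configurations) and $\mathcal E$ is a set of multisets of two labels. On a tree all of whose nodes have degree $1$ or $\Delta$, a solution assigns a label to every half-edge $(v,e)$, $v\in e$, such that at every node of degree $\Delta$ the multiset of the $\Delta$ incident half-edge labels is in $\mathcal V$, and on every edge the multiset of its two half-edge labels is in $\mathcal E$. **Depth.** For $\mathcal W\subseteq\mathcal V$ let $\mathcal M_{\mathcal W}$ be the digraph whose nodes are the pairs $(x,y)\in\Sigma^2$ such that $\{x,y\}$ is a sub-multiset of some $C\in\mathcal W$, with an edge from $(x_1,x_2)$ to $(y_1,y_2)$ iff $\{x_2,y_1\}\in\mathcal E$. A set $U$ of nodes is path-flexible if there is $K\ge 1$ such that for all $u,v\in U$ and all $m\ge K$ there is a walk of length $m$ from $u$ to $v$ inside $U$. * $\mathrm{flexSCC}(\mathcal W)$ is the set of all sets $\mathcal D$ of two-element multisets over $\Sigma$ for which $\{(x,y)\in V(\mathcal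 M_{\mathcal V}) : \{x,y\}\in\mathcal D\}$ is a path-flexible strongly connected component of $\mathcal M_{\mathcal W}$. * $\mathcal W|_{\mathcal D}$ is the set of all $C\in\mathcal W$ all of whose two-element sub-multisets are in $\mathcal D$. * $\mathrm{trim}(\mathcal W)$ is the set of all $C\in\mathcal W$ such that, for every $i\ge 1$, the complete tree of depth $i$ in which all inner nodes (including the root) have degree $\Delta$ has a solution with configuration $C$ at the root and configurations from $\mathcal W$ at all other inner nodes. A good sequence of length $k\ge 1$ is a tuple $(\mathcal V_1,\mathcal D_1,\mathcal V_2,\dots,\mathcal D_{k-1},\mathcal V_k)$ with all $\mathcal V_i$ non-empty such that, with $\mathcal V_0=\mathcal V$ and $\mathcal D_0$ the set of all two-element multisets over $\Sigma$, we have $\mathcal V_i=\mathrm{trim}(\mathcal V_{i-1}|_{\mathcal D_{i-1}})$ for $1\le i\le k$ and $\mathcal D_i\in\mathrm{flexSCC}(\mathcal V_i)$ for $1\le i<k$. The depth $d_\Pi\in\mathbb N\cup\{\infty\}$ is the largest length of a good sequence ($0$ if there is none, $\infty$ if there are arbitrarily long ones). **Randomized online-LOCAL.** An adversary fixes an $n$-node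 graph and an order $v_1,\dots,v_n$ of its nodes. The nodes are revealed in this order to an algorithm that knows $n$ and has access to an infinite stream of random bits, unknown to the adversary. When $v_i$ is revealed, an algorithm with locality $T(n)$ must label the half-edges at $v_i$ based on the random bits and on the subgraph induced by the radius-$T(n)$ neighborhoods of $v_1,\dots,v_i$. The algorithm solves $\Pi$ if, on all but finitely many trees with all degrees in $\{1,\Delta\}$ and for every order of the nodes, it fails to produce a solution with probability at most $1/n$. **Theorem.** Let $\Pi$ be an LCL problem on unrooted regular trees whose depth $d_\Pi=k$ is finite and positive. Then every randomized online-LOCAL algorithm for $\Pi$ has locality $\Omega(n^{1/k})$. That is, there is a constant $c>0$, depending only on $\Pi$, such that for every randomized online-LOCAL algorithm solving $\Pi$ with locality $T$ we have $T(n)\ge c\,n^{1/k}$ for all sufficiently large $n$ for which there is an $n$-node tree with all degrees in $\{1,\Delta\}$. -/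

import Mathlib

open Filter MeasureTheory

/-! ### LCL problems on unrooted regular trees -/

/-- An LCL problem `(Δ, L, 𝒱, ℰ)` on unrooted regular trees with label set `L`: node
configurations are multisets of `Δ` labels, edge configurations are multisets of two labels. -/
structure UnrootedLCL (L : Type*) where
  /-- the degree of the inner nodes -/
  Δ : ℕ
  Δ_pos : 0 < Δ
  /-- the node constraints `𝒱` -/
  nodeConstraints : Set (Sym L Δ)
  /-- the edge constraints `ℰ` -/
  edgeConstraints : Set (Sym2 L)

/-- The finite set of neighbours of `v`. -/
noncomputable def nbrs {V : Type*} [Finite V] (G : SimpleGraph V) (v : V) : Finset V :=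
  (G.neighborSet v).toFinite.toFinset

/-- The multiset of labels on the half-edges at `v`. A half-edge labeling is a function
`ℓ : V → V → L`, where `ℓ v u` is the label of the half-edge `(v, {v, u})`; the values `ℓ v u`
for non-adjacent `v`, `u` are never used. -/
noncomputable def nodeConfig {V L : Type*} [Finite V] (G : SimpleGraph V) (ℓ : V → V → L) (v : V) :
    Multiset L :=
  (nbrs G v).val.map (ℓ v)

/-- `G` is a finite tree all of whose nodes have degree `1` or `Δ`. -/
def IsRegularTree {V : Type*} [Finite V] (Δ : ℕ) (G : SimpleGraph V) : Prop :=
  G.IsTree ∧ ∀ v, (nbrs G v).card = 1 ∨ (nbrs G v).card = Δ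

/-- `G` with root `r` is the complete tree `T*ᵢ` of depth `i` in which every inner vertex,
including the root, has degree `Δ`: the vertices at distance less than `i` from the root have
degree `Δ`, and the remaining ones are at distance exactly `i` and are leaves. -/
structure IsCompleteTree {V : Type*} [Finite V] (Δ i : ℕ) (G : SimpleGraph V) (r : V) : Prop where
  isTree : G.IsTree
  dist_le : ∀ v, G.dist r v ≤ i
  inner : ∀ v, G.dist r v < i → (nbrs G v).card = Δ
  leaf : ∀ v, G.dist r v = i → (nbrs G v).card = 1

namespace UnrootedLCL

variable {L : Type*} (P : UnrootedLCL L)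

/-- The half-edge labeling `ℓ` is a solution of the problem on `G`. -/
def IsSolution {V : Type*} [Finite V] (G : SimpleGraph V) (ℓ : V → V → L) : Prop :=
  (∀ v, (nbrs G v).card = P.Δ → ∃ C ∈ P.nodeConstraints, (C : Multiset L) = nodeConfig G ℓ v) ∧
  ∀ u v, G.Adj u v → s(ℓ u v, ℓ v u) ∈ P.edgeConstraints

/-! ### The automaton -/

/-- The nodes of the automaton of the problem `(Δ, L, 𝒲, ℰ)`: the ordered pairs `(x, y)` such
that `{x, y}` is a sub-multiset of some configuration in `𝒲`. -/
def autNodes (W : Set (Sym L P.Δ)) : Set (L × L) :=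
  {p | ∃ C ∈ W, ({p.1, p.2} : Multiset L) ≤ (C : Multiset L)}

/-- The edges of the automaton of the problem `(Δ, L, 𝒲, ℰ)`. -/
def autAdj (W : Set (Sym L P.Δ)) (p q : L × L) : Prop :=
  p ∈ P.autNodes W ∧ q ∈ P.autNodes W ∧ s(p.2, q.1) ∈ P.edgeConstraints

/-- `U` is a strongly connected component of the automaton of `(Δ, L, 𝒲, ℰ)`. -/
def IsSCC (W : Set (Sym L P.Δ)) (U : Set (L × L)) : Prop :=
  ∃ u ∈ P.autNodes W, U = {v | v ∈ P.autNodes W ∧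
    Relation.ReflTransGen (P.autAdj W) u v ∧ Relation.ReflTransGen (P.autAdj W) v u}

/-- There is a walk of length `m` from `u` to `v` in the automaton of `(Δ, L, 𝒲, ℰ)` that only
visits nodes in `U`. -/
def WalkIn (W : Set (Sym L P.Δ)) (U : Set (L × L)) : ℕ → L × L → L × L → Prop
  | 0, u, v => u ∈ U ∧ u = v
  | m + 1, u, v => u ∈ U ∧ ∃ w, P.autAdj W u w ∧ WalkIn W U m w v

/-- `U` is path-flexible: any two of its nodes are joined by walks inside `U` of every
sufficiently large length. -/
def IsPathFlexible (W : Set (Sym L P.Δ)) (U : Set (L × L)) : Prop :=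
  ∃ K : ℕ, 0 < K ∧ ∀ m, K ≤ m → ∀ u ∈ U, ∀ v ∈ U, P.WalkIn W U m u v

/-! ### Restriction, trim, flexible components, depth -/

/-- The configurations in `𝒲` all of whose two-element sub-multisets belong to `𝒟`. -/
def restrict (W : Set (Sym L P.Δ)) (D : Set (Sym2 L)) : Set (Sym L P.Δ) :=
  {C | C ∈ W ∧ ∀ x y : L, ({x, y} : Multiset L) ≤ (C : Multiset L) → s(x, y) ∈ D}

/-- The configurations `C ∈ 𝒲` such that for every depth `i ≥ 1` the complete tree `T*ᵢ` has a
solution with configuration `C` at the root and configurations from `𝒲` at all other inner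
vertices. -/
def trim (W : Set (Sym L P.Δ)) : Set (Sym L P.Δ) :=
  {C | C ∈ W ∧ ∀ i : ℕ, 1 ≤ i →
    ∃ (V : Type) (_ : Finite V) (G : SimpleGraph V) (r : V) (ℓ : V → V → L),
      IsCompleteTree P.Δ i G r ∧ P.IsSolution G ℓ ∧
      nodeConfig G ℓ r = (C : Multiset L) ∧
      ∀ v, v ≠ r → G.dist r v < i → ∃ C' ∈ W, (C' : Multiset L) = nodeConfig G ℓ v}

/-- The set `U_𝒟` of nodes `(x, y)` of the automaton of the problem with `{x, y} ∈ 𝒟`. -/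
def pairNodes (D : Set (Sym2 L)) : Set (L × L) :=
  {p | p ∈ P.autNodes P.nodeConstraints ∧ s(p.1, p.2) ∈ D}

/-- The sets `𝒟` of label pairs for which `U_𝒟` is a path-flexible strongly connected component
of the automaton of `(Δ, L, 𝒲, ℰ)`. -/
def flexSCC (W : Set (Sym L P.Δ)) : Set (Set (Sym2 L)) :=
  {D | P.IsSCC W (P.pairNodes D) ∧ P.IsPathFlexible W (P.pairNodes D)}

/-- `(𝒱₁, 𝒟₁, 𝒱₂, …, 𝒟ₖ₋₁, 𝒱ₖ)` is a good sequence of length `k`. The entries are `W i` for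
`1 ≤ i ≤ k` and `D i` for `1 ≤ i < k`; the entries at `0` are the initial values `𝒱₀ = 𝒱` and
`𝒟₀ =` all pairs, and the entries at larger indices are irrelevant. -/
structure IsGoodSequence (k : ℕ) (W : ℕ → Set (Sym L P.Δ)) (D : ℕ → Set (Sym2 L)) : Prop where
  length_pos : 1 ≤ k
  W_zero : W 0 = P.nodeConstraints
  D_zero : D 0 = Set.univ
  W_succ : ∀ i < k, W (i + 1) = P.trim (P.restrict (W i) (D i))
  D_mem : ∀ i, 1 ≤ i → i < k → D i ∈ P.flexSCC (W i)
  W_nonempty : ∀ i, 1 ≤ i → i ≤ k → (W i).Nonempty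

/-- The depth of the problem: the largest length of a good sequence, `0` if there is none, and
`⊤` if there are arbitrarily long ones. -/
noncomputable def depth : ℕ∞ :=
  ⨆ (k : ℕ) (_ : ∃ W D, P.IsGoodSequence k W D), (k : ℕ∞)

end UnrootedLCL

/-! ### The randomized online-LOCAL model -/

/-- What an online algorithm knows about an `n`-node graph after some nodes were revealed: the
revealed nodes in their order, the set of all nodes seen so far, and the subgraph induced by the
nodes seen so far (as a graph on `Fin n` whose edges are those of the induced subgraph). -/
structure OnlineView (n : ℕ) where
  revealed : List (Fin n)
  seen : Set (Fin n)
  graph : SimpleGraph (Fin n)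

/-- The nodes within distance `T` of one of the nodes `σ 0, …, σ i`. -/
def seenNodes {n : ℕ} (T : ℕ) (G : SimpleGraph (Fin n)) (σ : Equiv.Perm (Fin n)) (i : Fin n) :
    Set (Fin n) :=
  {u | ∃ j : Fin n, j ≤ i ∧ ∃ p : G.Walk (σ j) u, p.length ≤ T}

/-- The view of an algorithm with locality `T` when it has to label the node `σ i` after the
nodes `σ 0, …, σ i` were revealed, in this order. -/
def onlineView {n : ℕ} (T : ℕ) (G : SimpleGraph (Fin n)) (σ : Equiv.Perm (Fin n)) (i : Fin n) :
    OnlineView n where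
  revealed := ((List.finRange n).take (i.val + 1)).map σ
  seen := seenNodes T G σ i
  graph := (G.induce (seenNodes T G σ i)).spanningCoe

/-- A randomized online-LOCAL algorithm producing half-edge labels. It knows the number `n` of
nodes, and the nodes carry the names `Fin n`. When a node is revealed, the algorithm labels the
half-edges at this node as a function of its view and of one infinite stream of random bits that
is used for the whole execution: `output n w ω u` is the label for the half-edge towards `u`
(irrelevant if `u` is not a neighbour). The view determines all earlier views, so the dependence
on the view and the bits includes unbounded global memory. -/
structure RandOnlineLocalAlg (L : Type*) where
  locality : ℕ → ℕ
  output : (n : ℕ) → OnlineView n → (ℕ → Bool) → Fin n → L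
  measurable_output : ∀ (n : ℕ) (w : OnlineView n) (f : Fin n → L),
    MeasurableSet {ω : ℕ → Bool | output n w ω = f}

/-- The law of an infinite stream of independent fair random bits. -/
noncomputable def randomBits : Measure (ℕ → Bool) :=
  Measure.infinitePi fun _ : ℕ => (PMF.uniformOfFintype Bool).toMeasure

namespace RandOnlineLocalAlg

variable {L : Type*} (A : RandOnlineLocalAlg L)

/-- The half-edge labeling of `G` produced when the nodes are revealed in the order
`σ 0, σ 1, …` and the random bits are `ω`. -/
def run {n : ℕ} (G : SimpleGraph (Fin n)) (σ : Equiv.Perm (Fin n)) (ω : ℕ → Bool) :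
    Fin n → Fin n → L :=
  fun v => A.output n (onlineView (A.locality n) G σ (σ.symm v)) ω

/-- The algorithm solves the problem with high probability: on all but finitely many regular
trees, and for every order fixed in advance by the adversary, the probability of failure is at
most `1 / n`. -/
def Solves (P : UnrootedLCL L) : Prop :=
  ∀ᶠ n : ℕ in atTop, ∀ G : SimpleGraph (Fin n), IsRegularTree P.Δ G →
    ∀ σ : Equiv.Perm (Fin n),
      randomBits.real {ω | ¬ P.IsSolution G (A.run G σ ω)} ≤ 1 / (n : ℝ)

end RandOnlineLocalAlg

/-! The proof is by contraposition: if an algorithm of locality T fails with probability at most 1/n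
on every n-node instance and C (T+1)^k ≤ n, then there is a good sequence of length k + 1, so the
depth exceeds k.

Randomness is removed by a union bound (`RandOnlineLocalAlg.exists_bits`). The argument only uses a
family of fewer than n instances, fixed in advance. Some string of random bits is therefore
successful on all of them at once, and with these bits the algorithm is deterministic and correct on
the whole family.

Let Δ ≥ 3. An instance contains a connected trunk and k separate nodes, the cores 1, …, k; the
neighbourhood of the trunk and the cores are revealed first. The views of radius T do not show how
the trunk is joined to the next core. So it can still be chosen from which half-edge near the trunk,
to which half-edge at the core and with which of two consecutive lengths a joining path runs. The
path is created by exchanging three edges outside the views (`IsSwitch`, `Good.exists_extension`),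
which preserves the node set, all degrees and the tree property. The labels at both ends are already
committed, and all variants are labelled correctly. Hence the labels along the paths give walks in
the automaton between the same pairs, in all orientations and of consecutive lengths. Such walks
force all pairs near the trunk into one path-flexible strongly connected component
(`sccPairs_mem_flexSCC`, `mem_sccPairs`).

This is iterated k times. The family F 1 contains all stages, and each stage of F (i + 1) has all
its extensions at level i in F i. Configurations near the trunks of F 1 belong to 𝒱; configurations
a constant distance γ further inside survive `trim`; the walks then live in the automaton of 𝒱₁, so
the pairs near the trunks of F 2 lie in a single component 𝒟₁; and so on (`IsFamily.hasConfig`). The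
component is always that of the pair p at the core 0, and k rounds give a good sequence of length k
+ 1 (`IsFamily.le_depth`).

The room for the paths comes from a hierarchical caterpillar. Every half-edge near the trunk must
begin a long path through nodes of degree Δ, and each extension uses up one level of this property.
A side tree that sustains i levels at radius M = O(T) has O(M^i) nodes, and the whole tree O(T^k)
(`sideWeight_le`, `lineWeight_le`). The number of stages is O(T^(k-1)).

For Δ = 2 a direct argument on eight paths yields a flexible component as soon as n is a large
multiple of T + 1. Such a component can be reused for ever, so the depth is infinite. For Δ = 1
there are no trees with more than two nodes. -/

namespace SimpleGraph

/-! ### Balls in graphs -/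

variable {V : Type*} {G G' : SimpleGraph V}

/-- The vertices joined to `Y` by a walk of length at most `r`. -/
def ballOf (G : SimpleGraph V) (Y : Set V) (r : ℕ) : Set V :=
  {v | ∃ y ∈ Y, ∃ p : G.Walk y v, p.length ≤ r}

lemma subset_ballOf (Y : Set V) (r : ℕ) : Y ⊆ G.ballOf Y r :=
  fun v hv => ⟨v, hv, Walk.nil, by simp⟩

lemma ballOf_mono {Y Z : Set V} {r s : ℕ} (h : Y ⊆ Z) (hrs : r ≤ s) :
    G.ballOf Y r ⊆ G.ballOf Z s := by
  rintro v ⟨y, hy, p, hp⟩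
  exact ⟨y, h hy, p, hp.trans hrs⟩

lemma ballOf_step {Y : Set V} {r : ℕ} {u v : V} (hu : u ∈ G.ballOf Y r) (h : G.Adj u v) :
    v ∈ G.ballOf Y (r + 1) := by
  obtain ⟨y, hy, p, hp⟩ := hu
  exact ⟨y, hy, p.concat h, by simpa using hp⟩

/-- The standard tool for confining balls: any growing sequence of sets that absorbs neighbours will
do. The conditions are required only for indices below `r`, so facts that hold only near `Y` can be
used to verify them. -/
lemma ballOf_induction {Y : Set V} {r : ℕ} (S : ℕ → Set V) (h0 : Y ⊆ S 0)
    (hmono : ∀ t < r, S t ⊆ S (t + 1))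
    (hstep : ∀ t < r, ∀ u ∈ S t, ∀ v, G.Adj u v → v ∈ S (t + 1)) : G.ballOf Y r ⊆ S r := by
  induction r with
  | zero =>
    rintro v ⟨y, hy, p, hp⟩
    have := Walk.eq_of_length_eq_zero (Nat.le_zero.1 hp)
    exact this ▸ h0 hy
  | succ r ih =>
    have ih' := ih (fun t ht => hmono t (by omega)) (fun t ht => hstep t (by omega))
    rintro v ⟨y, hy, p, hp⟩
    rcases Nat.lt_or_ge r p.length with h | h
    · have hnil : ¬ p.Nil := by
        intro hn
        rw [← Walk.length_eq_zero_iff] at hn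
        omega
      refine hstep r (by omega) p.penultimate (ih' ⟨y, hy, p.dropLast, ?_⟩) v
        (p.adj_penultimate hnil)
      have := congrArg Walk.length (p.concat_dropLast (p.adj_penultimate hnil))
      rw [Walk.length_concat] at this
      omega
    · exact hmono r (by omega) (ih' ⟨y, hy, p, h⟩)

lemma ballOf_succ_cases {Y : Set V} {r : ℕ} {v : V} (h : v ∈ G.ballOf Y (r + 1)) :
    v ∈ G.ballOf Y r ∨ ∃ u ∈ G.ballOf Y r, G.Adj u v := by
  obtain ⟨y, hy, p, hp⟩ := h
  by_cases hn : p.Nil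
  · left
    rw [← Walk.length_eq_zero_iff] at hn
    exact ⟨y, hy, p, by omega⟩
  · right
    refine ⟨p.penultimate, ⟨y, hy, p.dropLast, ?_⟩, p.adj_penultimate hn⟩
    have := congrArg Walk.length (p.concat_dropLast (p.adj_penultimate hn))
    rw [Walk.length_concat] at this
    omega

lemma ballOf_zero (Y : Set V) : G.ballOf Y 0 = Y := by
  refine Set.Subset.antisymm ?_ (subset_ballOf Y 0)
  rintro v ⟨y, hy, p, hp⟩
  exact Walk.eq_of_length_eq_zero (Nat.le_zero.1 hp) ▸ hy

lemma ballOf_ballOf (Y : Set V) (r s : ℕ) : G.ballOf (G.ballOf Y r) s ⊆ G.ballOf Y (r + s) := by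
  rintro v ⟨x, ⟨y, hy, p, hp⟩, q, hq⟩
  exact ⟨y, hy, p.append q, by rw [Walk.length_append]; omega⟩

lemma mem_ballOf_singleton_iff (hG : G.Connected) {x v : V} {r : ℕ} :
    v ∈ G.ballOf {x} r ↔ G.dist x v ≤ r := by
  constructor
  · rintro ⟨y, rfl, p, hp⟩
    exact (dist_le p).trans hp
  · intro h
    obtain ⟨p, hp⟩ := hG.exists_walk_length_eq_dist x v
    exact ⟨x, rfl, p, hp ▸ h⟩

/-- Graphs that agree on the vertices of a ball have the same balls inside. -/
lemma ballOf_congr {Y Z : Set V} {r T : ℕ}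
    (h : ∀ u ∈ G.ballOf Z T, ∀ v, G.Adj u v ↔ G'.Adj u v) (hYZ : Y ⊆ Z) (hr : r ≤ T) :
    G'.ballOf Y r = G.ballOf Y r := by
  induction r with
  | zero => rw [ballOf_zero, ballOf_zero]
  | succ r ih =>
    have ih := ih (by omega)
    ext v
    constructor
    · intro hv
      rcases ballOf_succ_cases hv with hv | ⟨u, hu, huv⟩
      · exact ballOf_mono le_rfl (Nat.le_succ r) (ih ▸ hv)
      · rw [ih] at hu
        exact ballOf_step hu ((h u (ballOf_mono hYZ (by omega) hu) v).2 huv)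
    · intro hv
      rcases ballOf_succ_cases hv with hv | ⟨u, hu, huv⟩
      · exact ballOf_mono le_rfl (Nat.le_succ r) (ih.symm ▸ hv)
      · have hu' := hu
        rw [← ih] at hu'
        exact ballOf_step hu' ((h u (ballOf_mono hYZ (by omega) hu) v).1 huv)

/-! ### Rooted trees -/

/-- Both neighbours are the penultimate vertex of a shortest path from `r` to `u`, and paths in a
tree are unique. -/
lemma IsTree.parent_unique (hG : G.IsTree) {r u v w : V} (hv : G.Adj u v) (hw : G.Adj u w)
    (hdv : G.dist r v < G.dist r u) (hdw : G.dist r w < G.dist r u) : v = w := by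
  have key : ∀ x, G.Adj u x → G.dist r x < G.dist r u →
      ∃ p : G.Walk r u, p.IsPath ∧ p.penultimate = x := by
    intro x hx hdx
    obtain ⟨p, hp, hl⟩ := hG.connected.exists_path_of_dist r x
    refine ⟨p.concat hx.symm, ?_, by simp⟩
    have h1 := dist_le (p.concat hx.symm)
    apply Walk.isPath_of_length_eq_dist
    rw [Walk.length_concat] at *
    have := hG.connected.dist_triangle (u := r) (v := x) (w := u)
    omega
  obtain ⟨p, hp, rfl⟩ := key v hv hdv
  obtain ⟨q, hq, rfl⟩ := key w hw hdw
  have := (hG.isAcyclic.subsingleton_path _ _).elim ⟨p, hp⟩ ⟨q, hq⟩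
  rw [Subtype.mk.injEq] at this
  rw [this]

lemma IsTree.dist_child (hG : G.IsTree) {r u v w : V} (hv : G.Adj u v) (hw : G.Adj u w)
    (hvw : v ≠ w) (hdv : G.dist r v < G.dist r u) : G.dist r w = G.dist r u + 1 := by
  rcases hG.dist_eq_dist_add_one_of_adj r hw with h | h
  · exact absurd (hG.parent_unique hv hw hdv (by omega)) hvw
  · omega

/-- A sequence of vertices that walks along the edges and never turns back at once. -/
structure NonBacktracking (G : SimpleGraph V) (m : ℕ) (w : ℕ → V) : Prop where
  adj : ∀ s < m, G.Adj (w s) (w (s + 1))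
  ne : ∀ s, s + 2 ≤ m → w (s + 2) ≠ w s

lemma NonBacktracking.mono {m m' : ℕ} {w : ℕ → V} (h : G.NonBacktracking m w) (hm : m' ≤ m) :
    G.NonBacktracking m' w :=
  ⟨fun s hs => h.adj s (by omega), fun s hs => h.ne s (by omega)⟩

lemma NonBacktracking.shift {m j : ℕ} {w : ℕ → V} (h : G.NonBacktracking (j + m) w) :
    G.NonBacktracking m (fun s => w (j + s)) :=
  ⟨fun s hs => h.adj (j + s) (by omega), fun s hs => h.ne (j + s) (by omega)⟩

/-- After a step away from the root the vertex just left is the unique parent. As turning back is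
excluded, the next step leads away as well. -/
lemma NonBacktracking.dist_of_child (hG : G.IsTree) {m : ℕ} {w : ℕ → V}
    (h : G.NonBacktracking m w) {r : V} (h1 : 1 ≤ m → G.dist r (w 0) < G.dist r (w 1)) :
    ∀ s ≤ m, G.dist r (w s) = G.dist r (w 0) + s := by
  intro s
  induction s using Nat.strong_induction_on with
  | _ s ih =>
    intro hs
    match s with
    | 0 => simp
    | 1 =>
      have := h1 hs
      have h01 : G.Adj (w 0) (w 1) := h.adj 0 (by omega)
      rcases hG.dist_eq_dist_add_one_of_adj r h01 with h' | h' <;> omega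
    | s + 2 =>
      have e1 := ih (s + 1) (by omega) (by omega)
      have e0 := ih s (by omega) (by omega)
      have h12 : G.Adj (w (s + 1)) (w (s + 2)) := h.adj (s + 1) (by omega)
      have := hG.dist_child (h.adj s (by omega)).symm h12 (h.ne s hs).symm (r := r) (by omega)
      omega

lemma NonBacktracking.dist_eq (hG : G.IsTree) {m : ℕ} {w : ℕ → V}
    (h : G.NonBacktracking m w) : ∀ s ≤ m, G.dist (w 0) (w s) = s := by
  intro s hs
  have := h.dist_of_child hG (r := w 0) (fun h1 => by
    rw [dist_self]
    exact hG.connected.pos_dist_of_ne (h.adj 0 (by omega)).ne) s hs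
  simpa using this

lemma NonBacktracking.injOn (hG : G.IsTree) {m : ℕ} {w : ℕ → V}
    (h : G.NonBacktracking m w) {s t : ℕ} (hs : s ≤ m) (ht : t ≤ m) (hst : w s = w t) : s = t := by
  have h1 := h.dist_eq hG s hs
  have h2 := h.dist_eq hG t ht
  rw [hst] at h1
  omega

/-- `Q` is connected, with base point `r`. -/
def ConnectedFrom (G : SimpleGraph V) (r : V) (Q : Set V) : Prop :=
  ∀ v ∈ Q, ∃ p : G.Walk r v, ∀ x ∈ p.support, x ∈ Q

/-- A walk to `u` inside `Q` shortens to the unique path from the root, whose penultimate vertex is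
the parent of `u`. -/
lemma ConnectedFrom.parent_mem (hG : G.IsTree) {r : V} {Q : Set V} (hQ : G.ConnectedFrom r Q)
    {u v : V} (hu : u ∈ Q) (h : G.Adj u v) (hd : G.dist r v < G.dist r u) : v ∈ Q := by
  classical
  obtain ⟨p, hp⟩ := hQ u hu
  have hnil : ¬ p.bypass.Nil := by
    intro hn
    have := hn.eq
    subst this
    simp at hd
  have hpath : p.bypass.IsPath := p.bypass_isPath
  have hmem : p.bypass.penultimate ∈ Q :=
    hp _ (p.support_bypass_subset_support (Walk.getVert_mem_support _ _))
  convert hmem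
  refine hG.parent_unique h (p.bypass.adj_penultimate hnil).symm hd ?_
  obtain ⟨q, hq, hl⟩ := hG.connected.exists_path_of_dist r u
  have e := (hG.isAcyclic.subsingleton_path _ _).elim ⟨p.bypass, hpath⟩ ⟨q, hq⟩
  rw [Subtype.mk.injEq] at e
  have h1 := congrArg Walk.length (p.bypass.concat_dropLast (p.bypass.adj_penultimate hnil))
  rw [Walk.length_concat] at h1
  have h2 := dist_le p.bypass.dropLast
  rw [e, hl] at h1
  rw [e] at h2 ⊢
  omega

lemma ConnectedFrom.ballOf {r : V} {Q : Set V} (hQ : G.ConnectedFrom r Q) (s : ℕ) :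
    G.ConnectedFrom r (G.ballOf Q s) := by
  intro v hv
  have : G.ballOf Q s ⊆ {v | ∃ p : G.Walk r v, ∀ x ∈ p.support, x ∈ G.ballOf Q s} := by
    have key := ballOf_induction (G := G) (Y := Q) (r := s)
      (fun t => {v | v ∈ G.ballOf Q t ∧ ∃ p : G.Walk r v, ∀ x ∈ p.support, x ∈ G.ballOf Q t}) ?_ ?_ ?_
    · exact fun v hv => (key hv).2
    · intro v hv
      obtain ⟨p, hp⟩ := hQ v hv
      exact ⟨subset_ballOf _ _ hv, p, fun x hx => subset_ballOf _ _ (hp x hx)⟩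
    · rintro t - v ⟨hv, p, hp⟩
      exact ⟨ballOf_mono le_rfl (Nat.le_succ t) hv, p,
        fun x hx => ballOf_mono le_rfl (Nat.le_succ t) (hp x hx)⟩
    · rintro t - u ⟨hu, p, hp⟩ v huv
      refine ⟨ballOf_step hu huv, p.concat huv, fun x hx => ?_⟩
      rw [Walk.support_concat, List.mem_append, List.mem_singleton] at hx
      rcases hx with hx | rfl
      · exact ballOf_mono le_rfl (Nat.le_succ t) (hp x hx)
      · exact ballOf_step hu huv
  exact this hv

/-- In a tree, a walk that leaves a connected set and does not turn back moves away from it. -/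
lemma NonBacktracking.notMem_ballOf (hG : G.IsTree) {m : ℕ} {w : ℕ → V}
    (h : G.NonBacktracking m w) {r : V} {Q : Set V} (hQ : G.ConnectedFrom r Q)
    (h0 : w 0 ∈ Q) (h1 : w 1 ∉ Q) {j : ℕ} (hj : j + 1 ≤ m) : w (j + 1) ∉ G.ballOf Q j := by
  have hup : G.dist r (w 0) < G.dist r (w 1) := by
    have h01 : G.Adj (w 0) (w 1) := h.adj 0 (by omega)
    rcases hG.dist_eq_dist_add_one_of_adj r h01 with h' | h'
    · exact absurd (hQ.parent_mem hG h0 h01 (by omega)) h1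
    · omega
  have hd := h.dist_of_child hG (r := r) (fun _ => hup)
  have hout : ∀ s, 1 ≤ s → s ≤ m → w s ∉ Q := by
    intro s hs
    induction s, hs using Nat.le_induction with
    | base => exact fun _ => h1
    | succ s hs ih =>
      intro hsm hmem
      refine ih (by omega) (hQ.parent_mem hG hmem (h.adj s (by omega)).symm ?_)
      rw [hd s (by omega), hd (s + 1) hsm]
      omega
  -- the vertices from which the root direction leads into `Q` in at most `t` steps
  have key : ∀ s, 1 ≤ s → s ≤ m → ∀ t, ∀ v ∈ G.ballOf Q t, v = w s → s ≤ t := by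
    let S : ℕ → Set V := fun t => {v | ∀ u : ℕ → V, u 0 = v →
      (∀ i < t, u i ∉ Q → G.Adj (u i) (u (i + 1)) ∧ G.dist r (u (i + 1)) < G.dist r (u i)) →
      ∃ i ≤ t, u i ∈ Q}
    have hS : ∀ t, G.ballOf Q t ⊆ S t := by
      intro t
      apply ballOf_induction
      · intro v hv u hu _
        exact ⟨0, le_rfl, hu ▸ hv⟩
      · intro t _ v hv u hu hu'
        obtain ⟨i, hi, hiQ⟩ := hv u hu (fun i hi => hu' i (by omega))
        exact ⟨i, by omega, hiQ⟩
      · intro t _ v hv x hvx u hu hu'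
        by_cases hx : x ∈ Q
        · exact ⟨0, by omega, hu ▸ hx⟩
        have h0 := hu' 0 (by omega) (hu ▸ hx)
        rcases hG.dist_eq_dist_add_one_of_adj r hvx with hd' | hd'
        · -- `x` is the parent of `v`
          obtain ⟨i, hi, hiQ⟩ := hv (fun i => Nat.casesOn (motive := fun _ => V) i v u) rfl (by
            intro i hi hiQ
            cases i with
            | zero =>
              subst hu
              exact ⟨hvx, by change G.dist r (u 0) < G.dist r v; omega⟩
            | succ i => exact hu' i (by omega) hiQ)
          cases i with
          | zero =>
            exact absurd (hQ.parent_mem hG (u := v) hiQ hvx (by omega)) hx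
          | succ i => exact ⟨i, by omega, hiQ⟩
        · have hv' : u 1 = v := by
            refine hG.parent_unique (r := r) (u := x) (by simpa [hu] using h0.1) hvx.symm ?_ (by omega)
            simpa [hu] using h0.2
          obtain ⟨i, hi, hiQ⟩ := hv (fun i => u (i + 1)) hv'
            (fun i hi hiQ => hu' (i + 1) (by omega) hiQ)
          exact ⟨i + 1, by omega, hiQ⟩
    intro s hs hsm t v hv hvs
    by_contra hlt
    -- Read backwards, `w` is a chain of parents. Within `t < s` steps it only visits indices at
    -- least 1, and these vertices lie outside `Q`.
    obtain ⟨i, hi, hiQ⟩ := hS t hv (fun i => w (s - i)) (by simp [hvs]) (by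
      intro i hi _
      have e : s - i = (s - (i + 1)) + 1 := by omega
      constructor
      · have := h.adj (s - (i + 1)) (by omega)
        rw [← e] at this
        exact this.symm
      · have e1 := hd (s - (i + 1)) (by omega)
        have e2 := hd (s - i) (by omega)
        change G.dist r (w (s - (i + 1))) < G.dist r (w (s - i))
        omega)
    exact hout (s - i) (by omega) (by omega) hiQ
  intro hmem
  have := key (j + 1) (by omega) hj j _ hmem rfl
  omega

end SimpleGraph

lemma mem_nbrs {V : Type*} [Finite V] {G : SimpleGraph V} {u v : V} :
    u ∈ nbrs G v ↔ G.Adj v u := by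
  simp [nbrs]

lemma card_nbrs_eq {V : Type*} [Finite V] {G G' : SimpleGraph V} {v : V}
    (h : ∀ w, G.Adj v w ↔ G'.Adj v w) : nbrs G v = nbrs G' v := by
  ext w
  rw [mem_nbrs, mem_nbrs, h]

lemma card_nbrs_exchange {V : Type*} [Finite V] {G G' : SimpleGraph V} {v o w : V}
    (ho : G.Adj v o) (hw : ¬ G.Adj v w)
    (h : ∀ x, G'.Adj v x ↔ (G.Adj v x ∧ x ≠ o) ∨ x = w) :
    (nbrs G' v).card = (nbrs G v).card := by
  classical
  have : nbrs G' v = insert w ((nbrs G v).erase o) := by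
    ext x
    rw [mem_nbrs, h, Finset.mem_insert, Finset.mem_erase, mem_nbrs]
    tauto
  rw [this, Finset.card_insert_of_notMem, Finset.card_erase_add_one]
  · exact mem_nbrs.2 ho
  · rw [Finset.mem_erase, mem_nbrs]
    tauto

lemma exists_nbr_ne {V : Type*} [Finite V] {G : SimpleGraph V} {v : V}
    (h : 3 ≤ (nbrs G v).card) (p s : V) : ∃ z, G.Adj v z ∧ z ≠ p ∧ z ≠ s := by
  classical
  have : 0 < (((nbrs G v).erase p).erase s).card := by
    have h1 := Finset.pred_card_le_card_erase (s := nbrs G v) (a := p)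
    have h2 := Finset.pred_card_le_card_erase (s := (nbrs G v).erase p) (a := s)
    omega
  obtain ⟨z, hz⟩ := Finset.card_pos.1 this
  rw [Finset.mem_erase, Finset.mem_erase, mem_nbrs] at hz
  exact ⟨z, hz.2.2, hz.2.1, hz.1⟩

/-! ### Exchanging three edges of a tree -/

namespace SimpleGraph

variable {V : Type*}

lemma isTree_of_connected_of_card_le [Finite V] {G : SimpleGraph V} (h : G.Connected)
    (hc : Nat.card G.edgeSet + 1 ≤ Nat.card V) : G.IsTree :=
  isTree_iff_connected_and_card.2 ⟨h, le_antisymm hc h.card_vert_le_card_edgeSet_add_one⟩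

/-- Every entrance to `B` starts at `a`, so a walk to `a` may be cut off just before it enters `B`
for the first time. -/
lemma exists_walk_avoiding {G : SimpleGraph V} {B : Set V} {a b : V}
    (hB : ∀ v w, G.Adj v w → v ∉ B → w ∈ B → v = a ∧ w = b) {v : V} (p : G.Walk v a)
    (hv : v ∉ B) (ha : a ∉ B) : ∃ q : G.Walk v a, ∀ x ∈ q.support, x ∉ B := by
  induction p with
  | nil => exact ⟨Walk.nil, by simpa using ha⟩
  | @cons u v w h p ih =>
    by_cases hvB : v ∈ B
    · obtain ⟨rfl, -⟩ := hB u v h hv hvB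
      exact ⟨Walk.nil, by simpa using ha⟩
    · obtain ⟨q, hq⟩ := ih hB hvB ha
      refine ⟨Walk.cons h q, ?_⟩
      intro x hx
      rw [Walk.support_cons, List.mem_cons] at hx
      rcases hx with rfl | hx
      · exact hv
      · exact hq x hx

/-- For all neighbours `z` of `y` but one there is a walk from `y` to `a` outside `B` that does
not use the edge `yz`. -/
lemma exists_walk_avoiding_edge {G : SimpleGraph V} (hG : G.Connected) {B : Set V} {a b y : V}
    (hB : ∀ v w, G.Adj v w → v ∉ B → w ∈ B → v = a ∧ w = b) (hy : y ∉ B) (ha : a ∉ B) :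
    ∃ s, ∀ z, z ≠ s → ∃ q : G.Walk y a, (∀ x ∈ q.support, x ∉ B) ∧ s(y, z) ∉ q.edges := by
  classical
  obtain ⟨p⟩ := hG.preconnected y a
  obtain ⟨q, hq⟩ := exists_walk_avoiding hB p hy ha
  -- A path uses only one edge at its first vertex, so its second vertex is the only exception.
  refine ⟨q.bypass.snd, fun z hz => ⟨q.bypass, ?_, ?_⟩⟩
  · exact fun x hx => hq x (q.support_bypass_subset_support hx)
  · intro h
    exact hz (q.bypass_isPath.eq_snd_of_mem_edges h)

/-- Replace the edges `yz`, `y'z'`, `ab` by `yy'`, `az`, `bz'`. -/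
def switch (G : SimpleGraph V) (y z y' z' a b : V) : SimpleGraph V :=
  fromEdgeSet ((G.edgeSet \ {s(y, z), s(y', z'), s(a, b)}) ∪ {s(y, y'), s(a, z), s(b, z')})

/-- The situation in which a switch of edges is carried out: `ab` is the only edge between `B`
and its complement, the edge `yz` lies outside `B`, the edge `y'z'` inside `B`, and one can get
from `y` to `a` and from `y'` to `b` without using these edges. -/
structure IsSwitch (G : SimpleGraph V) (B : Set V) (y z y' z' a b : V) : Prop where
  yz : G.Adj y z
  yz' : G.Adj y' z'
  ab : G.Adj a b
  hy : y ∉ B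
  hz : z ∉ B
  ha : a ∉ B
  hy' : y' ∈ B
  hz' : z' ∈ B
  hb : b ∈ B
  ya : y ≠ a
  za : z ≠ a
  yb' : y' ≠ b
  zb' : z' ≠ b
  naz : ¬ G.Adj a z
  nbz : ¬ G.Adj b z'
  cross : ∀ v w, G.Adj v w → v ∉ B → w ∈ B → v = a ∧ w = b
  walk : ∃ q : G.Walk y a, (∀ x ∈ q.support, x ∉ B) ∧ s(y, z) ∉ q.edges
  walk' : ∃ q : G.Walk y' b, (∀ x ∈ q.support, x ∈ B) ∧ s(y', z') ∉ q.edges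

namespace IsSwitch

variable {G : SimpleGraph V} {B : Set V} {y z y' z' a b : V}

lemma nyy (h : G.IsSwitch B y z y' z' a b) : ¬ G.Adj y y' :=
  fun hh => h.ya (h.cross _ _ hh h.hy h.hy').1

lemma adj_iff (h : G.IsSwitch B y z y' z' a b) (v w : V) :
    (G.switch y z y' z' a b).Adj v w ↔
      (G.Adj v w ∧ s(v, w) ≠ s(y, z) ∧ s(v, w) ≠ s(y', z') ∧ s(v, w) ≠ s(a, b)) ∨
      s(v, w) = s(y, y') ∨ s(v, w) = s(a, z) ∨ s(v, w) = s(b, z') := by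
  rw [switch, fromEdgeSet_adj]
  simp only [Set.mem_union, Set.mem_sdiff, mem_edgeSet, Set.mem_insert_iff, Set.mem_singleton_iff,
    not_or]
  constructor
  · exact fun h => h.1
  · intro hh
    refine ⟨hh, ?_⟩
    rcases hh with hh | hh | hh | hh
    · exact hh.1.ne
    all_goals
      rintro rfl
      rw [eq_comm, Sym2.eq_iff] at hh
    · obtain ⟨rfl, rfl⟩ | ⟨rfl, rfl⟩ := hh <;> exact h.hy h.hy'
    · obtain ⟨e1, e2⟩ | ⟨e1, e2⟩ := hh
      · exact h.za (e2.trans e1.symm)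
      · exact h.za (e2.trans e1.symm)
    · obtain ⟨e1, e2⟩ | ⟨e1, e2⟩ := hh
      · exact h.zb' (e2.trans e1.symm)
      · exact h.zb' (e2.trans e1.symm)

lemma adj_of_ne (h : G.IsSwitch B y z y' z' a b) {v : V} (hv : v ∉ ({y, z, y', z', a, b} : Set V))
    (w : V) : (G.switch y z y' z' a b).Adj v w ↔ G.Adj v w := by
  rw [h.adj_iff]
  simp only [Set.mem_insert_iff, Set.mem_singleton_iff, not_or] at hv
  simp only [ne_eq, Sym2.eq_iff]
  grind

lemma adj_y (h : G.IsSwitch B y z y' z' a b) (w : V) :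
    (G.switch y z y' z' a b).Adj y w ↔ (G.Adj y w ∧ w ≠ z) ∨ w = y' := by
  rw [h.adj_iff]
  have h1 := h.yz.ne
  have h2 : y ≠ y' := fun e => h.hy (e ▸ h.hy')
  have h3 : y ≠ z' := fun e => h.hy (e ▸ h.hz')
  have h4 : y ≠ b := fun e => h.hy (e ▸ h.hb)
  have h5 := h.ya
  simp only [ne_eq, Sym2.eq_iff]
  grind

lemma adj_z (h : G.IsSwitch B y z y' z' a b) (w : V) :
    (G.switch y z y' z' a b).Adj z w ↔ (G.Adj z w ∧ w ≠ y) ∨ w = a := by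
  rw [h.adj_iff]
  have h1 := h.yz.ne
  have h2 : z ≠ y' := fun e => h.hz (e ▸ h.hy')
  have h3 : z ≠ z' := fun e => h.hz (e ▸ h.hz')
  have h4 : z ≠ b := fun e => h.hz (e ▸ h.hb)
  have h5 := h.za
  simp only [ne_eq, Sym2.eq_iff]
  grind

lemma adj_a (h : G.IsSwitch B y z y' z' a b) (w : V) :
    (G.switch y z y' z' a b).Adj a w ↔ (G.Adj a w ∧ w ≠ b) ∨ w = z := by
  rw [h.adj_iff]
  have h1 := h.ya
  have h2 : a ≠ y' := fun e => h.ha (e ▸ h.hy')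
  have h3 : a ≠ z' := fun e => h.ha (e ▸ h.hz')
  have h4 : a ≠ b := fun e => h.ha (e ▸ h.hb)
  have h5 := h.za
  simp only [ne_eq, Sym2.eq_iff]
  grind

lemma adj_y' (h : G.IsSwitch B y z y' z' a b) (w : V) :
    (G.switch y z y' z' a b).Adj y' w ↔ (G.Adj y' w ∧ w ≠ z') ∨ w = y := by
  rw [h.adj_iff]
  have h1 := h.yz'.ne
  have h2 : y' ≠ y := fun e => h.hy (e ▸ h.hy')
  have h3 : y' ≠ z := fun e => h.hz (e ▸ h.hy')
  have h4 : y' ≠ a := fun e => h.ha (e ▸ h.hy')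
  have h5 := h.yb'
  simp only [ne_eq, Sym2.eq_iff]
  grind

lemma adj_z' (h : G.IsSwitch B y z y' z' a b) (w : V) :
    (G.switch y z y' z' a b).Adj z' w ↔ (G.Adj z' w ∧ w ≠ y') ∨ w = b := by
  rw [h.adj_iff]
  have h1 := h.yz'.ne
  have h2 : z' ≠ y := fun e => h.hy (e ▸ h.hz')
  have h3 : z' ≠ z := fun e => h.hz (e ▸ h.hz')
  have h4 : z' ≠ a := fun e => h.ha (e ▸ h.hz')
  have h5 := h.zb'
  simp only [ne_eq, Sym2.eq_iff]
  grind

lemma adj_b (h : G.IsSwitch B y z y' z' a b) (w : V) :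
    (G.switch y z y' z' a b).Adj b w ↔ (G.Adj b w ∧ w ≠ a) ∨ w = z' := by
  rw [h.adj_iff]
  have h1 := h.yb'
  have h2 : b ≠ y := fun e => h.hy (e ▸ h.hb)
  have h3 : b ≠ z := fun e => h.hz (e ▸ h.hb)
  have h4 : b ≠ a := fun e => h.ha (e ▸ h.hb)
  have h5 := h.zb'
  simp only [ne_eq, Sym2.eq_iff]
  grind

/-- Each of the six vertices loses one neighbour and gains a new one. -/
lemma card_nbrs [Finite V] (h : G.IsSwitch B y z y' z' a b) (v : V) :
    (nbrs (G.switch y z y' z' a b) v).card = (nbrs G v).card := by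
  by_cases hv : v ∈ ({y, z, y', z', a, b} : Set V)
  · simp only [Set.mem_insert_iff, Set.mem_singleton_iff] at hv
    rcases hv with rfl | rfl | rfl | rfl | rfl | rfl
    · exact card_nbrs_exchange h.yz h.nyy h.adj_y
    · exact card_nbrs_exchange h.yz.symm (fun hh => h.naz hh.symm) h.adj_z
    · exact card_nbrs_exchange h.yz' (fun hh => h.nyy hh.symm) h.adj_y'
    · exact card_nbrs_exchange h.yz'.symm (fun hh => h.nbz hh.symm) h.adj_z'
    · exact card_nbrs_exchange h.ab h.naz h.adj_a
    · exact card_nbrs_exchange h.ab.symm h.nbz h.adj_b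
  · rw [card_nbrs_eq (h.adj_of_ne hv)]

/-- The walks from `y` to `a` and from `y'` to `b` survive, and the new edges attach `z` to `a`,
`z'` to `b` and `y` to `y'`. So the six vertices remain in one piece, and every deleted edge joins
two of them. -/
lemma connected (h : G.IsSwitch B y z y' z' a b) (hG : G.Connected) :
    (G.switch y z y' z' a b).Connected := by
  set G' := G.switch y z y' z' a b with hG'
  have hyy : G'.Adj y y' := (h.adj_y y').2 (Or.inr rfl)
  have haz : G'.Adj a z := (h.adj_a z).2 (Or.inr rfl)
  have hbz : G'.Adj b z' := (h.adj_b z').2 (Or.inr rfl)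
  have hya : G'.Reachable y a := by
    obtain ⟨q, hq, hq'⟩ := h.walk
    refine ⟨q.transfer G' ?_⟩
    intro e he
    induction e with
    | _ u v =>
      rw [mem_edgeSet, h.adj_iff]
      have hu := hq u (q.fst_mem_support_of_mem_edges he)
      have hv := hq v (q.snd_mem_support_of_mem_edges he)
      refine Or.inl ⟨q.adj_of_mem_edges he, fun e => hq' (e ▸ he), ?_, ?_⟩
      · intro e
        rcases Sym2.eq_iff.1 e with ⟨rfl, -⟩ | ⟨-, rfl⟩
        · exact hu h.hy'
        · exact hv h.hy'
      · intro e
        rcases Sym2.eq_iff.1 e with ⟨-, rfl⟩ | ⟨rfl, -⟩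
        · exact hv h.hb
        · exact hu h.hb
  have hyb : G'.Reachable y' b := by
    obtain ⟨q, hq, hq'⟩ := h.walk'
    refine ⟨q.transfer G' ?_⟩
    intro e he
    induction e with
    | _ u v =>
      rw [mem_edgeSet, h.adj_iff]
      have hu := hq u (q.fst_mem_support_of_mem_edges he)
      have hv := hq v (q.snd_mem_support_of_mem_edges he)
      refine Or.inl ⟨q.adj_of_mem_edges he, ?_, fun e => hq' (e ▸ he), ?_⟩
      · intro e
        rcases Sym2.eq_iff.1 e with ⟨rfl, -⟩ | ⟨-, rfl⟩
        · exact h.hy hu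
        · exact h.hy hv
      · intro e
        rcases Sym2.eq_iff.1 e with ⟨rfl, -⟩ | ⟨-, rfl⟩
        · exact h.ha hu
        · exact h.ha hv
  have key : ∀ v, G'.Reachable v y := by
    have hz : G'.Reachable z y := (hya.trans haz.reachable).symm
    have hy' : G'.Reachable y' y := hyy.symm.reachable
    have hb : G'.Reachable b y := hyb.symm.trans hy'
    have hz' : G'.Reachable z' y := hbz.symm.reachable.trans hb
    have step : ∀ u v, G.Adj u v → G'.Reachable v y → G'.Reachable u y := by
      intro u v huv hv
      by_cases hr : s(u, v) ≠ s(y, z) ∧ s(u, v) ≠ s(y', z') ∧ s(u, v) ≠ s(a, b)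
      · exact ((h.adj_iff u v).2 (Or.inl ⟨huv, hr⟩)).reachable.trans hv
      · have : u ∈ ({y, z, y', z', a, b} : Set V) := by
          by_contra hu
          simp only [Set.mem_insert_iff, Set.mem_singleton_iff, not_or] at hu
          simp only [ne_eq, Sym2.eq_iff] at hr
          tauto
        simp only [Set.mem_insert_iff, Set.mem_singleton_iff] at this
        rcases this with rfl | rfl | rfl | rfl | rfl | rfl
        · exact Reachable.rfl
        · exact hz
        · exact hy'
        · exact hz'
        · exact hya.symm
        · exact hb
    have walk : ∀ u v, G.Walk u v → G'.Reachable v y → G'.Reachable u y := by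
      intro u v p hv
      induction p with
      | nil => exact hv
      | cons hh _ ih => exact step _ _ hh (ih hv)
    intro v
    obtain ⟨p⟩ := hG.preconnected v y
    exact walk v y p Reachable.rfl
  have := hG.nonempty
  exact ⟨fun u v => (key u).trans (key v).symm⟩

/-- Three distinct edges are removed and at most three are added, so the connected graph has no more
edges than a tree. -/
lemma isTree [Finite V] (h : G.IsSwitch B y z y' z' a b) (hG : G.IsTree) :
    (G.switch y z y' z' a b).IsTree := by
  refine isTree_of_connected_of_card_le (h.connected hG.connected) ?_
  rw [← (isTree_iff_connected_and_card.1 hG).2, Nat.card_coe_set_eq, Nat.card_coe_set_eq]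
  have h1 : s(y, z) ≠ s(y', z') := by
    rw [ne_eq, Sym2.eq_iff]
    rintro (⟨rfl, -⟩ | ⟨rfl, -⟩)
    · exact h.hy h.hy'
    · exact h.hy h.hz'
  have h2 : s(y, z) ≠ s(a, b) := by
    rw [ne_eq, Sym2.eq_iff]
    rintro (⟨rfl, -⟩ | ⟨rfl, -⟩)
    · exact h.ya rfl
    · exact h.hy h.hb
  have h3 : s(y', z') ≠ s(a, b) := by
    rw [ne_eq, Sym2.eq_iff]
    rintro (⟨rfl, -⟩ | ⟨-, rfl⟩)
    · exact h.ha h.hy'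
    · exact h.ha h.hz'
  have e3 : ({s(y, z), s(y', z'), s(a, b)} : Set (Sym2 V)).ncard = 3 :=
    Set.ncard_eq_three.2 ⟨_, _, _, h1, h2, h3, rfl⟩
  have hsub : ({s(y, z), s(y', z'), s(a, b)} : Set (Sym2 V)) ⊆ G.edgeSet := by
    rintro e (rfl | rfl | rfl)
    exacts [h.yz, h.yz', h.ab]
  have e4 : ({s(y, y'), s(a, z), s(b, z')} : Set (Sym2 V)).ncard ≤ 3 :=
    (Set.ncard_insert_le _ _).trans (Nat.succ_le_succ ((Set.ncard_insert_le _ _).trans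
      (by rw [Set.ncard_singleton])))
  have e5 := Set.ncard_sdiff_add_ncard_of_subset hsub (Set.toFinite _)
  have e6 := Set.ncard_union_le (G.edgeSet \ {s(y, z), s(y', z'), s(a, b)})
    {s(y, y'), s(a, z), s(b, z')}
  have e7 : (G.switch y z y' z' a b).edgeSet.ncard ≤
      ((G.edgeSet \ {s(y, z), s(y', z'), s(a, b)}) ∪ {s(y, y'), s(a, z), s(b, z')}).ncard := by
    refine Set.ncard_le_ncard ?_ (Set.toFinite _)
    rw [switch, edgeSet_fromEdgeSet]
    exact Set.sdiff_subset
  omega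

end IsSwitch

end SimpleGraph

/-! ### Views -/

section Views

variable {L : Type*} {n : ℕ}

lemma spanningCoe_induce_adj {V : Type*} {G : SimpleGraph V} {s : Set V} {u v : V} :
    (G.induce s).spanningCoe.Adj u v ↔ u ∈ s ∧ v ∈ s ∧ G.Adj u v := by
  simp only [SimpleGraph.map_adj, SimpleGraph.comap_adj, Function.Embedding.subtype_apply]
  constructor
  · rintro ⟨a, b, hab, rfl, rfl⟩
    exact ⟨a.2, b.2, hab⟩
  · rintro ⟨hu, hv, huv⟩
    exact ⟨⟨u, hu⟩, ⟨v, hv⟩, huv, rfl, rfl⟩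

lemma seenNodes_eq_ballOf (T : ℕ) (G : SimpleGraph (Fin n)) (σ : Equiv.Perm (Fin n)) (i : Fin n) :
    seenNodes T G σ i = G.ballOf {v | ∃ j ≤ i, σ j = v} T := by
  ext u
  constructor
  · rintro ⟨j, hj, p, hp⟩
    exact ⟨_, ⟨j, hj, rfl⟩, p, hp⟩
  · rintro ⟨_, ⟨j, hj, rfl⟩, p, hp⟩
    exact ⟨j, hj, p, hp⟩

/-- Two executions in which the same nodes are revealed up to `σ i` and in which the graphs agree
around these nodes give the same output at `σ i`. -/
lemma RandOnlineLocalAlg.run_eq (A : RandOnlineLocalAlg L) {G G' : SimpleGraph (Fin n)}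
    {σ σ' : Equiv.Perm (Fin n)} {i : Fin n} (hσ : ∀ j ≤ i, σ j = σ' j)
    (h : ∀ u ∈ G.ballOf {v | ∃ j ≤ i, σ j = v} (A.locality n), ∀ v, G.Adj u v ↔ G'.Adj u v)
    (ω : ℕ → Bool) : A.run G σ ω (σ i) = A.run G' σ' ω (σ i) := by
  have hset : {v | ∃ j ≤ i, σ j = v} = {v | ∃ j ≤ i, σ' j = v} := by
    ext v
    constructor
    · rintro ⟨j, hj, rfl⟩
      exact ⟨j, hj, (hσ j hj).symm⟩
    · rintro ⟨j, hj, rfl⟩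
      exact ⟨j, hj, hσ j hj⟩
  have hseen : seenNodes (A.locality n) G σ i = seenNodes (A.locality n) G' σ' i := by
    rw [seenNodes_eq_ballOf, seenNodes_eq_ballOf, ← hset]
    exact (SimpleGraph.ballOf_congr h subset_rfl le_rfl).symm
  have hview : onlineView (A.locality n) G σ i = onlineView (A.locality n) G' σ' i := by
    unfold onlineView
    congr 1
    · refine List.map_congr_left fun j hj => hσ j ?_
      rw [List.mem_take_iff_getElem] at hj
      obtain ⟨m, hm, rfl⟩ := hj
      rw [Fin.le_def, List.getElem_finRange]
      simp only [Fin.val_cast]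
      omega
    · ext u v
      rw [← hseen, spanningCoe_induce_adj, spanningCoe_induce_adj]
      refine and_congr_right fun hu => and_congr_right fun _ => h u ?_ v
      rwa [seenNodes_eq_ballOf] at hu
  unfold run
  have e : σ'.symm (σ i) = i := by rw [hσ i le_rfl, Equiv.symm_apply_apply]
  rw [Equiv.symm_apply_apply, e, hview]

/-- A permutation extending finitely many prescribed values, which then lists the elements of a
larger set first. -/
lemma exists_perm_extend (σ : Equiv.Perm (Fin n)) {p : ℕ} (hp : p ≤ n) (s : Finset (Fin n))
    (hs : ∀ j : Fin n, j.val < p → σ j ∈ s) :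
    ∃ (σ' : Equiv.Perm (Fin n)) (p' : ℕ), p ≤ p' ∧ p' ≤ n ∧
      (∀ j : Fin n, j.val < p → σ' j = σ j) ∧
      ∀ v, v ∈ s ↔ ∃ j : Fin n, j.val < p' ∧ σ' j = v := by
  classical
  have hsn : s.card ≤ n := by simpa using Finset.card_le_univ s
  have hps : p ≤ s.card := by
    have := Finset.card_le_card_of_injOn (s := (Finset.univ : Finset (Fin p))) (t := s)
      (fun j => σ (Fin.castLE hp j)) (fun j _ => hs _ j.2)
      (fun a _ b _ hab => by simpa using hab)
    simpa using this
  -- `g` enumerates `s`, beginning with the prescribed values; `τ` below continues `g` to a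
  -- permutation.
  obtain ⟨g, hg⟩ := Finset.exists_equiv_extend_of_card_eq (α := Fin s.card) (t := s) (by simp)
    (s := {j | j.val < p}) (f := fun j => σ (Fin.castLE hsn j))
    (by
      intro v hv
      obtain ⟨j, hj, rfl⟩ := Finset.mem_image.1 hv
      exact hs _ (by simpa using hj))
    (fun a _ b _ hab => by simpa using hab)
  obtain ⟨τ, hτ⟩ := Finset.exists_equiv_extend_of_card_eq (α := Fin n)
    (t := (Finset.univ : Finset (Fin n))) (by simp)
    (s := {j | j.val < s.card})
    (f := fun j => if h : j.val < s.card then (g ⟨j.val, h⟩ : Fin n) else j)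
    (Finset.subset_univ _)
    (by
      intro a ha b hb hab
      have ha' : a.val < s.card := by simpa using ha
      have hb' : b.val < s.card := by simpa using hb
      simp only [ha', hb', dite_true] at hab
      have := g.injective (Subtype.ext hab)
      rw [Fin.mk.injEq] at this
      exact Fin.ext this)
  have hτ' : ∀ (j : Fin n) (h : j.val < s.card), (τ j : Fin n) = g ⟨j.val, h⟩ := by
    intro j h
    rw [hτ j (by simpa using h), dif_pos h]
  refine ⟨τ.trans (Equiv.subtypeUnivEquiv (by simp)), s.card, hps, hsn, ?_, ?_⟩
  · intro j hj
    change (τ j : Fin n) = σ j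
    rw [hτ' j (by omega), hg _ (by simpa using hj)]
    rfl
  · intro v
    constructor
    · intro hv
      refine ⟨Fin.castLE hsn (g.symm ⟨v, hv⟩), (g.symm ⟨v, hv⟩).2, ?_⟩
      change (τ _ : Fin n) = v
      rw [hτ' _ (g.symm ⟨v, hv⟩).2]
      simp
    · rintro ⟨j, hj, rfl⟩
      change (τ j : Fin n) ∈ s
      rw [hτ' j hj]
      exact (g _).2

end Views

/-! ### Counting in regular trees -/

lemma sum_card_nbrs {V : Type*} [Fintype V] {G : SimpleGraph V} (hG : G.IsTree) :
    ∑ v, (nbrs G v).card + 2 = 2 * Fintype.card V := by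
  classical
  have h1 := G.sum_degrees_eq_twice_card_edges
  have h2 := hG.card_edgeFinset
  have h3 : ∀ v, (nbrs G v).card = G.degree v := by
    intro v
    rw [← SimpleGraph.card_neighborFinset_eq_degree]
    congr 1
    ext w
    rw [mem_nbrs, SimpleGraph.mem_neighborFinset]
  simp only [h3]
  omega

/-- The numbers deg v - 1 add up to n - 2, and each of them is 0 or Δ - 1. So if there is any
regular tree on n nodes, then n has the form that is needed for the word trees below. -/
lemma IsRegularTree.dvd {V : Type*} [Fintype V] {Δ : ℕ} {G : SimpleGraph V}
    (h : IsRegularTree Δ G) (hV : 2 ≤ Fintype.card V) :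
    Δ - 1 ∣ Fintype.card V - 2 := by
  have h1 := sum_card_nbrs h.1
  have h2 : ∑ v, ((nbrs G v).card - 1) + Fintype.card V = ∑ v, (nbrs G v).card := by
    have : ∑ v : V, 1 = Fintype.card V := by simp
    rw [← this, ← Finset.sum_add_distrib]
    refine Finset.sum_congr rfl fun v _ => Nat.sub_add_cancel ?_
    have : Nontrivial V := Fintype.one_lt_card_iff_nontrivial.1 hV
    obtain ⟨w, hw⟩ := h.1.connected.preconnected.exists_adj_of_nontrivial v
    exact Finset.card_pos.2 ⟨w, mem_nbrs.2 hw⟩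
  have h3 : Fintype.card V - 2 = ∑ v, ((nbrs G v).card - 1) := by omega
  rw [h3]
  refine Finset.dvd_sum fun v _ => ?_
  rcases h.2 v with h | h <;> rw [h]
  simp

/-! ### Complete trees around a node -/

lemma SimpleGraph.Connected.exists_parent {V : Type*} {G : SimpleGraph V} (hG : G.Connected)
    {x v : V} {m : ℕ} (h : G.dist x v = m + 1) : ∃ u, G.Adj u v ∧ G.dist x u = m := by
  obtain ⟨p, hp⟩ := hG.exists_walk_length_eq_dist x v
  have hnil : ¬ p.Nil := by
    rw [← SimpleGraph.Walk.length_eq_zero_iff]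
    omega
  refine ⟨p.penultimate, p.adj_penultimate hnil, ?_⟩
  have h1 := congrArg SimpleGraph.Walk.length (p.concat_dropLast (p.adj_penultimate hnil))
  rw [SimpleGraph.Walk.length_concat] at h1
  have h2 := SimpleGraph.dist_le p.dropLast
  have h3 := (p.adj_penultimate hnil).diff_dist_adj (u := x)
  omega

/-- Shortest paths from `x` stay in the ball, so distances from `x` are unchanged there; a vertex at
distance `i` keeps only its parent. -/
lemma isCompleteTree_ball {V : Type*} [Finite V] {Δ i : ℕ} {G : SimpleGraph V} (hG : G.IsTree)
    (x : V) (hi : 1 ≤ i) (hdeg : ∀ v, G.dist x v < i → (nbrs G v).card = Δ) :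
    IsCompleteTree Δ i (G.induce {v | G.dist x v ≤ i}) ⟨x, by simp⟩ := by
  classical
  set H := G.induce {v | G.dist x v ≤ i} with hH
  have walk : ∀ m, ∀ v : {v | G.dist x v ≤ i}, G.dist x v = m →
      ∃ p : H.Walk ⟨x, by simp⟩ v, p.length = m := by
    intro m
    induction m with
    | zero =>
      rintro ⟨v, hv⟩ h
      obtain rfl : x = v := (hG.connected.dist_eq_zero_iff).1 h
      exact ⟨SimpleGraph.Walk.nil, rfl⟩
    | succ m ih =>
      rintro ⟨v, hv⟩ h
      obtain ⟨u, huv, hu⟩ := hG.connected.exists_parent h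
      have hv' : G.dist x v ≤ i := hv
      have h' : G.dist x v = m + 1 := h
      obtain ⟨p, hp⟩ := ih ⟨u, by change G.dist x u ≤ i; omega⟩ hu
      have huv' : H.Adj ⟨u, by change G.dist x u ≤ i; omega⟩ ⟨v, hv⟩ := huv
      exact ⟨p.concat huv', by simp [hp]⟩
  have hconn : H.Connected := by
    have : Nonempty {v | G.dist x v ≤ i} := ⟨⟨x, by simp⟩⟩
    refine ⟨fun u v => ?_⟩
    obtain ⟨p, -⟩ := walk _ u rfl
    obtain ⟨q, -⟩ := walk _ v rfl
    exact ⟨p.reverse.append q⟩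
  have hdist : ∀ v, H.dist ⟨x, by simp⟩ v = G.dist x v := by
    intro v
    apply le_antisymm
    · obtain ⟨p, hp⟩ := walk _ v rfl
      exact hp ▸ SimpleGraph.dist_le p
    · obtain ⟨p, hp⟩ := hconn.exists_walk_length_eq_dist ⟨x, by simp⟩ v
      have := SimpleGraph.dist_le (p.map (SimpleGraph.Embedding.induce _).toHom)
      rw [SimpleGraph.Walk.length_map, hp] at this
      exact this
  refine ⟨⟨hconn, hG.isAcyclic.induce _⟩, fun v => ?_, fun v hv => ?_, fun v hv => ?_⟩
  · rw [hdist]; exact v.2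
  · rw [hdist] at hv
    rw [← hdeg v hv, ← Finset.card_map (Function.Embedding.subtype _)]
    congr 1
    ext u
    rw [Finset.mem_map, mem_nbrs]
    constructor
    · rintro ⟨w, hw, rfl⟩
      have hw : H.Adj v w := mem_nbrs.1 hw
      exact hw
    · intro hu
      have := hu.diff_dist_adj (u := x)
      exact ⟨⟨u, by change G.dist x u ≤ i; omega⟩, mem_nbrs.2 hu, rfl⟩
  · rw [hdist] at hv
    obtain ⟨u, huv, hu⟩ := hG.connected.exists_parent (m := i - 1) (by omega : G.dist x v = _)
    rw [Finset.card_eq_one]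
    refine ⟨⟨u, by change G.dist x u ≤ i; omega⟩, ?_⟩
    ext w
    rw [mem_nbrs, Finset.mem_singleton]
    constructor
    · intro hw
      have hw2 : G.dist x w ≤ i := w.2
      have hw' : G.Adj v w := hw
      rcases hG.dist_eq_dist_add_one_of_adj x hw' with h | h
      · have : (w : V) = u := hG.parent_unique hw' huv.symm (r := x) (by omega) (by omega)
        exact Subtype.ext this
      · omega
    · rintro rfl
      exact huv.symm

/-- The labels at a node do not change when the tree is restricted to a ball around which the
node lies in the interior. -/
lemma nodeConfig_induce {V L : Type*} [Finite V] {G : SimpleGraph V} {s : Set V} (ℓ : V → V → L)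
    (v : s) (h : ∀ u, G.Adj v u → u ∈ s) :
    nodeConfig (G.induce s) (fun a b => ℓ a b) v = nodeConfig G ℓ v := by
  unfold nodeConfig
  have : nbrs G v = (nbrs (G.induce s) v).map (Function.Embedding.subtype _) := by
    ext u
    rw [Finset.mem_map, mem_nbrs]
    constructor
    · intro hu
      exact ⟨⟨u, h u hu⟩, mem_nbrs.2 hu, rfl⟩
    · rintro ⟨w, hw, rfl⟩
      have hw : (G.induce s).Adj v w := mem_nbrs.1 hw
      exact hw
  rw [this, Finset.map_val, Multiset.map_map]
  rfl

lemma pair_le_nodeConfig {V L : Type*} [Finite V] {G : SimpleGraph V} {ℓ : V → V → L} {x : V}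
    {α β : L} : ({α, β} : Multiset L) ≤ nodeConfig G ℓ x ↔
      ∃ e f, e ≠ f ∧ G.Adj x e ∧ G.Adj x f ∧ ℓ x e = α ∧ ℓ x f = β := by
  classical
  unfold nodeConfig
  have key : ∀ e ∈ nbrs G x, (nbrs G x).val.map (ℓ x) =
      ℓ x e ::ₘ ((nbrs G x).erase e).val.map (ℓ x) := by
    intro e he
    rw [Finset.erase_val, ← Multiset.map_cons, Multiset.cons_erase he]
  constructor
  · intro h
    have hα : α ∈ (nbrs G x).val.map (ℓ x) := Multiset.mem_of_le h (by simp)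
    obtain ⟨e, he, rfl⟩ := Multiset.mem_map.1 hα
    rw [key e he, Multiset.insert_eq_cons, Multiset.cons_le_cons_iff,
      Multiset.singleton_le] at h
    obtain ⟨f, hf, rfl⟩ := Multiset.mem_map.1 h
    rw [Finset.mem_val, Finset.mem_erase] at hf
    exact ⟨e, f, hf.1.symm, mem_nbrs.1 he, mem_nbrs.1 hf.2, rfl, rfl⟩
  · rintro ⟨e, f, hef, he, hf, rfl, rfl⟩
    rw [key e (mem_nbrs.2 he), Multiset.insert_eq_cons, Multiset.cons_le_cons_iff,
      Multiset.singleton_le]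
    exact Multiset.mem_map.2 ⟨f, Finset.mem_erase.2 ⟨hef.symm, mem_nbrs.2 hf⟩, rfl⟩

namespace UnrootedLCL

variable {L : Type*} (P : UnrootedLCL L)

/-! ### Walks in the automaton -/

variable {P} {W : Set (Sym L P.Δ)}

lemma swap_mem_autNodes {p : L × L} (h : p ∈ P.autNodes W) : p.swap ∈ P.autNodes W := by
  obtain ⟨C, hC, hp⟩ := h
  exact ⟨C, hC, by rwa [Prod.fst_swap, Prod.snd_swap, Multiset.pair_comm]⟩

/-- Reading a labelled path backwards: swapping all pairs reverses the automaton. -/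
lemma autAdj_swap {p q : L × L} (h : P.autAdj W p q) : P.autAdj W q.swap p.swap :=
  ⟨swap_mem_autNodes h.2.1, swap_mem_autNodes h.1, by
    rw [Prod.snd_swap, Prod.fst_swap, Sym2.eq_swap]; exact h.2.2⟩

lemma WalkIn.append {U : Set (L × L)} {m m' : ℕ} {u v w : L × L} (h : P.WalkIn W U m u v)
    (h' : P.WalkIn W U m' v w) : P.WalkIn W U (m + m') u w := by
  induction m generalizing u with
  | zero =>
    obtain ⟨-, rfl⟩ := h
    rwa [Nat.zero_add]
  | succ m ih =>
    obtain ⟨hu, x, hx, hxv⟩ := h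
    rw [Nat.succ_add]
    exact ⟨hu, x, hx, ih hxv⟩

lemma WalkIn.swap {m : ℕ} {u v : L × L} (h : P.WalkIn W Set.univ m u v) :
    P.WalkIn W Set.univ m v.swap u.swap := by
  induction m generalizing u with
  | zero =>
    obtain ⟨-, rfl⟩ := h
    exact ⟨trivial, rfl⟩
  | succ m ih =>
    obtain ⟨hu, x, hx, hxv⟩ := h
    exact (ih hxv).append (m' := 1) ⟨trivial, u.swap, autAdj_swap hx, trivial, rfl⟩

lemma WalkIn.reflTransGen {U : Set (L × L)} {m : ℕ} {u v : L × L} (h : P.WalkIn W U m u v) :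
    Relation.ReflTransGen (P.autAdj W) u v := by
  induction m generalizing u with
  | zero =>
    obtain ⟨-, rfl⟩ := h
    exact Relation.ReflTransGen.refl
  | succ m ih =>
    obtain ⟨hu, x, hx, hxv⟩ := h
    exact Relation.ReflTransGen.head hx (ih hxv)

lemma exists_walkIn_of_reflTransGen {u v : L × L} (h : Relation.ReflTransGen (P.autAdj W) u v) :
    ∃ m, P.WalkIn W Set.univ m u v := by
  induction h using Relation.ReflTransGen.head_induction_on with
  | refl => exact ⟨0, trivial, rfl⟩
  | head h _ ih =>
    obtain ⟨m, hm⟩ := ih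
    exact ⟨m + 1, trivial, _, h, hm⟩

lemma reflTransGen_swap {u v : L × L} (h : Relation.ReflTransGen (P.autAdj W) u v) :
    Relation.ReflTransGen (P.autAdj W) v.swap u.swap := by
  obtain ⟨m, hm⟩ := exists_walkIn_of_reflTransGen h
  exact hm.swap.reflTransGen

variable (P W) in
/-- The strongly connected component of `p`. -/
def scc (p : L × L) : Set (L × L) :=
  {v | v ∈ P.autNodes W ∧ Relation.ReflTransGen (P.autAdj W) p v ∧
    Relation.ReflTransGen (P.autAdj W) v p}

lemma WalkIn.scc {p : L × L} {m : ℕ} {u v : L × L} (h : P.WalkIn W Set.univ m u v)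
    (hu : u ∈ P.scc W p) (hv : v ∈ P.scc W p) : P.WalkIn W (P.scc W p) m u v := by
  induction m generalizing u with
  | zero => exact ⟨hu, h.2⟩
  | succ m ih =>
    obtain ⟨-, x, hx, hxv⟩ := h
    refine ⟨hu, x, hx, ih hxv ⟨hx.2.1, hu.2.1.tail hx, hxv.reflTransGen.trans hv.2.2⟩⟩

lemma WalkIn.iterate {U : Set (L × L)} {a : ℕ} {p : L × L} (h : P.WalkIn W U a p p)
    (hp : p ∈ U) (j : ℕ) : P.WalkIn W U (a * j) p p := by
  induction j with
  | zero => exact ⟨hp, rfl⟩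
  | succ j ih => exact ih.append h

/-- Closed walks at `p` of the coprime lengths `a` and `a + 1` combine to all lengths from `a * a`
on. As `L` is finite, the detours between `p` and the other nodes of the component have bounded
length. -/
lemma isPathFlexible_scc [Finite L] {p : L × L} {a : ℕ} (ha : 0 < a)
    (h1 : P.WalkIn W Set.univ a p p) (h2 : P.WalkIn W Set.univ (a + 1) p p) :
    P.IsPathFlexible W (P.scc W p) := by
  have hlong : ∀ m, a * a ≤ m → P.WalkIn W Set.univ m p p := by
    intro m hm
    have hq : a ≤ m / a := (Nat.le_div_iff_mul_le ha).2 hm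
    have hr : m % a < a := Nat.mod_lt _ ha
    -- Division with remainder r < a ≤ q: of the q rounds, r are replaced by rounds of length `a +
    -- 1`.
    have e : m = a * (m / a - m % a) + (a + 1) * (m % a) := by
      have h3 := Nat.div_add_mod m a
      obtain ⟨d, hd⟩ := Nat.exists_eq_add_of_le (hr.le.trans hq)
      rw [hd, Nat.add_sub_cancel_left]
      rw [hd] at h3
      nlinarith
    rw [e]
    exact (h1.iterate trivial _).append (h2.iterate trivial _)
  have hto : ∃ K, ∀ v ∈ P.scc W p, (∃ l ≤ K, P.WalkIn W Set.univ l p v) ∧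
      ∃ l ≤ K, P.WalkIn W Set.univ l v p := by
    have hf : ∀ v, ∃ l, v ∈ P.scc W p → (∃ l' ≤ l, P.WalkIn W Set.univ l' p v) ∧
        ∃ l' ≤ l, P.WalkIn W Set.univ l' v p := by
      intro v
      by_cases hv : v ∈ P.scc W p
      · obtain ⟨l, hl⟩ := exists_walkIn_of_reflTransGen hv.2.1
        obtain ⟨l', hl'⟩ := exists_walkIn_of_reflTransGen hv.2.2
        exact ⟨l + l', fun _ => ⟨⟨l, by omega, hl⟩, l', by omega, hl'⟩⟩
      · exact ⟨0, fun h => absurd h hv⟩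
    choose f hf using hf
    have := Fintype.ofFinite (L × L)
    refine ⟨Finset.univ.sup f, fun v hv => ?_⟩
    have hle : f v ≤ Finset.univ.sup f := Finset.le_sup (Finset.mem_univ v)
    obtain ⟨⟨l, hl, h⟩, l', hl', h'⟩ := hf v hv
    exact ⟨⟨l, hl.trans hle, h⟩, l', hl'.trans hle, h'⟩
  obtain ⟨K, hK⟩ := hto
  refine ⟨a * a + 2 * K + 1, by omega, fun m hm u hu v hv => ?_⟩
  obtain ⟨-, l, hl, hul⟩ := hK u hu
  obtain ⟨⟨l', hl', hvl⟩, -⟩ := hK v hv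
  refine WalkIn.scc ?_ hu hv
  have e : m = l + (m - l - l') + l' := by omega
  rw [e]
  exact (hul.append (hlong _ (by omega))).append hvl

variable (P) in
/-- The pair sets that make up the strongly connected component of `p`. -/
def sccPairs (W : Set (Sym L P.Δ)) (p : L × L) : Set (Sym2 L) :=
  {e | ∃ v ∈ P.scc W p, s(v.1, v.2) = e}

/-- A component consists of ordered pairs, a set 𝒟 of unordered ones. They correspond only if the
component is closed under swapping, and for this it is enough that it contains `p.swap`. -/
lemma pairNodes_sccPairs (hW : W ⊆ P.nodeConstraints) {p : L × L}
    (hs : p.swap ∈ P.scc W p) : P.pairNodes (P.sccPairs W p) = P.scc W p := by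
  have hswap : ∀ v ∈ P.scc W p, v.swap ∈ P.scc W p := by
    intro v hv
    exact ⟨swap_mem_autNodes hv.1, hs.2.1.trans (reflTransGen_swap hv.2.2),
      (reflTransGen_swap hv.2.1).trans hs.2.2⟩
  ext v
  constructor
  · rintro ⟨-, u, hu, huv⟩
    rcases Sym2.eq_iff.1 huv with ⟨h1, h2⟩ | ⟨h1, h2⟩
    · have : u = v := Prod.ext h1 h2
      exact this ▸ hu
    · have : u.swap = v := Prod.ext h2 h1
      exact this ▸ hswap u hu
  · intro hv
    obtain ⟨C, hC, hCv⟩ := hv.1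
    exact ⟨⟨C, hW hC, hCv⟩, v, hv, rfl⟩

/-- A pair `p` from which both orientations of `q` can be reached, also after reversing `p`,
with walks of consecutive lengths, generates a path-flexible component. -/
lemma sccPairs_mem_flexSCC [Finite L] (hW : W ⊆ P.nodeConstraints) {p q : L × L}
    (hp : p ∈ P.autNodes W) (hpq : ∃ m, 0 < m ∧ P.WalkIn W Set.univ m p q ∧
      P.WalkIn W Set.univ (m + 1) p q)
    (hpq' : Relation.ReflTransGen (P.autAdj W) p q.swap)
    (hpq'' : Relation.ReflTransGen (P.autAdj W) p.swap q)
    (hpq3 : ∃ m, P.WalkIn W Set.univ m p.swap q.swap) :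
    P.sccPairs W p ∈ P.flexSCC W := by
  obtain ⟨m, hm, h1, h2⟩ := hpq
  obtain ⟨m', h3⟩ := hpq3
  have h3' := h3.swap
  rw [Prod.swap_swap, Prod.swap_swap] at h3'
  -- Reversal provides q → p.swap and q → p, hence the cycle p → q → p.swap → q → p.
  have hs : p.swap ∈ P.scc W p := by
    have e1 := reflTransGen_swap hpq'
    have e2 := reflTransGen_swap hpq''
    rw [Prod.swap_swap] at e1 e2
    exact ⟨swap_mem_autNodes hp, h1.reflTransGen.trans e1, hpq''.trans h3'.reflTransGen⟩
  have e := pairNodes_sccPairs hW hs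
  refine ⟨?_, ?_⟩
  · rw [e]
    exact ⟨p, hp, rfl⟩
  · rw [e]
    refine isPathFlexible_scc (a := m + m') (by omega) (h1.append h3') ?_
    have := h2.append h3'
    rwa [show m + 1 + m' = m + m' + 1 by omega] at this

/-- The walks between swapped pairs, read backwards, lead from `q` to `p` and to `r`, so all three
lie in one component. -/
lemma mem_sccPairs {p q r : L × L} (hr : r ∈ P.autNodes W)
    (h1 : Relation.ReflTransGen (P.autAdj W) p q)
    (h2 : Relation.ReflTransGen (P.autAdj W) p.swap q.swap)
    (h3 : Relation.ReflTransGen (P.autAdj W) r q)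
    (h4 : Relation.ReflTransGen (P.autAdj W) r.swap q.swap) :
    s(r.1, r.2) ∈ P.sccPairs W p := by
  have e2 := reflTransGen_swap h2
  have e4 := reflTransGen_swap h4
  rw [Prod.swap_swap, Prod.swap_swap] at e2 e4
  exact ⟨r, ⟨hr, h1.trans e4, h3.trans e2⟩, rfl⟩

/-! ### Walks in the automaton from labeled paths -/

variable (P) in
/-- The configuration at `v` belongs to `W`. -/
def HasConfig {V : Type*} [Finite V] (G : SimpleGraph V) (ℓ : V → V → L)
    (W : Set (Sym L P.Δ)) (v : V) : Prop :=
  ∃ C ∈ W, (C : Multiset L) = nodeConfig G ℓ v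

lemma HasConfig.mem_autNodes {V : Type*} [Finite V] {G : SimpleGraph V} {ℓ : V → V → L} {v : V}
    (h : P.HasConfig G ℓ W v) {e f : V} (hef : e ≠ f) (he : G.Adj v e) (hf : G.Adj v f) :
    (ℓ v e, ℓ v f) ∈ P.autNodes W := by
  obtain ⟨C, hC, h⟩ := h
  exact ⟨C, hC, by rw [h, pair_le_nodeConfig]; exact ⟨e, f, hef, he, hf, rfl, rfl⟩⟩

/-- At an inner vertex of the path the labels of the half-edges back and forward form a node of the
automaton, and the edge constraint between consecutive vertices is adjacency. The two outermost
vertices only fix directions and need no configuration in `W`. -/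
lemma walkIn_of_nonBacktracking {V : Type*} [Finite V] {G : SimpleGraph V} {ℓ : V → V → L}
    (hE : ∀ u v, G.Adj u v → s(ℓ u v, ℓ v u) ∈ P.edgeConstraints) {m : ℕ} {w : ℕ → V}
    (hw : G.NonBacktracking (m + 2) w) (hW : ∀ s, 1 ≤ s → s ≤ m + 1 → P.HasConfig G ℓ W (w s)) :
    P.WalkIn W Set.univ m (ℓ (w 1) (w 0), ℓ (w 1) (w 2))
      (ℓ (w (m + 1)) (w m), ℓ (w (m + 1)) (w (m + 2))) := by
  induction m generalizing w with
  | zero => exact ⟨trivial, rfl⟩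
  | succ m ih =>
    have h := ih (w := fun s => w (1 + s))
      ((hw.mono (by omega : 1 + (m + 2) ≤ m + 1 + 2)).shift) (fun s h1 h2 => hW _ (by omega) (by omega))
    have e1 : 1 + (m + 1) = m + 1 + 1 := by omega
    have e2 : 1 + m = m + 1 := by omega
    have e3 : 1 + (m + 2) = m + 1 + 2 := by omega
    simp only [e1, e2, e3] at h
    refine ⟨trivial, (ℓ (w 2) (w 1), ℓ (w 2) (w 3)), ⟨?_, ?_, ?_⟩, h⟩
    · exact (hW 1 le_rfl (by omega)).mem_autNodes (hw.ne 0 (by omega)).symm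
        (hw.adj 0 (by omega)).symm (hw.adj 1 (by omega))
    · exact (hW 2 (by omega) (by omega)).mem_autNodes (hw.ne 1 (by omega)).symm
        (hw.adj 1 (by omega)).symm (hw.adj 2 (by omega))
    · exact hE _ _ (hw.adj 1 (by omega))

/-- A labeled path from `x` to `c` gives a walk in the automaton between pairs at its ends. -/
lemma walkIn_of_path {V : Type*} [Finite V] {G : SimpleGraph V} {ℓ : V → V → L}
    (hE : ∀ u v, G.Adj u v → s(ℓ u v, ℓ v u) ∈ P.edgeConstraints) {m : ℕ} {w : ℕ → V}
    (hm : 0 < m) (hw : G.NonBacktracking m w) (hW : ∀ s ≤ m, P.HasConfig G ℓ W (w s))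
    {e f : V} (he : G.Adj (w 0) e) (hew : e ≠ w 1) (hf : G.Adj (w m) f) (hfw : f ≠ w (m - 1)) :
    P.WalkIn W Set.univ m (ℓ (w 0) e, ℓ (w 0) (w 1)) (ℓ (w m) (w (m - 1)), ℓ (w m) f) := by
  -- The path is prolonged by `e` in front and by `f` at the end.
  let w' : ℕ → V := fun s => if s = 0 then e else if s ≤ m + 1 then w (s - 1) else f
  have e0 : w' 0 = e := rfl
  have e1 : ∀ s ≤ m, w' (s + 1) = w s := by
    intro s hs
    simp [w', hs]
  have e2 : w' (m + 2) = f := by simp [w']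
  have h := walkIn_of_nonBacktracking (W := W) hE (m := m) (w := w') ⟨?_, ?_⟩ ?_
  · have e3 := e1 (m - 1) (by omega)
    rw [Nat.sub_add_cancel hm] at e3
    rwa [e0, e2, e3, e1 m le_rfl, e1 0 (by omega), e1 1 (by omega)] at h
  · intro s hs
    rcases Nat.eq_zero_or_pos s with rfl | hs0
    · rw [e0, e1 0 (by omega)]
      exact he.symm
    · obtain ⟨t, rfl⟩ := Nat.exists_eq_add_of_le' hs0
      rw [e1 t (by omega)]
      rcases Nat.lt_or_ge t m with ht | ht
      · rw [e1 _ (by omega)]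
        exact hw.adj t ht
      · obtain rfl : t = m := by omega
        rw [e2]
        exact hf
  · intro s hs
    rcases Nat.eq_zero_or_pos s with rfl | hs0
    · rw [e0, e1 1 (by omega)]
      exact hew.symm
    · obtain ⟨t, rfl⟩ := Nat.exists_eq_add_of_le' hs0
      rw [e1 t (by omega)]
      rcases Nat.lt_or_ge (t + 1) m with ht | ht
      · rw [e1 _ (by omega)]
        exact hw.ne t (by omega)
      · obtain rfl : m = t + 1 := by omega
        rw [e2]
        exact hfw
  · intro s h1 h2
    obtain ⟨t, rfl⟩ := Nat.exists_eq_add_of_le' h1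
    rw [e1 t (by omega)]
    exact hW t (by omega)

/-! ### Deciding `trim` in bounded balls -/

variable (P) in
/-- The complete tree of depth `i` has a solution with root configuration `C` and other inner
configurations in `W`. -/
def HasTree (W : Set (Sym L P.Δ)) (C : Sym L P.Δ) (i : ℕ) : Prop :=
  ∃ (V : Type) (_ : Finite V) (G : SimpleGraph V) (r : V) (ℓ : V → V → L),
    IsCompleteTree P.Δ i G r ∧ P.IsSolution G ℓ ∧ nodeConfig G ℓ r = (C : Multiset L) ∧
    ∀ v, v ≠ r → G.dist r v < i → ∃ C' ∈ W, (C' : Multiset L) = nodeConfig G ℓ v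

/-- There are only finitely many pairs (W, C). For each pair that fails at some depth one such depth
is recorded, and γ is the maximum. -/
lemma exists_trim_radius [Finite L] (P : UnrootedLCL L) : ∃ γ, ∀ (W : Set (Sym L P.Δ)) (C : Sym L P.Δ),
    C ∈ W → (∀ i, 1 ≤ i → i ≤ γ → P.HasTree W C i) → C ∈ P.trim W := by
  classical
  have := Fintype.ofFinite L
  have h : ∀ x : Set (Sym L P.Δ) × Sym L P.Δ, ∃ g, x.2 ∈ x.1 →
      (∀ i, 1 ≤ i → i ≤ g → P.HasTree x.1 x.2 i) → x.2 ∈ P.trim x.1 := by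
    intro x
    by_cases hx : ∀ i, 1 ≤ i → P.HasTree x.1 x.2 i
    · exact ⟨0, fun h _ => ⟨h, hx⟩⟩
    · push Not at hx
      obtain ⟨i, hi, hx⟩ := hx
      exact ⟨i, fun _ h => absurd (h i hi le_rfl) hx⟩
  choose g hg using h
  refine ⟨Finset.univ.sup g, fun W C hC h => hg (W, C) hC fun i h1 h2 => h i h1 (h2.trans ?_)⟩
  exact Finset.le_sup (Finset.mem_univ (W, C))

/-- The balls around `x` of radius up to γ are themselves the labelled complete trees that `trim`
asks for. Each use costs a distance γ. -/
lemma hasConfig_trim_of_ball {γ : ℕ} (hγ : ∀ (W : Set (Sym L P.Δ)) (C : Sym L P.Δ),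
    C ∈ W → (∀ i, 1 ≤ i → i ≤ γ → P.HasTree W C i) → C ∈ P.trim W) (hΔ : 2 ≤ P.Δ)
    {V : Type} [Finite V] {G : SimpleGraph V} (hG : G.IsTree) {ℓ : V → V → L}
    (hE : ∀ u v, G.Adj u v → s(ℓ u v, ℓ v u) ∈ P.edgeConstraints) {x : V}
    (hW : W ⊆ P.nodeConstraints) (hx : ∀ v ∈ G.ballOf {x} γ, P.HasConfig G ℓ W v) :
    P.HasConfig G ℓ (P.trim W) x := by
  have hx' : ∀ v, G.dist x v ≤ γ → P.HasConfig G ℓ W v := fun v hv =>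
    hx v ((SimpleGraph.mem_ballOf_singleton_iff hG.connected).2 hv)
  obtain ⟨C, hC, hCx⟩ := hx' x (by simp)
  refine ⟨C, hγ W C hC fun i h1 h2 => ?_, hCx⟩
  have hdeg : ∀ v, G.dist x v < i → (nbrs G v).card = P.Δ := by
    intro v hv
    obtain ⟨C', -, h⟩ := hx' v (by omega)
    have := congrArg Multiset.card h
    rw [nodeConfig, Multiset.card_map, Finset.card_val] at this
    rw [← this]
    exact C'.2
  have hT := isCompleteTree_ball hG x h1 hdeg
  have hcfg : ∀ v : {v | G.dist x v ≤ i}, G.dist x v < i →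
      nodeConfig (G.induce {v | G.dist x v ≤ i}) (fun a b => ℓ a b) v = nodeConfig G ℓ v := by
    intro v hv
    refine nodeConfig_induce ℓ v fun u hu => ?_
    have := hu.diff_dist_adj (u := x)
    change G.dist x u ≤ i
    omega
  -- The boundary vertices are leaves of the ball, and for Δ ≥ 2 no node constraint applies to them.
  have hdist : ∀ v : {v | G.dist x v ≤ i},
      (nbrs (G.induce {v | G.dist x v ≤ i}) v).card ≠ 1 → G.dist x v < i := by
    intro v hv
    by_contra hlt
    have h3 := hT.dist_le v
    rcases h3.lt_or_eq with h3 | h3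
    · obtain ⟨p, hp⟩ := hT.isTree.connected.exists_walk_length_eq_dist ⟨x, by simp⟩ v
      have := SimpleGraph.dist_le (p.map (SimpleGraph.Embedding.induce _).toHom)
      rw [SimpleGraph.Walk.length_map, hp] at this
      have h4 : G.dist x v ≤ _ := this
      omega
    · exact hv (hT.leaf v h3)
  refine ⟨{v | G.dist x v ≤ i}, inferInstance, _, ⟨x, by simp⟩, fun a b => ℓ a b, hT, ⟨?_, ?_⟩, ?_, ?_⟩
  · intro v hv
    have hv' := hdist v (by omega)
    obtain ⟨C', hC', h⟩ := hx' v (by omega)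
    exact ⟨C', hW hC', by rw [hcfg v hv', h]⟩
  · intro u v huv
    exact hE _ _ huv
  · rw [hcfg ⟨x, by simp⟩ (by simp; omega), hCx]
  · intro v _ hv
    have hv' : G.dist x v < i := by
      refine hdist v ?_
      rw [hT.inner v hv]
      omega
    obtain ⟨C', hC', h⟩ := hx' v (by omega)
    exact ⟨C', hC', by rw [hcfg v hv', h]⟩

end UnrootedLCL

/-! ### Levels -/

/-- The local structure of the hard instances at a node `v` with respect to a level function. -/
structure LevelAt {V : Type*} [Finite V] (Δ k R : ℕ) (G : SimpleGraph V) (level : V → ℕ)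
    (v : V) : Prop where
  degree : 1 ≤ level v → (nbrs G v).card = Δ
  lipschitz : ∀ w, G.Adj v w → level v ≤ level w + 1
  two : ∀ j, 1 ≤ j → j ≤ k → j * R ≤ level v →
    ∃ w₁ w₂, w₁ ≠ w₂ ∧ G.Adj v w₁ ∧ G.Adj v w₂ ∧ j * R ≤ level w₁ ∧ j * R ≤ level w₂

namespace SimpleGraph

variable {V : Type*} {G : SimpleGraph V}

lemma NonBacktracking.update {m : ℕ} {w : ℕ → V} (h : G.NonBacktracking m w)
    {z : V} (hz : G.Adj (w m) z) (hz' : z ≠ w (m - 1)) :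
    G.NonBacktracking (m + 1) (Function.update w (m + 1) z) := by
  constructor
  · intro s hs
    rw [Function.update_of_ne (by omega)]
    rcases Nat.lt_or_ge s m with h' | h'
    · rw [Function.update_of_ne (by omega)]
      exact h.adj s h'
    · obtain rfl : s = m := by omega
      rwa [Function.update_self]
  · intro s hs
    rw [Function.update_of_ne (by omega : s ≠ m + 1)]
    rcases Nat.lt_or_ge (s + 1) m with h' | h'
    · rw [Function.update_of_ne (by omega)]
      exact h.ne s h'
    · obtain rfl : m = s + 1 := by omega
      rwa [Function.update_self]

variable [Finite V] {Δ k R : ℕ} {level : V → ℕ} {bad : Set V}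

/-- Of two neighbours of level at least `j * R` one differs from the vertex just left, so the ray
can be continued greedily. The sequence is total, with a default value where no continuation exists,
and it is controlled up to the first bad vertex. -/
lemma exists_ray {j : ℕ} (hloc : ∀ v, v ∉ bad → LevelAt Δ k R G level v) (hj : 1 ≤ j)
    (hjk : j ≤ k) {x e : V} (hxe : G.Adj x e) (he : j * R ≤ level e) :
    ∃ w : ℕ → V, w 0 = x ∧ w 1 = e ∧ ∀ m, (∀ s, 1 ≤ s → s < m → w s ∉ bad) →
      G.NonBacktracking m w ∧ ∀ s, 1 ≤ s → s ≤ m → j * R ≤ level (w s) := by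
  classical
  let nxt : V × V → V × V := fun q =>
    (q.2, if h : ∃ z, G.Adj q.2 z ∧ z ≠ q.1 ∧ j * R ≤ level z then h.choose else q.2)
  let w : ℕ → V := fun s => (nxt^[s] (x, e)).1
  have hw : ∀ s, w (s + 1) = (nxt^[s] (x, e)).2 := fun s => by
    simp only [w, Function.iterate_succ', Function.comp_apply, nxt]
  have step : ∀ s, w (s + 1) ∉ bad → j * R ≤ level (w (s + 1)) →
      G.Adj (w (s + 1)) (w (s + 2)) ∧ w (s + 2) ≠ w s ∧ j * R ≤ level (w (s + 2)) := by
    intro s hb hl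
    obtain ⟨z₁, z₂, hne, h1, h2, h3, h4⟩ := (hloc _ hb).two j hj hjk hl
    have hex : ∃ z, G.Adj (w (s + 1)) z ∧ z ≠ w s ∧ j * R ≤ level z := by
      by_cases hz : z₁ = w s
      · exact ⟨z₂, h2, fun h => hne (hz.trans h.symm), h4⟩
      · exact ⟨z₁, h1, hz, h3⟩
    have e2 : w (s + 2) = hex.choose := by
      rw [hw (s + 1), Function.iterate_succ', Function.comp_apply]
      have hex' := hex
      rw [hw s] at hex'
      simp only [nxt]
      rw [dif_pos hex']
      congr 1
      ext z
      rw [hw s]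
    rw [e2]
    exact hex.choose_spec
  refine ⟨w, rfl, rfl, fun m hm => ?_⟩
  have hlev : ∀ s, 1 ≤ s → s ≤ m → j * R ≤ level (w s) := by
    intro s hs
    induction s, hs using Nat.le_induction with
    | base => exact fun _ => he
    | succ s hs ih =>
      intro hsm
      obtain ⟨s, rfl⟩ := Nat.exists_eq_add_of_le' hs
      exact (step s (hm _ (by omega) (by omega)) (ih (by omega))).2.2
  refine ⟨⟨fun s hs => ?_, fun s hs => ?_⟩, hlev⟩
  · rcases s with _ | s
    · exact hxe
    · exact (step s (hm _ (by omega) (by omega)) (hlev _ (by omega) (by omega))).1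
  · exact (step s (hm _ (by omega) (by omega)) (hlev _ (by omega) (by omega))).2.1

/-- From a node of a connected set `Q` one can walk in a prescribed direction through nodes of
high level until one is at distance `D` from `Q`, and find there an edge that does not lead to `a`. -/
lemma exists_arm (hG : G.IsTree) {j : ℕ} (hloc : ∀ v, v ∉ bad → LevelAt Δ k R G level v)
    (hΔ : 3 ≤ Δ) (hR : 1 ≤ R) (hj : 1 ≤ j) (hjk : j ≤ k) {r : V} {Q : Finset V}
    (hQ : G.ConnectedFrom r (Q : Set V)) {D : ℕ} (hD : 1 ≤ D)
    (hbad : ∀ v ∈ G.ballOf (Q : Set V) D, v ∉ bad) {x e : V} (hx : x ∈ Q) (hxe : G.Adj x e)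
    (he : j * R ≤ level e) {B : Set V} {a b : V}
    (hB : ∀ v w, G.Adj v w → v ∉ B → w ∈ B → v = a ∧ w = b) (ha : a ∉ B)
    (hBQ : ∀ v ∈ G.ballOf (Q : Set V) D, v ∉ B) :
    ∃ (t : ℕ) (w : ℕ → V), w 0 = x ∧ w 1 = e ∧ G.NonBacktracking (t + D + 1) w ∧
      t + 1 ≤ Q.card ∧ (∀ s, 1 ≤ s → s ≤ t + D → j * R ≤ level (w s)) ∧
      (∀ s ≤ t, w s ∈ Q) ∧ (∀ s ≤ D + 1, w (t + s) ∈ G.ballOf (Q : Set V) s) ∧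
      (∀ s ≤ D, w (t + s + 1) ∉ G.ballOf (Q : Set V) s) ∧
      ∃ q : G.Walk (w (t + D)) a, (∀ x ∈ q.support, x ∉ B) ∧
        s(w (t + D), w (t + D + 1)) ∉ q.edges := by
  classical
  obtain ⟨w, hw0, hw1, hw⟩ := exists_ray (bad := bad) hloc hj hjk hxe he
  have hbadQ : ∀ v ∈ Q, v ∉ bad := fun v hv => hbad v (subset_ballOf _ _ hv)
  -- A non-backtracking sequence in a tree is injective and cannot stay in a finite set. `t` will be
  -- the last index before the first exit.
  have hex : ∃ s, w s ∉ Q := by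
    by_contra! hall
    obtain ⟨h, -⟩ := hw Q.card (fun s _ _ => hbadQ _ (hall s))
    have := Finset.card_le_card_of_injOn (s := Finset.range (Q.card + 1)) (t := Q) w
      (fun s _ => hall s) (fun s hs s' hs' h' => by
        rw [Finset.coe_range, Set.mem_Iio] at hs hs'
        exact h.injOn hG (by omega) (by omega) h')
    rw [Finset.card_range] at this
    omega
  have hpos : Nat.find hex ≠ 0 := by
    intro h0
    have := Nat.find_spec hex
    rw [h0, hw0] at this
    exact this hx
  obtain ⟨t, ht⟩ := Nat.exists_eq_succ_of_ne_zero hpos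
  have hout : w (t + 1) ∉ Q := by
    have := Nat.find_spec hex
    rwa [ht] at this
  have hin : ∀ s ≤ t, w s ∈ Q := by
    intro s hs
    by_contra h
    have := Nat.find_min' hex h
    omega
  have key : ∀ m ≤ D, ∀ s ≤ m, G.NonBacktracking (t + s) w ∧ w (t + s) ∈ G.ballOf (Q : Set V) s := by
    intro m
    induction m with
    | zero =>
      intro _ s hs
      obtain rfl : s = 0 := by omega
      exact ⟨(hw t (fun s _ hs => hbadQ _ (hin s (by omega)))).1, subset_ballOf _ _ (hin t le_rfl)⟩
    | succ m ih =>
      intro hm s hs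
      rcases hs.lt_or_eq with hs | rfl
      · exact ih (by omega) s (by omega)
      have hnb : G.NonBacktracking (t + (m + 1)) w := by
        refine (hw _ fun s _ hs => ?_).1
        rcases Nat.lt_or_ge t s with h | h
        · obtain ⟨d, rfl⟩ := Nat.exists_eq_add_of_le h.le
          exact hbad _ (ballOf_mono le_rfl (by omega) (ih (by omega) d (by omega)).2)
        · exact hbadQ _ (hin s h)
      refine ⟨hnb, ?_⟩
      exact ballOf_step (ih (by omega) m le_rfl).2 (hnb.adj (t + m) (by omega))
  have hnb := (key D le_rfl D le_rfl).1
  have hball : ∀ s ≤ D, w (t + s) ∈ G.ballOf (Q : Set V) s := fun s hs => (key D le_rfl s hs).2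
  have hbad' : ∀ s, s ≤ t + D → w s ∉ bad := by
    intro s hs
    rcases Nat.lt_or_ge t s with h | h
    · obtain ⟨d, rfl⟩ := Nat.exists_eq_add_of_le h.le
      exact hbad _ (ballOf_mono le_rfl (by omega) (hball d (by omega)))
    · exact hbadQ _ (hin s h)
  have hlev := (hw (t + D) fun s _ hs => hbad' s (by omega)).2
  have hcard : t + 1 ≤ Q.card := by
    have := Finset.card_le_card_of_injOn (s := Finset.range (t + 1)) (t := Q) w
      (fun s hs => hin s (by rw [Finset.coe_range, Set.mem_Iio] at hs; omega)) (fun s hs s' hs' h' => by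
        rw [Finset.coe_range, Set.mem_Iio] at hs hs'
        exact hnb.injOn hG (by omega) (by omega) h')
    rwa [Finset.card_range] at this
  have hy := hball D le_rfl
  obtain ⟨s, hs⟩ := exists_walk_avoiding_edge hG.connected hB (hBQ _ hy) ha
  have hdeg : (nbrs G (w (t + D))).card = Δ := by
    refine (hloc _ (hbad _ hy)).degree (le_trans ?_ (hlev _ (by omega) le_rfl))
    exact Nat.mul_pos hj hR
  -- Two neighbours are forbidden: the previous vertex and the first vertex on the way to `a`. This
  -- is where Δ ≥ 3 is needed.
  obtain ⟨z, hz, hzp, hzs⟩ := exists_nbr_ne (by omega : 3 ≤ (nbrs G (w (t + D))).card)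
    (w (t + D - 1)) s
  have hnb' := hnb.update hz hzp
  have hu : ∀ s ≤ t + D, Function.update w (t + D + 1) z s = w s := fun s hs =>
    Function.update_of_ne (by omega) _ _
  have hball' : ∀ s ≤ D + 1, Function.update w (t + D + 1) z (t + s) ∈ G.ballOf (Q : Set V) s := by
    intro s hs
    rcases hs.lt_or_eq with hs | rfl
    · rw [hu _ (by omega)]
      exact hball s (by omega)
    · rw [← Nat.add_assoc, Function.update_self]
      exact ballOf_step hy hz
  refine ⟨t, Function.update w (t + D + 1) z, ?_, ?_, hnb', hcard, ?_, ?_, hball', ?_, ?_⟩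
  · rw [hu 0 (by omega), hw0]
  · rw [hu 1 (by omega), hw1]
  · intro s h1 h2
    rw [hu s h2]
    exact hlev s h1 h2
  · intro s hs
    rw [hu s (by omega)]
    exact hin s hs
  · intro s hs
    have hsh : G.NonBacktracking (D + 1) (fun s => Function.update w (t + D + 1) z (t + s)) :=
      (hnb'.mono (by omega : t + (D + 1) ≤ t + D + 1)).shift
    refine hsh.notMem_ballOf hG hQ ?_ ?_ (by omega)
    · have := hin t le_rfl
      rw [← hu t (by omega)] at this
      exact this
    · rw [hu (t + 1) (by omega)]
      exact hout
  · rw [hu _ le_rfl, Function.update_self]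
    exact hs z hzs

end SimpleGraph

lemma LevelAt.mono_ball {V : Type*} [Finite V] {Δ k R : ℕ} {G : SimpleGraph V} {level : V → ℕ}
    {bad : Set V} (hloc : ∀ v, v ∉ bad → LevelAt Δ k R G level v) {Y : Set V} {l r : ℕ}
    (hY : ∀ v ∈ Y, l ≤ level v) (hbad : ∀ v ∈ G.ballOf Y r, v ∉ bad) :
    ∀ v ∈ G.ballOf Y (r + 1), l ≤ level v + (r + 1) := by
  have key : G.ballOf Y (r + 1) ⊆ {v | l ≤ level v + (r + 1)} := by
    have := SimpleGraph.ballOf_induction (G := G) (Y := Y) (r := r + 1)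
      (fun t => {v | v ∈ G.ballOf Y t ∧ l ≤ level v + t}) ?_ ?_ ?_
    · exact fun v hv => (this hv).2
    · exact fun v hv => ⟨SimpleGraph.subset_ballOf _ _ hv, hY v hv⟩
    · rintro t - v ⟨h1, h2⟩
      exact ⟨SimpleGraph.ballOf_mono le_rfl (Nat.le_succ t) h1, by omega⟩
    · rintro t ht u ⟨h1, h2⟩ v huv
      have := (hloc u (hbad u (SimpleGraph.ballOf_mono le_rfl (by omega) h1))).lipschitz v huv
      exact ⟨SimpleGraph.ballOf_step h1 huv, by omega⟩
  exact key

/-- Entering `B` requires passing through `a`, which the ball does not reach. -/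
lemma SimpleGraph.ballOf_disjoint {V : Type*} {G : SimpleGraph V} {Y B : Set V} {a : V} {r : ℕ}
    (hB : ∀ v w, G.Adj v w → v ∉ B → w ∈ B → v = a) (ha : a ∉ G.ballOf Y r)
    (hY : ∀ v ∈ Y, v ∉ B) : ∀ v ∈ G.ballOf Y r, v ∉ B := by
  have := ballOf_induction (G := G) (Y := Y) (r := r) (fun t => {v | v ∈ G.ballOf Y t ∧ v ∉ B})
    (fun v hv => ⟨subset_ballOf _ _ hv, hY v hv⟩)
    (fun t _ v hv => ⟨ballOf_mono le_rfl (Nat.le_succ t) hv.1, hv.2⟩) ?_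
  · exact fun v hv => (this hv).2
  · rintro t ht u ⟨h1, h2⟩ v huv
    refine ⟨ballOf_step h1 huv, fun hv => ha ?_⟩
    rw [← hB u v huv h2 hv]
    exact ballOf_mono le_rfl ht.le h1

/-- The fixed data of the hard instances: the node `core 0` and, for each of the later indices
`l`, a region that is attached to the rest by the edge from `outer l` to `inner l` and that
contains the node `core l`. -/
structure Board (n : ℕ) where
  core : ℕ → Fin n
  region : ℕ → Set (Fin n)
  outer : ℕ → Fin n
  inner : ℕ → Fin n

/-- The position of these nodes with respect to the regions. -/
structure Board.IsValid {n : ℕ} (b : Board n) (k : ℕ) : Prop where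
  core_mem : ∀ l, 1 ≤ l → l ≤ k → b.core l ∈ b.region l
  inner_mem : ∀ l, 1 ≤ l → l ≤ k → b.inner l ∈ b.region l
  outer_notMem : ∀ l, 1 ≤ l → l ≤ k → b.outer l ∉ b.region l
  core_later : ∀ l m, 1 ≤ l → l < m → m ≤ k → b.core l ∉ b.region m
  inner_later : ∀ l m, 1 ≤ l → l < m → m ≤ k → b.inner l ∉ b.region m
  outer_later : ∀ l m, 1 ≤ l → l < m → m ≤ k → b.outer l ∉ b.region m

/-- A stage of the construction of a hard instance: a tree with its order of nodes, of which the
first `num` count as revealed, and the trunk, whose nodes have high level. -/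
structure Stage (n : ℕ) where
  graph : SimpleGraph (Fin n)
  level : Fin n → ℕ
  bad : Set (Fin n)
  trunk : Finset (Fin n)
  used : ℕ
  order : Equiv.Perm (Fin n)
  num : ℕ

/-! ### Stages of the construction and their invariants -/

namespace Stage

variable {n : ℕ}

/-- The nodes revealed so far. -/
def revealed (b : Board n) (k ρ : ℕ) (S : Stage n) : Set (Fin n) :=
  S.graph.ballOf (S.trunk : Set (Fin n)) ρ ∪ {v | ∃ l, 1 ≤ l ∧ l ≤ k ∧ v = b.core l}

/-- The region with index `l` has not been touched yet. -/
structure Fresh (b : Board n) (R M i l : ℕ) (S : Stage n) : Prop where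
  cross : ∀ v w, S.graph.Adj v w → v ∉ b.region l → w ∈ b.region l → v = b.outer l ∧ w = b.inner l
  adj : S.graph.Adj (b.outer l) (b.inner l)
  outer_bad : b.outer l ∈ S.bad
  inner_bad : b.inner l ∈ S.bad
  ball : ∀ v ∈ S.graph.ballOf {b.core l} M, v ∉ S.bad
  level : i * R ≤ S.level (b.core l)
  trunk : ∀ v ∈ S.trunk, v ∉ b.region l

/-- The invariants of a stage that can still be extended at the levels below `i`. -/
structure Good (b : Board n) (Δ k R ρ D i : ℕ) (S : Stage n) : Prop where
  tree : IsRegularTree Δ S.graph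
  loc : ∀ v, v ∉ S.bad → LevelAt Δ k R S.graph S.level v
  conn : S.graph.ConnectedFrom (b.core 0) (S.trunk : Set (Fin n))
  core_zero : b.core 0 ∈ S.trunk
  level : ∀ v ∈ S.trunk, i * R ≤ S.level v
  ball : ∀ v ∈ S.graph.ballOf (S.trunk : Set (Fin n)) (i * (ρ + D + 3)), v ∉ S.bad
  used_le : i + S.used ≤ k + 1
  core_used : ∀ l, 1 ≤ l → l ≤ S.used → b.core l ∈ S.trunk
  fresh : ∀ l, S.used < l → l ≤ k → S.Fresh b R (i * (ρ + D + 3)) (i - 1) l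
  num_le : S.num ≤ n
  revealed : ∀ v, v ∈ S.revealed b k ρ ↔ ∃ j : Fin n, j.val < S.num ∧ S.order j = v

/-- Lets a stage stay in the families of lower levels, so that `F (i + 1) ⊆ F i`. -/
lemma Good.mono {b : Board n} {Δ k R ρ D i : ℕ} {S : Stage n} (h : S.Good b Δ k R ρ D (i + 1)) :
    S.Good b Δ k R ρ D i := by
  have hM : i * (ρ + D + 3) ≤ (i + 1) * (ρ + D + 3) := Nat.mul_le_mul_right _ (Nat.le_succ i)
  refine ⟨h.tree, h.loc, h.conn, h.core_zero, fun v hv => ?_, fun v hv => ?_, ?_, h.core_used,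
    fun l h1 h2 => ?_, h.num_le, h.revealed⟩
  · exact (Nat.mul_le_mul_right R (Nat.le_succ i)).trans (h.level v hv)
  · exact h.ball v (SimpleGraph.ballOf_mono le_rfl hM hv)
  · have := h.used_le
    omega
  · have f := h.fresh l h1 h2
    exact ⟨f.cross, f.adj, f.outer_bad, f.inner_bad,
      fun v hv => f.ball v (SimpleGraph.ballOf_mono le_rfl hM hv),
      (Nat.mul_le_mul_right R (by omega)).trans f.level, f.trunk⟩

/-- `S'` continues `S`: what an algorithm with locality `T` does at the revealed nodes of `S` is
the same in `S'`. -/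
structure Continues (b : Board n) (k ρ T : ℕ) (S S' : Stage n) : Prop where
  num_le : S.num ≤ S'.num
  order : ∀ j : Fin n, j.val < S.num → S'.order j = S.order j
  agree : ∀ u ∈ S.graph.ballOf (S.revealed b k ρ) T, ∀ v, S.graph.Adj u v ↔ S'.graph.Adj u v

/-- In `S'` there is a path of length `m` from `x`, beginning with the edge to `e`, to `c`,
ending with the edge from `f`, along the trunk. -/
def HasPath (S' : Stage n) (x e f c : Fin n) (m : ℕ) : Prop :=
  ∃ w : ℕ → Fin n, w 0 = x ∧ w 1 = e ∧ w (m - 1) = f ∧ w m = c ∧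
    S'.graph.NonBacktracking m w ∧ ∀ s ≤ m, w s ∈ S'.trunk

/-- The revealed nodes come first in both orders and have the same T-neighbourhoods, so their labels
are committed before the continuation is chosen. -/
lemma Continues.run_eq {L : Type*} {b : Board n} {k ρ : ℕ} {S S' : Stage n}
    (A : RandOnlineLocalAlg L) (h : Continues b k ρ (A.locality n) S S')
    (hrev : ∀ v, v ∈ S.revealed b k ρ ↔ ∃ j : Fin n, j.val < S.num ∧ S.order j = v)
    (ω : ℕ → Bool) {v : Fin n} (hv : v ∈ S.revealed b k ρ) :
    A.run S'.graph S'.order ω v = A.run S.graph S.order ω v := by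
  obtain ⟨j, hj, rfl⟩ := (hrev v).1 hv
  refine (A.run_eq (fun j' hj' => (h.order j' (lt_of_le_of_lt hj' hj)).symm) ?_ ω).symm
  intro u hu
  refine h.agree u (SimpleGraph.ballOf_mono ?_ le_rfl hu)
  rintro _ ⟨j', hj', rfl⟩
  exact (hrev _).2 ⟨j', lt_of_le_of_lt hj' hj, rfl⟩

end Stage

/-! ### Joining the trunk to the next core -/

namespace Stage

variable {n : ℕ} {b : Board n} {Δ k R ρ D i : ℕ} {S : Stage n}

lemma Good.notMem_region (g : S.Good b Δ k R ρ D i) {l : ℕ} (h1 : S.used < l) (h2 : l ≤ k) :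
    ∀ v ∈ S.graph.ballOf (S.trunk : Set (Fin n)) (i * (ρ + D + 3)), v ∉ b.region l :=
  have f := g.fresh l h1 h2
  SimpleGraph.ballOf_disjoint (fun v w h hv hw => (f.cross v w h hv hw).1)
    (fun h => g.ball _ h f.outer_bad) f.trunk

lemma Good.mem_region (g : S.Good b Δ k R ρ D i) (hb : b.IsValid k) {l : ℕ} (h1 : S.used < l)
    (h2 : l ≤ k) : ∀ v ∈ S.graph.ballOf {b.core l} (i * (ρ + D + 3)), v ∈ b.region l := by
  have f := g.fresh l h1 h2
  have := SimpleGraph.ballOf_disjoint (G := S.graph) (Y := {b.core l}) (B := (b.region l)ᶜ)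
    (a := b.inner l) (r := i * (ρ + D + 3))
    (fun v w h hv hw => (f.cross w v h.symm hw (not_not.1 hv)).2)
    (fun h => f.ball _ h f.inner_bad)
    (fun v hv => by rw [Set.mem_singleton_iff.1 hv]; exact not_not.2 (hb.core_mem l (by omega) h2))
  exact fun v hv => not_not.1 (this v hv)

lemma Good.notMem_region_of_later (g : S.Good b Δ k R ρ D i) (hb : b.IsValid k) {l m : ℕ}
    (h1 : S.used < l) (hlm : l < m) (h2 : m ≤ k) :
    ∀ v ∈ S.graph.ballOf {b.core l} (i * (ρ + D + 3)), v ∉ b.region m :=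
  have f := g.fresh m (by omega) h2
  SimpleGraph.ballOf_disjoint (fun v w h hv hw => (f.cross v w h hv hw).1)
    (fun h => (g.fresh l h1 (by omega)).ball _ h f.outer_bad)
    (fun v hv => by
      rw [Set.mem_singleton_iff.1 hv]
      exact hb.core_later l m (by omega) hlm h2)

/-- The two paths along which the trunk is extended to the core `l`: the path `w` leaves the
neighbourhood of the trunk after `t` steps, the path `w'` begins at the core. -/
structure Joint (b : Board n) (R ρ D i l β t : ℕ) (S : Stage n) (w w' : ℕ → Fin n) : Prop where
  nb : S.graph.NonBacktracking (t + D + 1) w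
  nb' : S.graph.NonBacktracking (D + β + 1) w'
  zero' : w' 0 = b.core l
  level : ∀ s, 1 ≤ s → s ≤ t + D → i * R ≤ S.level (w s)
  level' : ∀ s, 1 ≤ s → s ≤ D + β → i * R ≤ S.level (w' s)
  mem : ∀ s ≤ t, w s ∈ S.graph.ballOf (S.trunk : Set (Fin n)) ρ
  ball : ∀ s ≤ D + 1, w (t + s) ∈ S.graph.ballOf (S.trunk : Set (Fin n)) (ρ + s)
  ball' : ∀ s ≤ D + β + 1, w' s ∈ S.graph.ballOf {b.core l} s
  far : ∀ s ≤ D, w (t + s + 1) ∉ S.graph.ballOf (S.graph.ballOf (S.trunk : Set (Fin n)) ρ) s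
  far' : ∀ s ≤ D + β, w' (s + 1) ∉ S.graph.ballOf {b.core l} s
  switch : S.graph.IsSwitch (b.region l) (w (t + D)) (w (t + D + 1)) (w' (D + β))
    (w' (D + β + 1)) (b.outer l) (b.inner l)

/-- One arm leaves the neighbourhood `Q` of the trunk, the other starts at the core, and each
continues `D` steps beyond what is revealed. Only the second arm depends on `β`: `w` and `t` are
chosen before it, so the two total lengths are consecutive. -/
lemma Good.exists_joint (g : S.Good b Δ k R ρ D (i + 1)) (hb : b.IsValid k) (hΔ : 3 ≤ Δ)
    (hi : 1 ≤ i) (hR : ρ + 1 ≤ R) (hD : 1 ≤ D) {x e f : Fin n}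
    (hx : x ∈ S.graph.ballOf (S.trunk : Set (Fin n)) ρ) (he : S.graph.Adj x e)
    (hf : S.graph.Adj (b.core (S.used + 1)) f) (hfl : i * R ≤ S.level f) {Q : Finset (Fin n)}
    (hQ : (Q : Set (Fin n)) = S.graph.ballOf (S.trunk : Set (Fin n)) ρ) :
    ∃ (t : ℕ) (w : ℕ → Fin n), t + 1 ≤ Q.card ∧ w 0 = x ∧ w 1 = e ∧
      ∀ β ≤ 1, ∃ w' : ℕ → Fin n, w' 1 = f ∧ S.Joint b R ρ D i (S.used + 1) β t w w' := by
  set l := S.used + 1 with hl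
  have hlk : l ≤ k := by have := g.used_le; omega
  have fr := g.fresh l (by omega) hlk
  have hik : i ≤ k := by have := g.used_le; omega
  set M := (i + 1) * (ρ + D + 3) with hM
  have hM1 : ρ + D + 3 ≤ M := by rw [hM]; nlinarith
  -- `e` may be at distance ρ + 1 from the trunk. The level drops by at most ρ + 1 ≤ R, that is, by
  -- one multiple of `R`.
  have hel : i * R ≤ S.level e := by
    have h1 := LevelAt.mono_ball g.loc (r := ρ) g.level
      (fun v hv => g.ball v (SimpleGraph.ballOf_mono le_rfl (by omega) hv)) e
      (SimpleGraph.ballOf_step hx he)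
    have h2 : (i + 1) * R = i * R + R := by ring
    omega
  have hQQ : ∀ s, S.graph.ballOf (Q : Set (Fin n)) s ⊆
      S.graph.ballOf (S.trunk : Set (Fin n)) (ρ + s) := fun s => by
    rw [hQ]
    exact SimpleGraph.ballOf_ballOf _ _ _
  obtain ⟨t, w, hw0, hw1, hnb, htQ, hlev, hin, hball, hfar, hwalk⟩ :=
    SimpleGraph.exists_arm g.tree.1 g.loc hΔ (by omega) hi hik (r := b.core 0) (Q := Q)
      (by rw [hQ]; exact g.conn.ballOf ρ) hD
      (fun v hv => g.ball v (SimpleGraph.ballOf_mono le_rfl (by omega) (hQQ D hv)))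
      (by rw [← Finset.mem_coe, hQ]; exact hx) he hel fr.cross
      (hb.outer_notMem l (by omega) hlk)
      (fun v hv => g.notMem_region (by omega) hlk v
        (SimpleGraph.ballOf_mono le_rfl (by omega) (hQQ D hv)))
  refine ⟨t, w, htQ, hw0, hw1, fun β hβ => ?_⟩
  have hcore : ∀ s, s ≤ M → ∀ v ∈ S.graph.ballOf {b.core l} s, v ∉ S.bad := fun s hs v hv =>
    fr.ball v (SimpleGraph.ballOf_mono le_rfl hs hv)
  have hreg : ∀ s, s ≤ M → ∀ v ∈ S.graph.ballOf {b.core l} s, v ∈ b.region l := fun s hs v hv =>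
    g.mem_region hb (by omega) hlk v (SimpleGraph.ballOf_mono le_rfl hs hv)
  have hout : ∀ s, s ≤ M → ∀ v ∈ S.graph.ballOf (S.trunk : Set (Fin n)) s, v ∉ b.region l :=
    fun s hs v hv => g.notMem_region (by omega) hlk v (SimpleGraph.ballOf_mono le_rfl hs hv)
  have hgood : ∀ s, s ≤ M → ∀ v ∈ S.graph.ballOf (S.trunk : Set (Fin n)) s, v ∉ S.bad :=
    fun s hs v hv => g.ball v (SimpleGraph.ballOf_mono le_rfl hs hv)
  -- Inside the region the two sides of the cut edge exchange roles: the set to be avoided is the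
  -- complement of the region, and the arm leaves a single node.
  obtain ⟨t', w', hw0', hw1', hnb', htQ', hlev', hin', hball', hfar', hwalk'⟩ :=
    SimpleGraph.exists_arm g.tree.1 g.loc hΔ (by omega) hi hik (r := b.core l)
      (Q := {b.core l}) (D := D + β) (a := b.inner l) (b := b.outer l) (B := (b.region l)ᶜ)
      (by
        intro v hv
        rw [Finset.coe_singleton, Set.mem_singleton_iff] at hv
        subst hv
        exact ⟨SimpleGraph.Walk.nil, by simp⟩) (by omega)
      (fun v hv => hcore (D + β) (by omega) v (by simpa using hv))
      (Finset.mem_singleton_self _) hf hfl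
      (fun v w h hv hw => (fr.cross w v h.symm hw (not_not.1 hv)).symm)
      (not_not.2 (hb.inner_mem l (by omega) hlk))
      (fun v hv => not_not.2 (hreg (D + β) (by omega) v (by simpa using hv)))
  obtain rfl : t' = 0 := by simpa using htQ'
  simp only [Nat.zero_add, Finset.coe_singleton] at hnb' hlev' hball' hfar' hwalk'
  refine ⟨w', hw1', hnb, hnb', hw0', hlev, hlev', ?_, fun s hs => hQQ s (hball s hs), ?_, ?_, ?_, ?_⟩
  · intro s hs
    rw [← hQ]
    exact hin s hs
  · exact fun s hs => hball' s hs
  · intro s hs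
    rw [← hQ]
    exact hfar s hs
  · exact fun s hs => hfar' s hs
  · have hy := hQQ D (hball D (by omega))
    have hz := hQQ (D + 1) (hball (D + 1) le_rfl)
    have hy' := hball' (D + β) (by omega)
    have hz' := hball' (D + β + 1) (by omega)
    refine ⟨hnb.adj _ (by omega), hnb'.adj _ (by omega), fr.adj, hout _ (by omega) _ hy,
      hout _ (by omega) _ hz, hb.outer_notMem l (by omega) hlk, hreg _ (by omega) _ hy',
      hreg _ (by omega) _ hz', hb.inner_mem l (by omega) hlk, ?_, ?_, ?_, ?_, ?_, ?_, fr.cross,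
      hwalk, ?_⟩
    · exact fun h => hgood _ (by omega) _ hy (h ▸ fr.outer_bad)
    · exact fun h => hgood _ (by omega) _ hz (h.symm ▸ fr.outer_bad)
    · exact fun h => hcore _ (by omega) _ hy' (h ▸ fr.inner_bad)
    · exact fun h => hcore _ (by omega) _ hz' (h.symm ▸ fr.inner_bad)
    · exact fun h => hgood _ (by omega) _ (SimpleGraph.ballOf_step hz h.symm) fr.outer_bad
    · exact fun h => hcore _ (by omega) _ (SimpleGraph.ballOf_step hz' h.symm) fr.inner_bad
    · rw [Nat.zero_add (D + β)] at hwalk'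
      obtain ⟨q, h1, h2⟩ := hwalk'
      exact ⟨q, fun x hx => not_not.1 (h1 x hx), h2⟩

end Stage

/-! ### The extended stage -/

namespace Stage

variable {n : ℕ} {b : Board n} {Δ k R ρ D i : ℕ} {S : Stage n}

open scoped Classical in
/-- The stage after connecting the trunk with the core `l` along the paths `w` and `w'`. -/
noncomputable def extend (S : Stage n) (b : Board n) (R ρ D i l β t : ℕ) (w w' : ℕ → Fin n)
    (σ : Equiv.Perm (Fin n)) (p : ℕ) : Stage n where
  graph := S.graph.switch (w (t + D)) (w (t + D + 1)) (w' (D + β)) (w' (D + β + 1))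
    (b.outer l) (b.inner l)
  -- The cap gives both ends of the new edge the same level `i * R`, so the level function stays
  -- Lipschitz across it.
  level := fun v => min (S.level v) (i * R)
  -- The outer ends of the removed edges lose a neighbour on which their level may rest. The ends of
  -- the cut edge are bad already.
  bad := S.bad ∪ {w (t + D + 1), w' (D + β + 1)}
  trunk := Finset.univ.filter (fun v => v ∈ S.graph.ballOf (S.trunk : Set (Fin n)) ρ) ∪
    (Finset.range (t + D + 1)).image w ∪ (Finset.range (D + β + 1)).image w'
  used := l
  order := σ
  num := p

section

variable {l β t p : ℕ} {w w' : ℕ → Fin n} {σ : Equiv.Perm (Fin n)}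

lemma mem_extend_trunk {v : Fin n} : v ∈ (S.extend b R ρ D i l β t w w' σ p).trunk ↔
    v ∈ S.graph.ballOf (S.trunk : Set (Fin n)) ρ ∨ (∃ s ≤ t + D, w s = v) ∨
      ∃ s ≤ D + β, w' s = v := by
  simp [extend]

/-- The nodes that are incident to the exchanged edges. -/
def touched (b : Board n) (D l β t : ℕ) (w w' : ℕ → Fin n) : Set (Fin n) :=
  {w (t + D), w (t + D + 1), w' (D + β), w' (D + β + 1), b.outer l, b.inner l}

lemma Joint.adj_of_notMem (J : S.Joint b R ρ D i l β t w w') {v : Fin n}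
    (hv : v ∉ touched b D l β t w w') (u : Fin n) :
    (S.extend b R ρ D i l β t w w' σ p).graph.Adj v u ↔ S.graph.Adj v u :=
  J.switch.adj_of_ne hv u

/-- Nodes outside the region that are not bad and near the trunk are touched only at the end. -/
lemma Joint.notMem_touched_of_notMem (J : S.Joint b R ρ D i l β t w w') {v : Fin n}
    (h1 : v ∉ b.region l) (h2 : v ≠ b.outer l) (h3 : v ≠ w (t + D)) (h4 : v ≠ w (t + D + 1)) :
    v ∉ touched b D l β t w w' := by
  rintro (rfl | rfl | rfl | rfl | rfl | rfl)
  · exact h3 rfl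
  · exact h4 rfl
  · exact h1 J.switch.hy'
  · exact h1 J.switch.hz'
  · exact h2 rfl
  · exact h1 J.switch.hb

lemma Joint.notMem_touched_of_mem (J : S.Joint b R ρ D i l β t w w') {v : Fin n}
    (h1 : v ∈ b.region l) (h2 : v ≠ b.inner l) (h3 : v ≠ w' (D + β)) (h4 : v ≠ w' (D + β + 1)) :
    v ∉ touched b D l β t w w' := by
  rintro (rfl | rfl | rfl | rfl | rfl | rfl)
  · exact J.switch.hy h1
  · exact J.switch.hz h1
  · exact h3 rfl
  · exact h4 rfl
  · exact J.switch.ha h1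
  · exact h2 rfl

lemma Good.used_lt (g : S.Good b Δ k R ρ D (i + 1)) (hi : 1 ≤ i) : S.used + 1 ≤ k := by
  have := g.used_le
  omega

lemma le_radius (i ρ D : ℕ) : i * (ρ + D + 3) + (ρ + D + 3) = (i + 1) * (ρ + D + 3) := by ring

lemma Joint.touched_notMem_region (J : S.Joint b R ρ D i (S.used + 1) β t w w')
    (g : S.Good b Δ k R ρ D (i + 1)) (hb : b.IsValid k) (hβ : β ≤ 1) {m : ℕ} (h1 : S.used + 1 < m) (h2 : m ≤ k) :
    ∀ v ∈ touched b D (S.used + 1) β t w w', v ∉ b.region m := by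
  have hM := le_radius i ρ D
  have hy := J.ball D (by omega)
  have hz := J.ball (D + 1) (by omega)
  have hy' := J.ball' (D + β) (by omega)
  have hz' := J.ball' (D + β + 1) (by omega)
  have h3 := g.notMem_region (by omega) h2
  have h4 := g.notMem_region_of_later hb (Nat.lt_succ_self _) h1 h2
  rintro v (rfl | rfl | rfl | rfl | rfl | rfl)
  · exact h3 _ (SimpleGraph.ballOf_mono le_rfl (by omega) hy)
  · exact h3 _ (SimpleGraph.ballOf_mono le_rfl (by omega) hz)
  · exact h4 _ (SimpleGraph.ballOf_mono le_rfl (by omega) hy')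
  · exact h4 _ (SimpleGraph.ballOf_mono le_rfl (by omega) hz')
  · exact hb.outer_later _ _ (by omega) h1 h2
  · exact hb.inner_later _ _ (by omega) h1 h2

/-- The switch takes place far from the revealed nodes. -/
lemma Joint.touched_far (J : S.Joint b R ρ D i (S.used + 1) β t w w')
    (g : S.Good b Δ k R ρ D (i + 1)) (hb : b.IsValid k) (hi : 1 ≤ i) (hβ : β ≤ 1) {T : ℕ} (hT : D = T + 1) :
    ∀ v ∈ S.graph.ballOf (S.revealed b k ρ) T, v ∉ touched b D (S.used + 1) β t w w' := by
  have hM := le_radius i ρ D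
  have hl := g.used_lt hi
  have hfr := g.fresh (S.used + 1) (by omega) hl
  -- distance from the trunk
  have hQ : ∀ v ∈ S.graph.ballOf (S.graph.ballOf (S.trunk : Set (Fin n)) ρ) T,
      v ∉ touched b D (S.used + 1) β t w w' := by
    intro v hv
    have hv' := SimpleGraph.ballOf_ballOf _ _ _ hv
    refine J.notMem_touched_of_notMem
      (g.notMem_region (by omega) hl v (SimpleGraph.ballOf_mono le_rfl (by omega) hv')) ?_ ?_ ?_
    · rintro rfl
      exact g.ball _ (SimpleGraph.ballOf_mono le_rfl (by omega) hv') hfr.outer_bad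
    · rintro rfl
      have := J.far T (by omega)
      rw [Nat.add_assoc, ← hT] at this
      exact this hv
    · rintro rfl
      have := J.far D (by omega)
      exact this (SimpleGraph.ballOf_mono le_rfl (by omega) hv)
  have hc : ∀ v ∈ S.graph.ballOf {b.core (S.used + 1)} T,
      v ∉ touched b D (S.used + 1) β t w w' := by
    intro v hv
    refine J.notMem_touched_of_mem (g.mem_region hb (by omega) hl v
      (SimpleGraph.ballOf_mono le_rfl (by omega) hv)) ?_ ?_ ?_
    · rintro rfl
      exact hfr.ball _ (SimpleGraph.ballOf_mono le_rfl (by omega) hv) hfr.inner_bad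
    · rintro rfl
      have := J.far' (T + β) (by omega)
      rw [show T + β + 1 = D + β by omega] at this
      exact this (SimpleGraph.ballOf_mono le_rfl (by omega) hv)
    · rintro rfl
      exact J.far' (D + β) (by omega) (SimpleGraph.ballOf_mono le_rfl (by omega) hv)
  rintro v ⟨y, hy, q, hq⟩
  rcases hy with hy | ⟨m, hm1, hm2, rfl⟩
  · exact hQ v ⟨y, hy, q, hq⟩
  -- A core already used lies in the trunk, the next one is the start of the second arm, and the
  -- later ones are protected by their regions.
  · rcases lt_trichotomy m (S.used + 1) with h | rfl | h
    · exact hQ v ⟨_, SimpleGraph.subset_ballOf _ _ (g.core_used m hm1 (by omega)), q, hq⟩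
    · exact hc v ⟨_, rfl, q, hq⟩
    · intro hv
      exact J.touched_notMem_region g hb hβ h hm2 v hv
        (g.mem_region hb (by omega) hm2 v ⟨_, rfl, q, hq.trans (by omega)⟩)

/-- An edge of a forest is a bridge, so one of the two walks from `c` to its ends has to use it. -/
lemma _root_.SimpleGraph.IsAcyclic.mem_edges {V : Type*} {G : SimpleGraph V} (hG : G.IsAcyclic)
    {c y z : V} (hyz : G.Adj y z) (p : G.Walk c y) (hp : s(y, z) ∉ p.edges) (q : G.Walk c z) :
    s(y, z) ∈ q.edges := by
  have h := SimpleGraph.isAcyclic_iff_forall_adj_isBridge.1 hG hyz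
  have := (SimpleGraph.isBridge_iff_forall_walk_mem_edges.1 h) (p.reverse.append q)
  rw [SimpleGraph.Walk.edges_append, List.mem_append, SimpleGraph.Walk.edges_reverse,
    List.mem_reverse] at this
  exact this.resolve_left hp

/-- Balls around the new trunk. -/
lemma Joint.ball_extend (J : S.Joint b R ρ D i (S.used + 1) β t w w')
    (g : S.Good b Δ k R ρ D (i + 1)) (hb : b.IsValid k) (hi : 1 ≤ i) (hβ : β ≤ 1) :
    ∀ v ∈ (S.extend b R ρ D i (S.used + 1) β t w w' σ p).graph.ballOf
      ((S.extend b R ρ D i (S.used + 1) β t w w' σ p).trunk : Set (Fin n)) (i * (ρ + D + 3)),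
    (v ∈ S.graph.ballOf (S.trunk : Set (Fin n)) ((i + 1) * (ρ + D + 3)) ∧
      v ∉ b.region (S.used + 1) ∧ v ≠ w (t + D + 1)) ∨
    (v ∈ S.graph.ballOf {b.core (S.used + 1)} ((i + 1) * (ρ + D + 3)) ∧
      v ∈ b.region (S.used + 1) ∧ v ≠ w' (D + β + 1)) := by
  set l := S.used + 1 with hl
  set S' := S.extend b R ρ D i l β t w w' σ p with hS'
  have hM := le_radius i ρ D
  have hlk := g.used_lt hi
  have hfr := g.fresh l (by omega) hlk
  set y := w (t + D) with hy
  set z := w (t + D + 1) with hz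
  set y' := w' (D + β) with hy'
  set z' := w' (D + β + 1) with hz'
  have sw := J.switch
  -- `K` is the side of the bridge `yz` that contains the trunk, and `K'` the side of `y'z'` that
  -- contains the core. Neither contains `z` or `z'` respectively (`Kz`, `Kz'`).
  let K : Fin n → Prop := fun v => ∃ q : S.graph.Walk (b.core 0) v, s(y, z) ∉ q.edges
  let K' : Fin n → Prop := fun v => ∃ q : S.graph.Walk (b.core l) v, s(y', z') ∉ q.edges
  have Kstep : ∀ u v, K u → S.graph.Adj u v → s(u, v) ≠ s(y, z) → K v := by
    rintro u v ⟨q, hq⟩ huv hne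
    refine ⟨q.concat huv, ?_⟩
    rw [SimpleGraph.Walk.edges_concat, List.concat_eq_append, List.mem_append, List.mem_singleton]
    rintro (h | h)
    · exact hq h
    · exact hne h.symm
  have Kstep' : ∀ u v, K' u → S.graph.Adj u v → s(u, v) ≠ s(y', z') → K' v := by
    rintro u v ⟨q, hq⟩ huv hne
    refine ⟨q.concat huv, ?_⟩
    rw [SimpleGraph.Walk.edges_concat, List.concat_eq_append, List.mem_append, List.mem_singleton]
    rintro (h | h)
    · exact hq h
    · exact hne h.symm
  have hzQ : z ∉ S.graph.ballOf (S.trunk : Set (Fin n)) ρ := fun h =>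
    J.far D (by omega) (SimpleGraph.subset_ballOf _ _ h)
  have KQ : ∀ v ∈ S.graph.ballOf (S.trunk : Set (Fin n)) ρ, K v := by
    intro v hv
    obtain ⟨q, hq⟩ := g.conn.ballOf ρ v hv
    exact ⟨q, fun h => hzQ (hq z (q.snd_mem_support_of_mem_edges h))⟩
  have Kw : ∀ s ≤ t + D, K (w s) := by
    intro s
    induction s with
    | zero => exact fun _ => KQ _ (J.mem 0 (by omega))
    | succ s ih =>
      intro hs
      refine Kstep _ _ (ih (by omega)) (J.nb.adj s (by omega)) fun h => ?_
      rcases Sym2.eq_iff.1 h with ⟨-, h⟩ | ⟨h, -⟩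
      · have := J.nb.injOn g.tree.1 (by omega) (by omega) h
        omega
      · have := J.nb.injOn g.tree.1 (by omega) (by omega) h
        omega
  have Kw' : ∀ s ≤ D + β, K' (w' s) := by
    intro s
    induction s with
    | zero => exact fun _ => by rw [J.zero']; exact ⟨SimpleGraph.Walk.nil, by simp⟩
    | succ s ih =>
      intro hs
      refine Kstep' _ _ (ih (by omega)) (J.nb'.adj s (by omega)) fun h => ?_
      rcases Sym2.eq_iff.1 h with ⟨-, h⟩ | ⟨h, -⟩
      · have := J.nb'.injOn g.tree.1 (by omega) (by omega) h
        omega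
      · have := J.nb'.injOn g.tree.1 (by omega) (by omega) h
        omega
  have Kz : ∀ v, K v → v ≠ z := by
    rintro v ⟨q, hq⟩ rfl
    obtain ⟨q', hq'⟩ := Kw (t + D) le_rfl
    exact hq (g.tree.1.isAcyclic.mem_edges sw.yz q' hq' q)
  have Kz' : ∀ v, K' v → v ≠ z' := by
    rintro v ⟨q, hq⟩ rfl
    obtain ⟨q', hq'⟩ := Kw' (D + β) le_rfl
    exact hq (g.tree.1.isAcyclic.mem_edges sw.yz' q' hq' q)
  have hreg : ∀ r ≤ (i + 1) * (ρ + D + 3), ∀ v ∈ S.graph.ballOf {b.core l} r, v ∈ b.region l :=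
    fun r hr v hv => g.mem_region hb (by omega) hlk v (SimpleGraph.ballOf_mono le_rfl hr hv)
  have hout : ∀ r ≤ (i + 1) * (ρ + D + 3), ∀ v ∈ S.graph.ballOf (S.trunk : Set (Fin n)) r,
      v ∉ b.region l :=
    fun r hr v hv => g.notMem_region (by omega) hlk v (SimpleGraph.ballOf_mono le_rfl hr hv)
  -- A growing ball can change sides only along `yy'`. It then arrives at `y` or `y'`, whose old
  -- distances are at most ρ + D and D + β, so crossing does not add up radii.
  have key := SimpleGraph.ballOf_induction (G := S'.graph) (Y := (S'.trunk : Set (Fin n)))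
    (r := i * (ρ + D + 3))
    (fun r => {v | (v ∈ S.graph.ballOf (S.trunk : Set (Fin n)) (ρ + D + r) ∧ K v) ∨
      (v ∈ S.graph.ballOf {b.core l} (D + β + r) ∧ K' v)}) ?_ ?_ ?_
  · intro v hv
    rcases key hv with ⟨h1, h2⟩ | ⟨h1, h2⟩
    · exact Or.inl ⟨SimpleGraph.ballOf_mono le_rfl (by omega) h1, hout _ (by omega) v h1, Kz v h2⟩
    · exact Or.inr ⟨SimpleGraph.ballOf_mono le_rfl (by omega) h1, hreg _ (by omega) v h1, Kz' v h2⟩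
  · intro v hv
    rcases mem_extend_trunk.1 hv with hv | ⟨s, hs, rfl⟩ | ⟨s, hs, rfl⟩
    · exact Or.inl ⟨SimpleGraph.ballOf_mono le_rfl (by omega) hv, KQ v hv⟩
    · refine Or.inl ⟨?_, Kw s hs⟩
      rcases Nat.lt_or_ge t s with h | h
      · obtain ⟨d, rfl⟩ := Nat.exists_eq_add_of_le h.le
        exact SimpleGraph.ballOf_mono le_rfl (by omega) (J.ball d (by omega))
      · exact SimpleGraph.ballOf_mono le_rfl (by omega) (J.mem s h)
    · exact Or.inr ⟨SimpleGraph.ballOf_mono le_rfl (by omega) (J.ball' s (by omega)), Kw' s hs⟩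
  · rintro r - v (⟨h1, h2⟩ | ⟨h1, h2⟩)
    · exact Or.inl ⟨SimpleGraph.ballOf_mono le_rfl (by omega) h1, h2⟩
    · exact Or.inr ⟨SimpleGraph.ballOf_mono le_rfl (by omega) h1, h2⟩
  · rintro r hr u (⟨h1, h2⟩ | ⟨h1, h2⟩) v huv
    · have hu1 := hout _ (by omega) u h1
      have hu2 : u ≠ b.outer l := by
        rintro rfl
        exact g.ball _ (SimpleGraph.ballOf_mono le_rfl (by omega) h1) hfr.outer_bad
      have hu3 := Kz u h2
      by_cases hu4 : u = y
      · subst hu4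
        rcases (sw.adj_y v).1 huv with ⟨h3, h4⟩ | rfl
        · refine Or.inl ⟨SimpleGraph.ballOf_step h1 h3, Kstep _ _ h2 h3 fun h => ?_⟩
          rcases Sym2.eq_iff.1 h with ⟨-, h⟩ | ⟨h, -⟩
          · exact h4 h
          · exact hu3 h
        · exact Or.inr ⟨SimpleGraph.ballOf_mono le_rfl (by omega) (J.ball' (D + β) (by omega)),
            Kw' _ le_rfl⟩
      · have h3 := (J.adj_of_notMem (J.notMem_touched_of_notMem hu1 hu2 hu4 hu3) v).1 huv
        refine Or.inl ⟨SimpleGraph.ballOf_step h1 h3, Kstep _ _ h2 h3 fun h => ?_⟩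
        rcases Sym2.eq_iff.1 h with ⟨h, -⟩ | ⟨h, -⟩
        · exact hu4 h
        · exact hu3 h
    · have hu1 := hreg _ (by omega) u h1
      have hu2 : u ≠ b.inner l := by
        rintro rfl
        exact hfr.ball _ (SimpleGraph.ballOf_mono le_rfl (by omega) h1) hfr.inner_bad
      have hu3 := Kz' u h2
      by_cases hu4 : u = y'
      · subst hu4
        rcases (sw.adj_y' v).1 huv with ⟨h3, h4⟩ | rfl
        · refine Or.inr ⟨SimpleGraph.ballOf_step h1 h3, Kstep' _ _ h2 h3 fun h => ?_⟩
          rcases Sym2.eq_iff.1 h with ⟨-, h⟩ | ⟨h, -⟩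
          · exact h4 h
          · exact hu3 h
        · exact Or.inl ⟨SimpleGraph.ballOf_mono le_rfl (by omega) (J.ball D (by omega)),
            Kw _ le_rfl⟩
      · have h3 := (J.adj_of_notMem (J.notMem_touched_of_mem hu1 hu2 hu4 hu3) v).1 huv
        refine Or.inr ⟨SimpleGraph.ballOf_step h1 h3, Kstep' _ _ h2 h3 fun h => ?_⟩
        rcases Sym2.eq_iff.1 h with ⟨h, -⟩ | ⟨h, -⟩
        · exact hu4 h
        · exact hu3 h

end

end Stage

lemma SimpleGraph.ConnectedFrom.step {V : Type*} {G : SimpleGraph V} {Q : Set V} {r u v : V}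
    (hu : ∃ p : G.Walk r u, ∀ x ∈ p.support, x ∈ Q) (h : G.Adj u v) (hv : v ∈ Q) :
    ∃ p : G.Walk r v, ∀ x ∈ p.support, x ∈ Q := by
  obtain ⟨p, hp⟩ := hu
  refine ⟨p.concat h, fun x hx => ?_⟩
  rw [SimpleGraph.Walk.support_concat, List.mem_append,
    List.mem_singleton] at hx
  rcases hx with hx | rfl
  · exact hp x hx
  · exact hv

/-! ### The invariants after an extension -/

namespace Stage

variable {n : ℕ} {b : Board n} {Δ k R ρ D i : ℕ} {S : Stage n}
  {β t p : ℕ} {w w' : ℕ → Fin n} {σ : Equiv.Perm (Fin n)}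

lemma Joint.notMem_region (J : S.Joint b R ρ D i (S.used + 1) β t w w')
    (g : S.Good b Δ k R ρ D (i + 1)) {m : ℕ} (h1 : S.used < m) (h2 : m ≤ k) :
    ∀ s ≤ t + D + 1, w s ∉ b.region m := by
  have hM := le_radius i ρ D
  intro s hs
  refine g.notMem_region h1 h2 _ (SimpleGraph.ballOf_mono le_rfl (?_ : ρ + (s - t) ≤ _) ?_)
  · omega
  · rcases Nat.lt_or_ge t s with h | h
    · obtain ⟨d, rfl⟩ := Nat.exists_eq_add_of_le h.le
      rw [Nat.add_sub_cancel_left]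
      exact J.ball d (by omega)
    · exact SimpleGraph.ballOf_mono le_rfl (by omega) (J.mem s h)

lemma Joint.mem_region (J : S.Joint b R ρ D i (S.used + 1) β t w w')
    (g : S.Good b Δ k R ρ D (i + 1)) (hb : b.IsValid k) (hi : 1 ≤ i) (hβ : β ≤ 1) :
    ∀ s ≤ D + β + 1, w' s ∈ b.region (S.used + 1) := by
  have hM := le_radius i ρ D
  exact fun s hs => g.mem_region hb (by omega) (g.used_lt hi) _
    (SimpleGraph.ballOf_mono le_rfl (by omega) (J.ball' s hs))

lemma Joint.adj_left (J : S.Joint b R ρ D i (S.used + 1) β t w w')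
    (g : S.Good b Δ k R ρ D (i + 1)) (hi : 1 ≤ i) :
    ∀ s < t + D,
      (S.extend b R ρ D i (S.used + 1) β t w w' σ p).graph.Adj (w s) (w (s + 1)) := by
  intro s hs
  have h1 := J.notMem_region g (Nat.lt_succ_self _) (g.used_lt hi)
  refine (J.switch.adj_iff _ _).2 (Or.inl ⟨J.nb.adj s (by omega), fun h => ?_, fun h => ?_,
    fun h => ?_⟩)
  · rcases Sym2.eq_iff.1 h with ⟨h, -⟩ | ⟨h, -⟩
    · have := J.nb.injOn g.tree.1 (by omega) (by omega) h
      omega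
    · have := J.nb.injOn g.tree.1 (by omega) (by omega) h
      omega
  · rcases Sym2.eq_iff.1 h with ⟨h, -⟩ | ⟨h, -⟩
    · exact h1 s (by omega) (h ▸ J.switch.hy')
    · exact h1 s (by omega) (h ▸ J.switch.hz')
  · rcases Sym2.eq_iff.1 h with ⟨-, h⟩ | ⟨h, -⟩
    · exact h1 (s + 1) (by omega) (h ▸ J.switch.hb)
    · exact h1 s (by omega) (h ▸ J.switch.hb)

lemma Joint.adj_right (J : S.Joint b R ρ D i (S.used + 1) β t w w')
    (g : S.Good b Δ k R ρ D (i + 1)) (hb : b.IsValid k) (hi : 1 ≤ i) (hβ : β ≤ 1) :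
    ∀ s < D + β,
      (S.extend b R ρ D i (S.used + 1) β t w w' σ p).graph.Adj (w' s) (w' (s + 1)) := by
  intro s hs
  have h1 := J.mem_region g hb hi hβ
  refine (J.switch.adj_iff _ _).2 (Or.inl ⟨J.nb'.adj s (by omega), fun h => ?_, fun h => ?_,
    fun h => ?_⟩)
  · rcases Sym2.eq_iff.1 h with ⟨h, -⟩ | ⟨h, -⟩
    · exact J.switch.hy (h ▸ h1 s (by omega))
    · exact J.switch.hz (h ▸ h1 s (by omega))
  · rcases Sym2.eq_iff.1 h with ⟨h, -⟩ | ⟨h, -⟩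
    · have := J.nb'.injOn g.tree.1 (by omega) (by omega) h
      omega
    · have := J.nb'.injOn g.tree.1 (by omega) (by omega) h
      omega
  · rcases Sym2.eq_iff.1 h with ⟨h, -⟩ | ⟨-, h⟩
    · exact J.switch.ha (h ▸ h1 s (by omega))
    · exact J.switch.ha (h ▸ h1 (s + 1) (by omega))

lemma Joint.adj_middle (J : S.Joint b R ρ D i (S.used + 1) β t w w') :
    (S.extend b R ρ D i (S.used + 1) β t w w' σ p).graph.Adj (w (t + D)) (w' (D + β)) :=
  (J.switch.adj_y _).2 (Or.inr rfl)

/-- `w` forwards, the new edge, then `w'` backwards: t + D, 1 and D + β edges. -/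
lemma Joint.hasPath (J : S.Joint b R ρ D i (S.used + 1) β t w w')
    (g : S.Good b Δ k R ρ D (i + 1)) (hb : b.IsValid k) (hi : 1 ≤ i) (hD : 1 ≤ D) (hβ : β ≤ 1) :
    (S.extend b R ρ D i (S.used + 1) β t w w' σ p).HasPath (w 0) (w 1) (w' 1)
      (b.core (S.used + 1)) (t + D + 1 + D + β) := by
  have h1 := J.notMem_region g (Nat.lt_succ_self _) (g.used_lt hi)
  have h2 := J.mem_region g hb hi hβ
  refine ⟨fun s => if s ≤ t + D then w s else w' (t + D + 1 + D + β - s), ?_, ?_, ?_, ?_, ⟨?_, ?_⟩,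
    ?_⟩
  · simp
  · dsimp only
    rw [if_pos (by omega)]
  · dsimp only
    rw [if_neg (by omega)]
    congr 1
    omega
  · dsimp only
    rw [if_neg (by omega), Nat.sub_self, J.zero']
  · intro s hs
    rcases lt_trichotomy s (t + D) with h | rfl | h
    · rw [if_pos h.le, if_pos (by omega)]
      exact J.adj_left g hi s h
    · rw [if_pos le_rfl, if_neg (by omega), show t + D + 1 + D + β - (t + D + 1) = D + β by omega]
      exact J.adj_middle
    · rw [if_neg (by omega), if_neg (by omega)]
      have := J.adj_right (σ := σ) (p := p) g hb hi hβ (t + D + 1 + D + β - (s + 1)) (by omega)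
      rw [show t + D + 1 + D + β - (s + 1) + 1 = t + D + 1 + D + β - s by omega] at this
      exact this.symm
  · intro s hs
    by_cases h : s + 2 ≤ t + D
    · rw [if_pos h, if_pos (by omega)]
      exact J.nb.ne s (by omega)
    · rw [if_neg h]
      by_cases h' : s ≤ t + D
      · rw [if_pos h']
        exact fun e => h1 s (by omega) (e ▸ h2 _ (by omega))
      · rw [if_neg h']
        have := J.nb'.ne (t + D + 1 + D + β - (s + 2)) (by omega)
        rw [show t + D + 1 + D + β - (s + 2) + 2 = t + D + 1 + D + β - s by omega] at this
        exact this.symm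
  · intro s hs
    dsimp only
    rw [mem_extend_trunk]
    split_ifs with h
    · exact Or.inr (Or.inl ⟨s, h, rfl⟩)
    · exact Or.inr (Or.inr ⟨_, by omega, rfl⟩)

lemma Good.level_le (g : S.Good b Δ k R ρ D (i + 1)) (hR : ρ + 1 ≤ R) :
    ∀ v ∈ S.graph.ballOf (S.trunk : Set (Fin n)) ρ, i * R ≤ S.level v := by
  intro v hv
  have hM := le_radius i ρ D
  have h1 := LevelAt.mono_ball g.loc (r := ρ) g.level
    (fun v hv => g.ball v (SimpleGraph.ballOf_mono le_rfl (by omega) hv)) v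
    (SimpleGraph.ballOf_mono le_rfl (Nat.le_succ ρ) hv)
  have h2 : (i + 1) * R = i * R + R := by ring
  omega

lemma Joint.level_trunk (J : S.Joint b R ρ D i (S.used + 1) β t w w')
    (g : S.Good b Δ k R ρ D (i + 1)) (hi : 1 ≤ i) (hR : ρ + 1 ≤ R) :
    ∀ v ∈ (S.extend b R ρ D i (S.used + 1) β t w w' σ p).trunk, i * R ≤ S.level v := by
  intro v hv
  rcases mem_extend_trunk.1 hv with hv | ⟨s, hs, rfl⟩ | ⟨s, hs, rfl⟩
  · exact g.level_le hR v hv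
  · rcases Nat.eq_zero_or_pos s with rfl | h
    · exact g.level_le hR _ (J.mem 0 (by omega))
    · exact J.level s h hs
  · rcases Nat.eq_zero_or_pos s with rfl | h
    · rw [J.zero']
      exact (g.fresh _ (Nat.lt_succ_self _) (g.used_lt hi)).level
    · exact J.level' s h hs

/-- Only the ends of the new edge need an argument: their previous vertex on the arm and each other
are two neighbours of full level `i * R`. With `D ≥ 2` this previous vertex is not the start of the
arm, which `J.level` and `J.level'` do not cover. -/
lemma Joint.levelAt (J : S.Joint b R ρ D i (S.used + 1) β t w w')
    (g : S.Good b Δ k R ρ D (i + 1)) (hb : b.IsValid k) (hi : 1 ≤ i) (hD : 2 ≤ D) (hβ : β ≤ 1) {v : Fin n}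
    (hv : v ∉ (S.extend b R ρ D i (S.used + 1) β t w w' σ p).bad) :
    LevelAt Δ k R (S.extend b R ρ D i (S.used + 1) β t w w' σ p).graph
      (S.extend b R ρ D i (S.used + 1) β t w w' σ p).level v := by
  have hlk := g.used_lt hi
  have fr := g.fresh _ (Nat.lt_succ_self _) hlk
  have h1 := J.notMem_region g (Nat.lt_succ_self _) (g.used_lt hi)
  have h2 := J.mem_region g hb hi hβ
  have hbad : v ∉ S.bad := fun h => hv (Or.inl h)
  have hz : v ≠ w (t + D + 1) := fun h => hv (Or.inr (Or.inl h))
  have hz' : v ≠ w' (D + β + 1) := fun h => hv (Or.inr (Or.inr h))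
  have ha : v ≠ b.outer (S.used + 1) := fun h => hbad (h ▸ fr.outer_bad)
  have hin : v ≠ b.inner (S.used + 1) := fun h => hbad (h ▸ fr.inner_bad)
  have L := g.loc v hbad
  have hdeg : 1 ≤ min (S.level v) (i * R) →
      (nbrs (S.extend b R ρ D i (S.used + 1) β t w w' σ p).graph v).card = Δ := fun h => by
    rw [← L.degree (h.trans (min_le_left _ _))]
    exact J.switch.card_nbrs v
  have hlev : ∀ s, 1 ≤ s → s ≤ t + D → min (S.level (w s)) (i * R) = i * R := fun s h h' =>
    min_eq_right (J.level s h h')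
  have hlev' : ∀ s, 1 ≤ s → s ≤ D + β → min (S.level (w' s)) (i * R) = i * R := fun s h h' =>
    min_eq_right (J.level' s h h')
  by_cases hy : v = w (t + D)
  · subst hy
    have hadj := J.switch.adj_y
    refine ⟨hdeg, ?_, ?_⟩
    · intro u hu
      change min _ _ ≤ min _ _ + 1
      rcases (hadj u).1 hu with ⟨hu, -⟩ | rfl
      · have := L.lipschitz u hu
        omega
      · rw [hlev' _ (by omega) le_rfl]
        omega
    · intro j hj hjk hjl
      have hjl' : j * R ≤ i * R := hjl.trans (min_le_right _ _)
      have hprev : S.graph.Adj (w (t + D)) (w (t + D - 1)) := by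
        have := J.nb.adj (t + D - 1) (by omega)
        rw [show t + D - 1 + 1 = t + D by omega] at this
        exact this.symm
      refine ⟨w (t + D - 1), w' (D + β), ?_, (hadj _).2 (Or.inl ⟨hprev, ?_⟩),
        (hadj _).2 (Or.inr rfl), ?_, ?_⟩
      · exact fun h => h1 _ (by omega) (h ▸ h2 _ (by omega))
      · have := J.nb.ne (t + D - 1) (by omega)
        rw [show t + D - 1 + 2 = t + D + 1 by omega] at this
        exact this.symm
      · exact hjl'.trans (hlev _ (by omega) (by omega)).ge
      · exact hjl'.trans (hlev' _ (by omega) (by omega)).ge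
  by_cases hy' : v = w' (D + β)
  · subst hy'
    have hadj := J.switch.adj_y'
    refine ⟨hdeg, ?_, ?_⟩
    · intro u hu
      change min _ _ ≤ min _ _ + 1
      rcases (hadj u).1 hu with ⟨hu, -⟩ | rfl
      · have := L.lipschitz u hu
        omega
      · rw [hlev _ (by omega) le_rfl]
        omega
    · intro j hj hjk hjl
      have hjl' : j * R ≤ i * R := hjl.trans (min_le_right _ _)
      have hprev : S.graph.Adj (w' (D + β)) (w' (D + β - 1)) := by
        have := J.nb'.adj (D + β - 1) (by omega)
        rw [show D + β - 1 + 1 = D + β by omega] at this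
        exact this.symm
      refine ⟨w' (D + β - 1), w (t + D), ?_, (hadj _).2 (Or.inl ⟨hprev, ?_⟩),
        (hadj _).2 (Or.inr rfl), ?_, ?_⟩
      · exact fun h => h1 _ (by omega) (h ▸ h2 _ (by omega))
      · have := J.nb'.ne (D + β - 1) (by omega)
        rw [show D + β - 1 + 2 = D + β + 1 by omega] at this
        exact this.symm
      · exact hjl'.trans (hlev' _ (by omega) (by omega)).ge
      · exact hjl'.trans (hlev _ (by omega) (by omega)).ge
  have hadj := J.adj_of_notMem (σ := σ) (p := p) (v := v) (by
    rintro (h | h | h | h | h | h)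
    exacts [hy h, hz h, hy' h, hz' h, ha h, hin h])
  refine ⟨hdeg, ?_, ?_⟩
  · intro u hu
    change min _ _ ≤ min _ _ + 1
    have := L.lipschitz u ((hadj u).1 hu)
    omega
  · intro j hj hjk hjl
    have hjl' : j * R ≤ i * R := hjl.trans (min_le_right _ _)
    obtain ⟨w₁, w₂, h3, h4, h5, h6, h7⟩ := L.two j hj hjk (hjl.trans (min_le_left _ _))
    exact ⟨w₁, w₂, h3, (hadj _).2 h4, (hadj _).2 h5, le_min h6 hjl', le_min h7 hjl'⟩

lemma Joint.connectedFrom (J : S.Joint b R ρ D i (S.used + 1) β t w w')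
    (g : S.Good b Δ k R ρ D (i + 1)) (hb : b.IsValid k) (hi : 1 ≤ i) (hD : 1 ≤ D) (hβ : β ≤ 1) :
    (S.extend b R ρ D i (S.used + 1) β t w w' σ p).graph.ConnectedFrom (b.core 0)
      ((S.extend b R ρ D i (S.used + 1) β t w w' σ p).trunk : Set (Fin n)) := by
  set S' := S.extend b R ρ D i (S.used + 1) β t w w' σ p with hS'
  have hQ : ∀ v ∈ S.graph.ballOf (S.trunk : Set (Fin n)) ρ, ∃ q : S'.graph.Walk (b.core 0) v,
      ∀ x ∈ q.support, x ∈ (S'.trunk : Set (Fin n)) := by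
    intro v hv
    obtain ⟨q, hq⟩ := g.conn.ballOf ρ v hv
    have hq' : ∀ e ∈ q.edges, e ∈ S'.graph.edgeSet := by
      intro e he
      induction e with
      | _ x y =>
        refine (J.adj_of_notMem (σ := σ) (p := p) (v := x) ?_ y).2 (q.adj_of_mem_edges he)
        exact J.touched_far g hb hi hβ (T := D - 1) (by omega) _ (SimpleGraph.subset_ballOf _ _
          (Or.inl (hq x (q.fst_mem_support_of_mem_edges he))))
    refine ⟨q.transfer _ hq', fun x hx => ?_⟩
    rw [SimpleGraph.Walk.support_transfer] at hx
    exact mem_extend_trunk.2 (Or.inl (hq x hx))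
  have hw : ∀ s ≤ t + D, ∃ q : S'.graph.Walk (b.core 0) (w s),
      ∀ x ∈ q.support, x ∈ (S'.trunk : Set (Fin n)) := by
    intro s
    induction s with
    | zero => exact fun _ => hQ _ (J.mem 0 (by omega))
    | succ s ih =>
      exact fun hs => SimpleGraph.ConnectedFrom.step (ih (by omega)) (J.adj_left g hi s (by omega))
        (mem_extend_trunk.2 (Or.inr (Or.inl ⟨_, hs, rfl⟩)))
  have hw' : ∀ s ≤ D + β, ∃ q : S'.graph.Walk (b.core 0) (w' (D + β - s)),
      ∀ x ∈ q.support, x ∈ (S'.trunk : Set (Fin n)) := by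
    intro s
    induction s with
    | zero =>
      exact fun _ => SimpleGraph.ConnectedFrom.step (hw _ le_rfl) J.adj_middle
        (mem_extend_trunk.2 (Or.inr (Or.inr ⟨_, le_rfl, rfl⟩)))
    | succ s ih =>
      intro hs
      have := J.adj_right (σ := σ) (p := p) g hb hi hβ (D + β - (s + 1)) (by omega)
      rw [show D + β - (s + 1) + 1 = D + β - s by omega] at this
      exact SimpleGraph.ConnectedFrom.step (ih (by omega)) this.symm
        (mem_extend_trunk.2 (Or.inr (Or.inr ⟨_, by omega, rfl⟩)))
  intro v hv
  rcases mem_extend_trunk.1 hv with hv | ⟨s, hs, rfl⟩ | ⟨s, hs, rfl⟩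
  · exact hQ v hv
  · exact hw s hs
  · have := hw' (D + β - s) (by omega)
    rwa [show D + β - (D + β - s) = s by omega] at this

/-- The exchanged edges have no end in a later region, so its structure is inherited. -/
lemma Joint.fresh (J : S.Joint b R ρ D i (S.used + 1) β t w w')
    (g : S.Good b Δ k R ρ D (i + 1)) (hb : b.IsValid k) (hβ : β ≤ 1) {m : ℕ}
    (h1 : S.used + 1 < m) (h2 : m ≤ k) :
    (S.extend b R ρ D i (S.used + 1) β t w w' σ p).Fresh b R (i * (ρ + D + 3)) (i - 1) m := by
  have hM := le_radius i ρ D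
  have f := g.fresh m (by omega) h2
  have htouch := J.touched_notMem_region g hb hβ h1 h2
  have hadj : ∀ v ∈ b.region m, ∀ u,
      (S.extend b R ρ D i (S.used + 1) β t w w' σ p).graph.Adj v u ↔ S.graph.Adj v u :=
    fun v hv => J.adj_of_notMem (fun h => htouch v h hv)
  have hmem := g.mem_region hb (by omega) h2
  refine ⟨?_, ?_, Or.inl f.outer_bad, Or.inl f.inner_bad, ?_, ?_, ?_⟩
  · exact fun v u hvu hv hu => f.cross v u ((hadj u hu v).1 hvu.symm).symm hv hu
  · exact ((hadj _ (hb.inner_mem m (by omega) h2) _).2 f.adj.symm).symm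
  · intro v hv
    rw [SimpleGraph.ballOf_congr (Z := {b.core m}) (T := i * (ρ + D + 3)) (fun u hu u' =>
      (hadj u (hmem u (SimpleGraph.ballOf_mono le_rfl (by omega) hu)) u').symm) le_rfl le_rfl] at hv
    have hv' := hmem v (SimpleGraph.ballOf_mono le_rfl (by omega) hv)
    rintro (h | rfl | rfl)
    · exact f.ball v (SimpleGraph.ballOf_mono le_rfl (by omega) hv) h
    · exact htouch _ (Or.inr (Or.inl rfl)) hv'
    · exact htouch _ (Or.inr (Or.inr (Or.inr (Or.inl rfl)))) hv'
  · have := f.level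
    rw [Nat.add_sub_cancel] at this
    have h3 : (i - 1) * R ≤ i * R := Nat.mul_le_mul_right _ (Nat.sub_le _ _)
    exact le_min (h3.trans this) h3
  · intro v hv
    rcases mem_extend_trunk.1 hv with hv | ⟨s, hs, rfl⟩ | ⟨s, hs, rfl⟩
    · exact g.notMem_region (by omega) h2 v (SimpleGraph.ballOf_mono le_rfl (by omega) hv)
    · exact J.notMem_region g (by omega) h2 s (by omega)
    · exact g.notMem_region_of_later hb (Nat.lt_succ_self _) h1 h2 _
        (SimpleGraph.ballOf_mono le_rfl (by omega) (J.ball' s (by omega)))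

/-- A stage can be extended by a path from a given half-edge near the trunk to a given half-edge
at the next core, of two consecutive lengths. -/
theorem Good.exists_extension {T : ℕ} (g : S.Good b Δ k R ρ (T + 2) (i + 1)) (hb : b.IsValid k)
    (hΔ : 3 ≤ Δ) (hi : 1 ≤ i) (hR : ρ + 1 ≤ R) {x e f : Fin n}
    (hx : x ∈ S.graph.ballOf (S.trunk : Set (Fin n)) ρ) (he : S.graph.Adj x e)
    (hf : S.graph.Adj (b.core (S.used + 1)) f) (hfl : i * R ≤ S.level f) {q : ℕ}
    (hq : (S.graph.ballOf (S.trunk : Set (Fin n)) ρ).ncard ≤ q) :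
    ∃ m, 0 < m ∧ ∀ β ≤ 1, ∃ S' : Stage n, S'.Good b Δ k R ρ (T + 2) i ∧ S.Continues b k ρ T S' ∧
      S'.HasPath x e f (b.core (S.used + 1)) (m + β) ∧ S'.trunk.card ≤ 2 * q + 2 * T + 6 := by
  classical
  set Q : Finset (Fin n) :=
    Finset.univ.filter (fun v => v ∈ S.graph.ballOf (S.trunk : Set (Fin n)) ρ) with hQdef
  have hQ : (Q : Set (Fin n)) = S.graph.ballOf (S.trunk : Set (Fin n)) ρ := by simp [Q]
  have hQq : Q.card ≤ q := by rwa [← Set.ncard_coe_finset, hQ]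
  obtain ⟨t, w, htQ, rfl, rfl, hw⟩ := g.exists_joint hb hΔ hi hR (by omega) hx he hf hfl hQ
  refine ⟨t + (T + 2) + 1 + (T + 2), by omega, fun β hβ => ?_⟩
  obtain ⟨w', rfl, J⟩ := hw β hβ
  -- The revealed set depends only on graph and trunk, so it can be formed with the old order before
  -- the new order is constructed from it.
  set Rev := (S.extend b R ρ (T + 2) i (S.used + 1) β t w w' S.order S.num).revealed b k ρ with hRev
  have hsub : ∀ v ∈ S.revealed b k ρ, v ∈ Rev := by
    rintro v (hv | hv)
    · exact Or.inl (SimpleGraph.subset_ballOf _ _ (mem_extend_trunk.2 (Or.inl hv)))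
    · exact Or.inr hv
  obtain ⟨σ, p, hp1, hp2, hσ, hp⟩ := exists_perm_extend S.order g.num_le Rev.toFinite.toFinset
    (fun j hj => (Set.Finite.mem_toFinset _).2 (hsub _ ((g.revealed _).2 ⟨j, hj, rfl⟩)))
  simp only [Set.Finite.mem_toFinset] at hp
  refine ⟨S.extend b R ρ (T + 2) i (S.used + 1) β t w w' σ p, ?_, ?_,
    J.hasPath g hb hi (by omega) hβ, ?_⟩
  · refine ⟨⟨J.switch.isTree g.tree.1, fun v => ?_⟩, fun v hv => J.levelAt g hb hi (by omega) hβ hv,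
      J.connectedFrom g hb hi (by omega) hβ, ?_, ?_, ?_, ?_, ?_, ?_, hp2, hp⟩
    · have h1 := J.switch.card_nbrs v
      have h2 := g.tree.2 v
      rw [← h1] at h2
      exact h2
    · exact mem_extend_trunk.2 (Or.inl (SimpleGraph.subset_ballOf _ _ g.core_zero))
    · exact fun v hv => le_min (J.level_trunk g hi hR v hv) le_rfl
    · intro v hv
      have hfr := g.fresh _ (Nat.lt_succ_self _) (g.used_lt hi)
      have hM := le_radius i ρ (T + 2)
      rcases J.ball_extend g hb hi hβ v hv with ⟨h1, h2, h3⟩ | ⟨h1, h2, h3⟩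
      · rintro (h | h | h)
        · exact g.ball v h1 h
        · exact h3 h
        · exact h2 (h ▸ J.switch.hz')
      · rintro (h | h | h)
        · exact hfr.ball v h1 h
        · exact J.switch.hz (h ▸ h2)
        · exact h3 h
    · have := g.used_le
      change i + (S.used + 1) ≤ k + 1
      omega
    · intro l h1 h2
      change l ≤ S.used + 1 at h2
      rcases Nat.lt_or_ge S.used l with h | h
      · obtain rfl : l = S.used + 1 := by omega
        exact mem_extend_trunk.2 (Or.inr (Or.inr ⟨0, by omega, J.zero'⟩))
      · exact mem_extend_trunk.2 (Or.inl (SimpleGraph.subset_ballOf _ _ (g.core_used l h1 h)))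
    · exact fun l h1 h2 => J.fresh g hb hβ h1 h2
  -- Arms of length T + 1 would already hide the switch. The spare step ensures `D ≥ 2` also for T =
  -- 0.
  · exact ⟨hp1, hσ, fun u hu v => (J.adj_of_notMem (J.touched_far g hb hi hβ (T := T + 1) rfl u
      (SimpleGraph.ballOf_mono le_rfl (Nat.le_succ T) hu)) v).symm⟩
  · have h1 : (S.extend b R ρ (T + 2) i (S.used + 1) β t w w' σ p).trunk.card ≤
        Q.card + (t + (T + 2) + 1) + ((T + 2) + β + 1) := by
      refine (Finset.card_union_le _ _).trans (Nat.add_le_add ((Finset.card_union_le _ _).trans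
        (Nat.add_le_add (le_of_eq ?_) ?_)) ?_)
      · rw [hQdef]
      · exact Finset.card_image_le.trans (by simp)
      · exact Finset.card_image_le.trans (by simp)
    omega

end Stage

lemma SimpleGraph.ncard_ballOf_le {V : Type*} [Finite V] {G : SimpleGraph V} {Δ : ℕ}
    (hG : ∀ v, (nbrs G v).card ≤ Δ) (Y : Finset V) (r : ℕ) :
    (G.ballOf (Y : Set V) r).ncard ≤ Y.card * (Δ + 1) ^ r := by
  classical
  induction r with
  | zero => rw [SimpleGraph.ballOf_zero, Set.ncard_coe_finset]; simp
  | succ r ih =>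
    set B := (G.ballOf (Y : Set V) r).toFinite.toFinset with hB
    have hBc : B.card ≤ Y.card * (Δ + 1) ^ r := by
      rwa [← Set.ncard_eq_toFinset_card]
    have hsub : G.ballOf (Y : Set V) (r + 1) ⊆ (B ∪ B.biUnion (nbrs G) : Finset V) := by
      intro v hv
      rw [Finset.mem_coe, Finset.mem_union, Finset.mem_biUnion]
      rcases SimpleGraph.ballOf_succ_cases hv with h | ⟨u, hu, huv⟩
      · exact Or.inl ((Set.Finite.mem_toFinset _).2 h)
      · exact Or.inr ⟨u, (Set.Finite.mem_toFinset _).2 hu, mem_nbrs.2 huv⟩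
    refine (Set.ncard_le_ncard hsub (Set.toFinite _)).trans ?_
    rw [Set.ncard_coe_finset]
    refine (Finset.card_union_le _ _).trans ?_
    have h1 := Finset.card_biUnion_le_card_mul B (nbrs G) Δ (fun v _ => hG v)
    calc B.card + _ ≤ B.card + B.card * Δ := Nat.add_le_add_left h1 _
      _ = B.card * (Δ + 1) := by ring
      _ ≤ Y.card * (Δ + 1) ^ r * (Δ + 1) := Nat.mul_le_mul_right _ hBc
      _ = Y.card * (Δ + 1) ^ (r + 1) := by ring

lemma IsRegularTree.card_nbrs_le {V : Type*} [Finite V] {G : SimpleGraph V} {Δ : ℕ}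
    (h : IsRegularTree Δ G) (hΔ : 1 ≤ Δ) (v : V) : (nbrs G v).card ≤ Δ := by
  rcases h.2 v with h | h <;> omega

/-! ### The family of all stages -/

namespace Stage

variable {n : ℕ} {b : Board n} {Δ k R ρ D i T : ℕ} {S S' S'' : Stage n}

lemma Continues.refl (S : Stage n) : Continues b k ρ T S S :=
  ⟨le_rfl, fun _ _ => rfl, fun _ _ _ => Iff.rfl⟩

lemma Continues.revealed_subset (h : Continues b k ρ T S S')
    (hS : ∀ v, v ∈ S.revealed b k ρ ↔ ∃ j : Fin n, j.val < S.num ∧ S.order j = v)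
    (hS' : ∀ v, v ∈ S'.revealed b k ρ ↔ ∃ j : Fin n, j.val < S'.num ∧ S'.order j = v) :
    S.revealed b k ρ ⊆ S'.revealed b k ρ := by
  intro v hv
  obtain ⟨j, hj, rfl⟩ := (hS v).1 hv
  exact (hS' _).2 ⟨j, hj.trans_le h.num_le, h.order j hj⟩

lemma Continues.trans (h : Continues b k ρ T S S') (h' : Continues b k ρ T S' S'')
    (hsub : S.revealed b k ρ ⊆ S'.revealed b k ρ) : Continues b k ρ T S S'' := by
  refine ⟨h.num_le.trans h'.num_le, fun j hj => ?_, fun u hu v => ?_⟩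
  · rw [h'.order j (hj.trans_le h.num_le), h.order j hj]
  · rw [h.agree u hu v]
    refine h'.agree u ?_ v
    have := SimpleGraph.ballOf_congr h.agree le_rfl le_rfl
    rw [← this] at hu
    exact SimpleGraph.ballOf_mono hsub le_rfl hu

/-- Every possible extension of the stage `S` at the level `i` is in `F`. -/
def ExtendsIn (b : Board n) (k R ρ T i : ℕ) (S : Stage n) (F : Finset (Stage n)) : Prop :=
  ∀ x e f, x ∈ S.graph.ballOf (S.trunk : Set (Fin n)) ρ → S.graph.Adj x e →
    S.graph.Adj (b.core (S.used + 1)) f → i * R ≤ S.level f →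
    ∃ m, 0 < m ∧ ∀ β ≤ 1, ∃ S' ∈ F, S.Continues b k ρ T S' ∧
      S'.HasPath x e f (b.core (S.used + 1)) (m + β)

/-- One new stage for each choice of `x`, `e`, `f` and β: at most q (Δ+1)^ρ nodes `x` near the
trunk, Δ choices each for `e` and `f`, and two lengths. The old stages are kept. -/
lemma exists_finset_extension (hb : b.IsValid k) (hΔ : 3 ≤ Δ) (hi : 1 ≤ i) (hR : ρ + 1 ≤ R)
    {q : ℕ} (F : Finset (Stage n)) (hF : ∀ S ∈ F, S.Good b Δ k R ρ (T + 2) (i + 1))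
    (hq : ∀ S ∈ F, S.trunk.card ≤ q) :
    ∃ F' : Finset (Stage n), F ⊆ F' ∧ (∀ S' ∈ F', S'.Good b Δ k R ρ (T + 2) i) ∧
      (∀ S ∈ F, S.ExtendsIn b k R ρ T i F') ∧
      (∀ S' ∈ F', ∃ S ∈ F, S.Continues b k ρ T S') ∧
      (∀ S' ∈ F', S'.trunk.card ≤ 2 * (q * (Δ + 1) ^ ρ) + 2 * T + 6) ∧
      F'.card ≤ F.card * (1 + q * (Δ + 1) ^ ρ * (Δ * (Δ * 2))) := by
  classical
  let cond : Stage n × Fin n × Fin n × Fin n → Prop := fun τ =>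
    τ.1 ∈ F ∧ τ.2.1 ∈ τ.1.graph.ballOf (τ.1.trunk : Set (Fin n)) ρ ∧
    τ.1.graph.Adj τ.2.1 τ.2.2.1 ∧ τ.1.graph.Adj (b.core (τ.1.used + 1)) τ.2.2.2 ∧
    i * R ≤ τ.1.level τ.2.2.2
  have hball : ∀ S ∈ F, (S.graph.ballOf (S.trunk : Set (Fin n)) ρ).ncard ≤ q * (Δ + 1) ^ ρ :=
    fun S hS => (SimpleGraph.ncard_ballOf_le ((hF S hS).tree.card_nbrs_le (by omega)) _ _).trans
      (Nat.mul_le_mul_right _ (hq S hS))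
  have hex : ∀ τ, ∃ (m : ℕ) (g : ℕ → Stage n), cond τ → 0 < m ∧ ∀ β ≤ 1,
      (g β).Good b Δ k R ρ (T + 2) i ∧ τ.1.Continues b k ρ T (g β) ∧
      (g β).HasPath τ.2.1 τ.2.2.1 τ.2.2.2 (b.core (τ.1.used + 1)) (m + β) ∧
      (g β).trunk.card ≤ 2 * (q * (Δ + 1) ^ ρ) + 2 * T + 6 := by
    rintro ⟨S, x, e, f⟩
    by_cases h : cond ⟨S, x, e, f⟩
    · obtain ⟨m, hm, hβ⟩ := (hF S h.1).exists_extension hb hΔ hi hR h.2.1 h.2.2.1 h.2.2.2.1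
        h.2.2.2.2 (hball S h.1)
      have : ∀ β, ∃ S', β ≤ 1 → S'.Good b Δ k R ρ (T + 2) i ∧ S.Continues b k ρ T S' ∧
          S'.HasPath x e f (b.core (S.used + 1)) (m + β) ∧
          S'.trunk.card ≤ 2 * (q * (Δ + 1) ^ ρ) + 2 * T + 6 := by
        intro β
        by_cases h' : β ≤ 1
        · obtain ⟨S', hS'⟩ := hβ β h'
          exact ⟨S', fun _ => hS'⟩
        · exact ⟨S, fun h => absurd h h'⟩
      choose g hg using this
      exact ⟨m, g, fun _ => ⟨hm, hg⟩⟩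
    · exact ⟨0, fun _ => S, fun h' => absurd h' h⟩
  choose m g hg using hex
  let N : Stage n → Finset (Stage n) := fun S =>
    (S.graph.ballOf (S.trunk : Set (Fin n)) ρ).toFinite.toFinset.biUnion fun x =>
      (nbrs S.graph x).biUnion fun e =>
        ((nbrs S.graph (b.core (S.used + 1))).filter (fun f => i * R ≤ S.level f)).biUnion fun f =>
          (Finset.range 2).image (g (S, x, e, f))
  have hN : ∀ S ∈ F, ∀ S' ∈ N S, S'.Good b Δ k R ρ (T + 2) i ∧ S.Continues b k ρ T S' ∧
      S'.trunk.card ≤ 2 * (q * (Δ + 1) ^ ρ) + 2 * T + 6 := by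
    intro S hS S' hS'
    simp only [N, Finset.mem_biUnion, Finset.mem_image, Finset.mem_filter, mem_nbrs,
      Set.Finite.mem_toFinset, Finset.mem_range] at hS'
    obtain ⟨x, hx, e, he, f, ⟨hf, hfl⟩, β, hβ, rfl⟩ := hS'
    have := (hg (S, x, e, f) ⟨hS, hx, he, hf, hfl⟩).2 β (by omega)
    exact ⟨this.1, this.2.1, this.2.2.2⟩
  refine ⟨F ∪ F.biUnion N, Finset.subset_union_left, ?_, ?_, ?_, ?_, ?_⟩
  · intro S' hS'
    rcases Finset.mem_union.1 hS' with h | h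
    · exact (hF S' h).mono
    · obtain ⟨S, hS, h⟩ := Finset.mem_biUnion.1 h
      exact (hN S hS S' h).1
  · intro S hS x e f hx he hf hfl
    obtain ⟨h1, h2⟩ := hg (S, x, e, f) ⟨hS, hx, he, hf, hfl⟩
    refine ⟨_, h1, fun β hβ => ⟨g (S, x, e, f) β, ?_, (h2 β hβ).2.1, (h2 β hβ).2.2.1⟩⟩
    refine Finset.mem_union_right _ (Finset.mem_biUnion.2 ⟨S, hS, ?_⟩)
    simp only [N, Finset.mem_biUnion, Finset.mem_image, Finset.mem_filter, mem_nbrs,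
      Set.Finite.mem_toFinset, Finset.mem_range]
    exact ⟨x, hx, e, he, f, ⟨hf, hfl⟩, β, by omega, rfl⟩
  · intro S' hS'
    rcases Finset.mem_union.1 hS' with h | h
    · exact ⟨S', h, Continues.refl S'⟩
    · obtain ⟨S, hS, h⟩ := Finset.mem_biUnion.1 h
      exact ⟨S, hS, (hN S hS S' h).2.1⟩
  · intro S' hS'
    rcases Finset.mem_union.1 hS' with h | h
    · have h1 := hq S' h
      have h2 : 1 ≤ (Δ + 1) ^ ρ := Nat.one_le_pow _ _ (by omega)
      have h3 := Nat.mul_le_mul_left q h2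
      omega
    · obtain ⟨S, hS, h⟩ := Finset.mem_biUnion.1 h
      exact (hN S hS S' h).2.2
  · refine (Finset.card_union_le _ _).trans ?_
    rw [Nat.mul_add, Nat.mul_one]
    refine Nat.add_le_add_left (Finset.card_biUnion_le_card_mul _ _ _ fun S hS => ?_) _
    refine (Finset.card_biUnion_le_card_mul _ _ (Δ * (Δ * 2)) fun x _ => ?_).trans
      (Nat.mul_le_mul_right _ ?_)
    · refine (Finset.card_biUnion_le_card_mul _ _ (Δ * 2) fun e _ => ?_).trans
        (Nat.mul_le_mul_right _ ((hF S hS).tree.card_nbrs_le (by omega) _))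
      refine (Finset.card_biUnion_le_card_mul _ _ 2 fun f _ => ?_).trans
        (Nat.mul_le_mul_right _ ?_)
      · exact Finset.card_image_le.trans (by simp)
      · exact (Finset.card_filter_le _ _).trans ((hF S hS).tree.card_nbrs_le (by omega) _)
    · rw [← Set.ncard_eq_toFinset_card]
      exact hball S hS

/-- The stages that arise from `S₀` by extensions at the levels `k, …, i` form `F i`. -/
structure IsFamily (b : Board n) (Δ k R ρ T : ℕ) (S₀ : Stage n) (F : ℕ → Finset (Stage n)) :
    Prop where
  root : S₀ ∈ F (k + 1)
  subset : ∀ i, 1 ≤ i → i ≤ k → F (i + 1) ⊆ F i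
  good : ∀ i, 1 ≤ i → i ≤ k + 1 → ∀ S ∈ F i, S.Good b Δ k R ρ (T + 2) i
  extend : ∀ i, 1 ≤ i → i ≤ k → ∀ S ∈ F (i + 1), S.ExtendsIn b k R ρ T i (F i)
  continues : ∀ i, 1 ≤ i → i ≤ k + 1 → ∀ S ∈ F i, S₀.Continues b k ρ T S

/-- A bound for the growth of the number of stages. -/
def growth (Δ k ρ : ℕ) : ℕ :=
  (1 + (Δ + 1) ^ ρ * (Δ * (Δ * 2))) * (2 * (Δ + 1) ^ ρ + 6) ^ k

/-- The first trunk is a single node, later ones have O(T) nodes. So the first extension multiplies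
the number of stages by a constant and each of the other k - 1 by O(T). -/
theorem exists_isFamily (hb : b.IsValid k) (hΔ : 3 ≤ Δ) (hR : ρ + 1 ≤ R)
    {S₀ : Stage n} (hS : S₀.Good b Δ k R ρ (T + 2) (k + 1)) (hcard : S₀.trunk.card = 1) :
    ∃ F, IsFamily b Δ k R ρ T S₀ F ∧ (F 1).card ≤ growth Δ k ρ ^ k * (T + 1) ^ (k - 1) := by
  set B := (Δ + 1) ^ ρ with hB
  set E := 2 * B + 6 with hE
  set K := growth Δ k ρ with hK
  have hE1 : 1 ≤ E := by omega
  -- the families, indexed from the root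
  have key : ∀ j ≤ k, ∃ G : ℕ → Finset (Stage n), S₀ ∈ G 0 ∧ (∀ j' < j, G j' ⊆ G (j' + 1)) ∧
      (∀ j' ≤ j, ∀ S ∈ G j', S.Good b Δ k R ρ (T + 2) (k + 1 - j')) ∧
      (∀ j' < j, ∀ S ∈ G j', S.ExtendsIn b k R ρ T (k - j') (G (j' + 1))) ∧
      (∀ j' ≤ j, ∀ S ∈ G j', S₀.Continues b k ρ T S) ∧
      (∀ S ∈ G j, S.trunk.card ≤ if j = 0 then 1 else E ^ j * (T + 1)) ∧
      (G j).card ≤ K ^ j * (T + 1) ^ (j - 1) := by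
    intro j
    induction j with
    | zero =>
      refine fun _ => ⟨fun _ => {S₀}, by simp, by simp, ?_, by simp, ?_, by simp [hcard], by simp⟩
      · rintro j' hj' S hS'
        obtain rfl : j' = 0 := by omega
        rw [Finset.mem_singleton.1 hS']
        exact hS
      · rintro j' hj' S hS'
        rw [Finset.mem_singleton.1 hS']
        exact Continues.refl _
    | succ j ih =>
      intro hj
      obtain ⟨G, h1, h2, h3, h4, h5, h6, h7⟩ := ih (by omega)
      have hg := h3 j le_rfl
      rw [show k + 1 - j = k - j + 1 by omega] at hg
      obtain ⟨F', e1, e2, e3, e4, e5, e6⟩ :=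
        exists_finset_extension hb hΔ (by omega : 1 ≤ k - j) hR (G j) hg h6
      have hG : ∀ j' ≤ j, Function.update G (j + 1) F' j' = G j' := fun j' hj' =>
        Function.update_of_ne (by omega) _ _
      have hG' : Function.update G (j + 1) F' (j + 1) = F' := Function.update_self _ _ _
      refine ⟨Function.update G (j + 1) F', ?_, ?_, ?_, ?_, ?_, ?_, ?_⟩
      · rwa [hG 0 (by omega)]
      · intro j' hj'
        rw [hG j' (by omega)]
        rcases Nat.lt_or_ge j' j with h | h
        · rw [hG _ (by omega)]
          exact h2 j' h
        · obtain rfl : j' = j := by omega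
          rwa [hG']
      · intro j' hj' S hS'
        rcases Nat.lt_or_ge j j' with h | h
        · obtain rfl : j' = j + 1 := by omega
          rw [hG'] at hS'
          rw [show k + 1 - (j + 1) = k - j by omega]
          exact e2 S hS'
        · rw [hG j' h] at hS'
          exact h3 j' h S hS'
      · intro j' hj' S hS'
        rw [hG j' (by omega)] at hS'
        rcases Nat.lt_or_ge j' j with h | h
        · rw [hG _ (by omega)]
          exact h4 j' h S hS'
        · obtain rfl : j' = j := by omega
          rw [hG']
          exact e3 S hS'
      · intro j' hj' S hS'
        rcases Nat.lt_or_ge j j' with h | h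
        · obtain rfl : j' = j + 1 := by omega
          rw [hG'] at hS'
          obtain ⟨S₁, hS₁, hc⟩ := e4 S hS'
          have hc' := h5 j le_rfl S₁ hS₁
          exact hc'.trans hc (hc'.revealed_subset hS.revealed (hg S₁ hS₁).revealed)
        · rw [hG j' h] at hS'
          exact h5 j' h S hS'
      · intro S hS'
        rw [hG'] at hS'
        rw [if_neg (by omega)]
        refine (e5 S hS').trans ?_
        have h8 : (if j = 0 then 1 else E ^ j * (T + 1)) ≤ E ^ j * (T + 1) := by
          split_ifs
          · exact Nat.one_le_iff_ne_zero.2 (by positivity)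
          · exact le_rfl
        have h9 : 1 ≤ E ^ j := Nat.one_le_pow _ _ (by omega)
        have h10 := Nat.mul_le_mul_right B h8
        have h11 : E ^ (j + 1) * (T + 1) = 2 * (E ^ j * (T + 1) * B) + 6 * (E ^ j * (T + 1)) := by
          rw [pow_succ, hE]
          ring
        have h12 := Nat.mul_le_mul_right (T + 1) h9
        rw [h11, ← hB]
        generalize E ^ j * (T + 1) = X at h8 h10 h12 ⊢
        generalize (if j = 0 then 1 else X) * B = Y at h10 ⊢
        generalize X * B = Z at h10 ⊢
        omega
      · rw [hG']
        refine e6.trans ?_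
        have hKj : (1 + B * (Δ * (Δ * 2))) * E ^ j ≤ K :=
          Nat.mul_le_mul_left _ (Nat.pow_le_pow_right hE1 (by omega))
        rcases Nat.eq_zero_or_pos j with rfl | hj0
        · rw [if_pos rfl]
          simp only [pow_zero, Nat.zero_add, Nat.sub_self, mul_one, pow_one, Nat.zero_sub,
            one_mul] at h7 hKj ⊢
          exact (Nat.mul_le_mul h7 hKj).trans (by simp)
        · rw [if_neg (by omega)]
          have h8 : 1 + E ^ j * (T + 1) * B * (Δ * (Δ * 2)) ≤ K * (T + 1) := by
            have h9 : 1 ≤ E ^ j * (T + 1) := Nat.one_le_iff_ne_zero.2 (by positivity)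
            calc _ ≤ E ^ j * (T + 1) + E ^ j * (T + 1) * B * (Δ * (Δ * 2)) :=
                  Nat.add_le_add_right h9 _
              _ = (1 + B * (Δ * (Δ * 2))) * E ^ j * (T + 1) := by ring
              _ ≤ _ := Nat.mul_le_mul_right _ hKj
          calc _ ≤ K ^ j * (T + 1) ^ (j - 1) * (K * (T + 1)) := Nat.mul_le_mul h7 h8
            _ = K ^ (j + 1) * ((T + 1) ^ (j - 1) * (T + 1)) := by ring
            _ = K ^ (j + 1) * (T + 1) ^ (j + 1 - 1) := by
              rw [← pow_succ, Nat.sub_add_cancel hj0, Nat.add_sub_cancel]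
  obtain ⟨G, h1, h2, h3, h4, h5, -, h7⟩ := key k le_rfl
  refine ⟨fun i => G (k + 1 - i), ⟨?_, ?_, ?_, ?_, ?_⟩, h7⟩
  · rwa [Nat.sub_self]
  · intro i hi hik
    have := h2 (k - i) (by omega)
    rwa [show k + 1 - (i + 1) = k - i by omega, show k + 1 - i = k - i + 1 by omega]
  · intro i hi hik S hS'
    have := h3 _ (by omega) S hS'
    rwa [show k + 1 - (k + 1 - i) = i by omega] at this
  · intro i hi hik S hS'
    rw [show k + 1 - (i + 1) = k - i by omega] at hS'
    have := h4 (k - i) (by omega) S hS'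
    rwa [show k - (k - i) = i by omega, show k - i + 1 = k + 1 - i by omega] at this
  · intro i hi hik S hS'
    exact h5 _ (by omega) S hS'

end Stage

/-! ### The sequence of components of one label pair -/

namespace UnrootedLCL

variable {L : Type*} {P : UnrootedLCL L}

lemma restrict_subset (W : Set (Sym L P.Δ)) (D : Set (Sym2 L)) : P.restrict W D ⊆ W :=
  fun _ h => h.1

lemma trim_subset (W : Set (Sym L P.Δ)) : P.trim W ⊆ W :=
  fun _ h => h.1

variable (P) in
/-- The sequence of configurations and pairs in which the component of `p` is always chosen. -/
def componentSeq (p : L × L) : ℕ → Set (Sym L P.Δ) × Set (Sym2 L)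
  | 0 => (P.nodeConstraints, Set.univ)
  | i + 1 =>
    (P.trim (P.restrict (componentSeq p i).1 (componentSeq p i).2),
      P.sccPairs (P.trim (P.restrict (componentSeq p i).1 (componentSeq p i).2)) p)

lemma componentSeq_subset (p : L × L) (i : ℕ) :
    (P.componentSeq p i).1 ⊆ P.nodeConstraints := by
  induction i with
  | zero => exact subset_rfl
  | succ i ih => exact (trim_subset _).trans ((restrict_subset _ _).trans ih)

lemma isGoodSequence_componentSeq {p : L × L} {k : ℕ} (hk : 1 ≤ k)
    (hD : ∀ i, 1 ≤ i → i < k → P.sccPairs (P.componentSeq p i).1 p ∈ P.flexSCC (P.componentSeq p i).1)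
    (hW : ∀ i, 1 ≤ i → i ≤ k → (P.componentSeq p i).1.Nonempty) :
    P.IsGoodSequence k (fun i => (P.componentSeq p i).1) (fun i => (P.componentSeq p i).2) := by
  refine ⟨hk, rfl, rfl, fun i _ => rfl, fun i h1 h2 => ?_, hW⟩
  obtain ⟨j, rfl⟩ := Nat.exists_eq_add_of_le' h1
  exact hD _ h1 h2

lemma le_depth {k : ℕ} {W : ℕ → Set (Sym L P.Δ)} {D : ℕ → Set (Sym2 L)}
    (h : P.IsGoodSequence k W D) : (k : ℕ∞) ≤ P.depth :=
  le_iSup₂_of_le k ⟨W, D, h⟩ le_rfl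

end UnrootedLCL

/-! ### From a correct algorithm to a good sequence -/

namespace Stage

variable {n : ℕ} {b : Board n} {k R γ : ℕ} {S₀ S : Stage n} {L : Type*}
  {P : UnrootedLCL L} {A : RandOnlineLocalAlg L} {F : ℕ → Finset (Stage n)} {ω : ℕ → Bool} {i : ℕ}

/-- The labeling computed at a stage. -/
noncomputable abbrev label (A : RandOnlineLocalAlg L) (ω : ℕ → Bool) (S : Stage n) :
    Fin n → Fin n → L :=
  A.run S.graph S.order ω

lemma IsFamily.subset_one {Δ ρ T : ℕ} (hF : IsFamily b Δ k R ρ T S₀ F) (h1 : 1 ≤ i)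
    (h2 : i ≤ k + 1) : F i ⊆ F 1 := by
  induction i with
  | zero => omega
  | succ i ih =>
    rcases Nat.eq_zero_or_pos i with rfl | h
    · exact subset_rfl
    · exact (hF.subset i h (by omega)).trans (ih h (by omega))

lemma IsFamily.root_mem {Δ ρ T : ℕ} (hF : IsFamily b Δ k R ρ T S₀ F) (h1 : 1 ≤ i)
    (h2 : i ≤ k + 1) : S₀ ∈ F i := by
  have : ∀ j, j ≤ k → S₀ ∈ F (k + 1 - j) := by
    intro j
    induction j with
    | zero => exact fun _ => hF.root
    | succ j ih =>
      intro hj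
      have := ih (by omega)
      rw [show k + 1 - j = k + 1 - (j + 1) + 1 by omega] at this
      exact hF.subset _ (by omega) (by omega) this
  have := this (k + 1 - i) (by omega)
  rwa [show k + 1 - (k + 1 - i) = i by omega] at this

/-- If the configurations along the trunks of all extensions belong to `W`, then the label pairs
near the trunk are connected with the label pair at the next core. -/
lemma IsFamily.exists_walks (hF : IsFamily b P.Δ k R ((k + 1) * γ) (A.locality n) S₀ F)
    (hsol : ∀ S ∈ F 1, P.IsSolution S.graph (S.label A ω)) (hi : 1 ≤ i) (hik : i ≤ k)
    {W : Set (Sym L P.Δ)}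
    (hW : ∀ S ∈ F i, ∀ v ∈ S.trunk, P.HasConfig S.graph (S.label A ω) W v) (hS : S ∈ F (i + 1))
    {x e e' f f' : Fin n} (hx : x ∈ S.graph.ballOf (S.trunk : Set (Fin n)) ((k + 1) * γ))
    (he : S.graph.Adj x e) (he' : S.graph.Adj x e') (hee : e ≠ e')
    (hf : S.graph.Adj (b.core (S.used + 1)) f) (hf' : S.graph.Adj (b.core (S.used + 1)) f')
    (hff : f ≠ f') (hfl : i * R ≤ S.level f) :
    ∃ m, 0 < m ∧ ∀ β ≤ 1, P.WalkIn W Set.univ (m + β) (S.label A ω x e', S.label A ω x e)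
      (S.label A ω (b.core (S.used + 1)) f, S.label A ω (b.core (S.used + 1)) f') := by
  obtain ⟨m, hm, h⟩ := hF.extend i hi hik S hS x e f hx he hf hfl
  refine ⟨m, hm, fun β hβ => ?_⟩
  obtain ⟨S', hS', hc, w, rfl, rfl, hwf, hwc, hnb, hwt⟩ := h β hβ
  have g := hF.good (i + 1) (by omega) (by omega) S hS
  have hxR : w 0 ∈ S.revealed b k ((k + 1) * γ) := Or.inl hx
  have hcR : b.core (S.used + 1) ∈ S.revealed b k ((k + 1) * γ) :=
    Or.inr ⟨_, by omega, g.used_lt hi, rfl⟩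
  have hxe := (hc.agree _ (SimpleGraph.subset_ballOf _ _ hxR) e').1 he'
  have hcf := (hc.agree _ (SimpleGraph.subset_ballOf _ _ hcR) f').1 hf'
  have run1 := hc.run_eq A g.revealed ω hxR
  have run2 := hc.run_eq A g.revealed ω hcR
  rw [← hwc] at hcf
  have := UnrootedLCL.walkIn_of_path (W := W)
    (hsol S' (hF.subset_one hi (by omega) hS')).2 (by omega : 0 < m + β) hnb
    (fun s hs => hW S' hS' _ (hwt s hs)) hxe hee.symm hcf (by rw [hwf]; exact hff.symm)
  rw [hwf, hwc] at this
  simp only [label] at this ⊢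
  rwa [run1, run2] at this

/-- Induction over the levels. On F (i + 1) the configurations near the trunks lie in the restricted
set, hence γ further inside in its `trim`, which is the next set W. The trunks of F (i + 1) contain
all joining paths that start from a stage of F (i + 2). So in the automaton of W the pair `p` at the
core 0 and every pair near the trunk of such a stage are linked to the pair at the next core. Thus
the component of `p` is flexible and contains all these pairs, which is the next restriction. -/
theorem IsFamily.hasConfig [Finite L] (hF : IsFamily b P.Δ k R ((k + 1) * γ) (A.locality n) S₀ F)
    (hsol : ∀ S ∈ F 1, P.IsSolution S.graph (S.label A ω)) (hΔ : 2 ≤ P.Δ)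
    (hR : (k + 1) * γ + 1 ≤ R)
    (hγ : ∀ (W : Set (Sym L P.Δ)) (C : Sym L P.Δ),
      C ∈ W → (∀ i, 1 ≤ i → i ≤ γ → P.HasTree W C i) → C ∈ P.trim W) {e₁ e₂ : Fin n}
    (h₁ : S₀.graph.Adj (b.core 0) e₁) (h₂ : S₀.graph.Adj (b.core 0) e₂) (hne : e₁ ≠ e₂) {p : L × L}
    (hp : p = (S₀.label A ω (b.core 0) e₁, S₀.label A ω (b.core 0) e₂)) (i : ℕ) (hi : i ≤ k) :
    (1 ≤ i → P.sccPairs (P.componentSeq p i).1 p ∈ P.flexSCC (P.componentSeq p i).1) ∧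
    ∀ S ∈ F (i + 1), ∀ x ∈ S.graph.ballOf (S.trunk : Set (Fin n)) ((k + 1 - i) * γ),
      P.HasConfig S.graph (S.label A ω)
        (P.restrict (P.componentSeq p i).1 (P.componentSeq p i).2) x := by
  induction i with
  | zero =>
    refine ⟨fun h => absurd h (by omega), fun S hS x hx => ?_⟩
    have g := hF.good 1 le_rfl (by omega) S hS
    have hbad : ∀ v ∈ S.graph.ballOf (S.trunk : Set (Fin n)) ((k + 1) * γ), v ∉ S.bad :=
      fun v hv => g.ball v (SimpleGraph.ballOf_mono le_rfl (by omega) hv)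
    have h1 := LevelAt.mono_ball g.loc (r := (k + 1) * γ) g.level hbad x
    have h2 : x ∈ S.graph.ballOf (S.trunk : Set (Fin n)) ((k + 1) * γ) := hx
    -- The radius is less than `R`, so the level stays positive and the degree is Δ. Radius 0 is
    -- separate because `LevelAt.mono_ball` speaks of a successor.
    have h3 : 1 ≤ S.level x := by
      rcases Nat.eq_zero_or_pos ((k + 1) * γ) with h0 | h0
      · rw [h0, SimpleGraph.ballOf_zero] at h2
        have := g.level x h2
        omega
      · have := LevelAt.mono_ball g.loc (r := (k + 1) * γ - 1) g.level
          (fun v hv => hbad v (SimpleGraph.ballOf_mono le_rfl (Nat.sub_le _ _) hv)) x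
        rw [Nat.sub_add_cancel h0] at this
        have := this h2
        omega
    obtain ⟨C, hC, hCx⟩ := (hsol S hS).1 x ((g.loc x (hbad x h2)).degree h3)
    exact ⟨C, ⟨hC, fun _ _ _ => trivial⟩, hCx⟩
  | succ i ih =>
    obtain ⟨-, ih⟩ := ih (by omega)
    set W := (P.componentSeq p (i + 1)).1 with hWdef
    have hsub : W ⊆ P.nodeConstraints := UnrootedLCL.componentSeq_subset p (i + 1)
    have hball : ∀ S ∈ F (i + 1), ∀ x ∈ S.graph.ballOf (S.trunk : Set (Fin n))
        ((k + 1 - (i + 1)) * γ), P.HasConfig S.graph (S.label A ω) W x := by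
      intro S hS x hx
      have g := hF.good (i + 1) (by omega) (by omega) S hS
      refine UnrootedLCL.hasConfig_trim_of_ball hγ hΔ g.tree.1
        (hsol S (hF.subset_one (by omega) (by omega) hS)).2
        ((UnrootedLCL.restrict_subset _ _).trans (UnrootedLCL.componentSeq_subset p i))
        fun v hv => ih S hS v ?_
      have e : (k + 1 - i) * γ = (k + 1 - (i + 1)) * γ + γ := by
        rw [← Nat.succ_mul]
        congr 1
        omega
      rw [e]
      refine SimpleGraph.ballOf_ballOf _ _ _ (SimpleGraph.ballOf_mono ?_ le_rfl hv)
      exact Set.singleton_subset_iff.2 hx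
    have htrunk : ∀ S ∈ F (i + 1), ∀ v ∈ S.trunk, P.HasConfig S.graph (S.label A ω) W v :=
      fun S hS v hv => hball S hS v (SimpleGraph.subset_ballOf _ _ hv)
    have hcore : ∀ S ∈ F (i + 1 + 1), ∃ f f', f ≠ f' ∧ S.graph.Adj (b.core (S.used + 1)) f ∧
        S.graph.Adj (b.core (S.used + 1)) f' ∧ (i + 1) * R ≤ S.level f ∧
        (i + 1) * R ≤ S.level f' := by
      intro S hS
      have g := hF.good (i + 1 + 1) (by omega) (by omega) S hS
      have fr := g.fresh (S.used + 1) (by omega) (g.used_lt (by omega))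
      exact (g.loc _ (fr.ball _ (SimpleGraph.subset_ballOf _ _ rfl))).two (i + 1) (by omega) hi
        fr.level
    have hwalk : ∀ S ∈ F (i + 1 + 1), ∀ f f', f ≠ f' → S.graph.Adj (b.core (S.used + 1)) f →
        S.graph.Adj (b.core (S.used + 1)) f' → (i + 1) * R ≤ S.level f → ∀ x e e',
        x ∈ S.graph.ballOf (S.trunk : Set (Fin n)) ((k + 1) * γ) → S.graph.Adj x e →
        S.graph.Adj x e' → e ≠ e' → ∃ m, 0 < m ∧ ∀ β ≤ 1,
        P.WalkIn W Set.univ (m + β) (S.label A ω x e', S.label A ω x e)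
          (S.label A ω (b.core (S.used + 1)) f, S.label A ω (b.core (S.used + 1)) f') :=
      fun S hS f f' hff hf hf' hfl x e e' hx he he' hee =>
        hF.exists_walks hsol (by omega) hi htrunk hS hx he he' hee hf hf' hff hfl
    -- The core 0 is revealed in the root stage, so the same pair is read there in every stage.
    have hp' : ∀ S ∈ F (i + 1 + 1), S.graph.Adj (b.core 0) e₁ ∧ S.graph.Adj (b.core 0) e₂ ∧
        p = (S.label A ω (b.core 0) e₁, S.label A ω (b.core 0) e₂) := by
      intro S hS
      have hc := hF.continues (i + 1 + 1) (by omega) (by omega) S hS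
      have g := hF.good (k + 1) (by omega) le_rfl S₀ hF.root
      have h0 : b.core 0 ∈ S₀.revealed b k ((k + 1) * γ) :=
        Or.inl (SimpleGraph.subset_ballOf _ _ g.core_zero)
      have hrun := hc.run_eq A g.revealed ω h0
      refine ⟨(hc.agree _ (SimpleGraph.subset_ballOf _ _ h0) _).1 h₁,
        (hc.agree _ (SimpleGraph.subset_ballOf _ _ h0) _).1 h₂, ?_⟩
      simp only [label, hrun, hp]
    refine ⟨fun _ => ?_, fun S hS x hx => ?_⟩
    · have hr := hF.root_mem (i := i + 1 + 1) (by omega) (by omega)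
      obtain ⟨a1, a2, a3⟩ := hp' S₀ hr
      have g := hF.good (k + 1) (by omega) le_rfl S₀ hF.root
      have h0 : b.core 0 ∈ S₀.graph.ballOf (S₀.trunk : Set (Fin n)) ((k + 1) * γ) :=
        SimpleGraph.subset_ballOf _ _ g.core_zero
      obtain ⟨f, f', hff, hf, hf', hfl, hfl'⟩ := hcore S₀ hr
      -- With q the pair at the next core, these are walks p → q, p → q.swap, p.swap → q and p.swap
      -- → q.swap.
      obtain ⟨m1, hm1, w1⟩ := hwalk S₀ hr f f' hff hf hf' hfl _ e₂ e₁ h0 a2 a1 hne.symm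
      obtain ⟨m2, hm2, w2⟩ := hwalk S₀ hr f' f hff.symm hf' hf hfl' _ e₂ e₁ h0 a2 a1 hne.symm
      obtain ⟨m3, hm3, w3⟩ := hwalk S₀ hr f f' hff hf hf' hfl _ e₁ e₂ h0 a1 a2 hne
      obtain ⟨m4, hm4, w4⟩ := hwalk S₀ hr f' f hff.symm hf' hf hfl' _ e₁ e₂ h0 a1 a2 hne
      rw [a3]
      refine UnrootedLCL.sccPairs_mem_flexSCC hsub ?_ ⟨m1, hm1, w1 0 (by omega), w1 1 le_rfl⟩
        (w2 0 (by omega)).reflTransGen (w3 0 (by omega)).reflTransGen ⟨_, w4 0 (by omega)⟩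
      exact (htrunk S₀ (hF.subset _ (by omega) hi hr) _ g.core_zero).mem_autNodes hne a1 a2
    · have hS1 := hF.subset _ (by omega) hi hS
      obtain ⟨C, hC, hCx⟩ := hball S hS1 x hx
      refine ⟨C, ⟨hC, fun α β h => ?_⟩, hCx⟩
      rw [hCx, pair_le_nodeConfig] at h
      obtain ⟨e', e, hee, he', he, rfl, rfl⟩ := h
      have hx' : x ∈ S.graph.ballOf (S.trunk : Set (Fin n)) ((k + 1) * γ) :=
        SimpleGraph.ballOf_mono le_rfl (Nat.mul_le_mul_right _ (Nat.sub_le _ _)) hx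
      obtain ⟨a1, a2, a3⟩ := hp' S hS
      have g := hF.good (i + 1 + 1) (by omega) (by omega) S hS
      have h0 : b.core 0 ∈ S.graph.ballOf (S.trunk : Set (Fin n)) ((k + 1) * γ) :=
        SimpleGraph.subset_ballOf _ _ g.core_zero
      obtain ⟨f, f', hff, hf, hf', hfl, hfl'⟩ := hcore S hS
      obtain ⟨m1, hm1, w1⟩ := hwalk S hS f f' hff hf hf' hfl _ e₂ e₁ h0 a2 a1 hne.symm
      obtain ⟨m2, hm2, w2⟩ := hwalk S hS f' f hff.symm hf' hf hfl' _ e₁ e₂ h0 a1 a2 hne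
      obtain ⟨m3, hm3, w3⟩ := hwalk S hS f f' hff hf hf' hfl _ e e' hx' he he' hee.symm
      obtain ⟨m4, hm4, w4⟩ := hwalk S hS f' f hff.symm hf' hf hfl' _ e' e hx' he' he hee
      have hr : (S.label A ω x e', S.label A ω x e) ∈ P.autNodes W :=
        (hball S hS1 x hx).mem_autNodes hee he' he
      have r1 := (w1 0 (by omega)).reflTransGen
      have r2 := (w2 0 (by omega)).reflTransGen
      have r3 := (w3 0 (by omega)).reflTransGen
      have r4 := (w4 0 (by omega)).reflTransGen
      rw [← a3] at r1
      have a3' : p.swap = (S.label A ω (b.core 0) e₂, S.label A ω (b.core 0) e₁) := by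
        rw [a3, Prod.swap_prod_mk]
      rw [← a3'] at r2
      exact UnrootedLCL.mem_sccPairs hr r1 r2 r3 r4

/-- If an algorithm solves the problem on all stages of a family, for one value of the random
bits, then there is a longer good sequence. -/
theorem IsFamily.le_depth [Finite L]
    (hF : IsFamily b P.Δ k R ((k + 1) * γ) (A.locality n) S₀ F)
    (hsol : ∀ S ∈ F 1, P.IsSolution S.graph (S.label A ω)) (hk : 1 ≤ k) (hΔ : 2 ≤ P.Δ)
    (hR : (k + 1) * γ + 1 ≤ R)
    (hγ : ∀ (W : Set (Sym L P.Δ)) (C : Sym L P.Δ),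
      C ∈ W → (∀ i, 1 ≤ i → i ≤ γ → P.HasTree W C i) → C ∈ P.trim W) :
    ((k + 1 : ℕ) : ℕ∞) ≤ P.depth := by
  have g := hF.good (k + 1) (by omega) le_rfl S₀ hF.root
  have hlev : 1 * R ≤ S₀.level (b.core 0) :=
    (Nat.mul_le_mul_right R (by omega)).trans (g.level _ g.core_zero)
  obtain ⟨e₁, e₂, hne, h₁, h₂, -⟩ :=
    (g.loc _ (g.ball _ (SimpleGraph.subset_ballOf _ _ g.core_zero))).two 1 le_rfl hk hlev
  have key := hF.hasConfig hsol hΔ hR hγ h₁ h₂ hne rfl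
  refine UnrootedLCL.le_depth (UnrootedLCL.isGoodSequence_componentSeq (by omega)
    (fun i h1 h2 => (key i (by omega)).1 h1) fun i h1 h2 => ?_)
  obtain ⟨j, rfl⟩ := Nat.exists_eq_add_of_le' h1
  -- The root stage belongs to every family, so the configuration at the core 0 is a common witness
  -- of non-emptiness.
  have hS₀ := hF.root_mem (i := j + 1) (by omega) h2
  obtain ⟨C, hC, -⟩ := UnrootedLCL.hasConfig_trim_of_ball hγ hΔ g.tree.1
    (hsol S₀ (hF.root_mem le_rfl (by omega))).2
    ((UnrootedLCL.restrict_subset _ _).trans (UnrootedLCL.componentSeq_subset _ j))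
    (x := b.core 0) fun v hv => (key j (by omega)).2 S₀ hS₀ v
      (SimpleGraph.ballOf_mono (Set.singleton_subset_iff.2 g.core_zero)
        (Nat.le_mul_of_pos_left _ (by omega)) hv)
  exact ⟨C, hC⟩

end Stage

/-- The union bound: an algorithm that solves the problem with high probability solves fewer than
`n` given instances with the same random bits. -/
theorem RandOnlineLocalAlg.exists_bits {L : Type*} {P : UnrootedLCL L} {A : RandOnlineLocalAlg L}
    {n : ℕ} (hA : ∀ G : SimpleGraph (Fin n), IsRegularTree P.Δ G → ∀ σ : Equiv.Perm (Fin n),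
      randomBits.real {ω | ¬ P.IsSolution G (A.run G σ ω)} ≤ 1 / (n : ℝ))
    {ι : Type*} (F : Finset ι) (G : ι → SimpleGraph (Fin n)) (σ : ι → Equiv.Perm (Fin n))
    (hG : ∀ j ∈ F, IsRegularTree P.Δ (G j)) (hF : F.card < n) :
    ∃ ω, ∀ j ∈ F, P.IsSolution (G j) (A.run (G j) (σ j) ω) := by
  have : IsProbabilityMeasure randomBits := by
    unfold randomBits
    infer_instance
  by_contra! hcon
  have hn : (0 : ℝ) < n := by
    have : 0 < n := by omega
    exact_mod_cast this
  have hcover : (Set.univ : Set (ℕ → Bool)) ⊆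
      ⋃ j ∈ F, {ω | ¬ P.IsSolution (G j) (A.run (G j) (σ j) ω)} := by
    intro ω _
    obtain ⟨j, hj, h⟩ := hcon ω
    exact Set.mem_iUnion₂.2 ⟨j, hj, h⟩
  have h1 : (1 : ℝ) ≤ F.card * (1 / n) := by
    calc (1 : ℝ) = randomBits.real Set.univ := (probReal_univ).symm
      _ ≤ randomBits.real (⋃ j ∈ F, {ω | ¬ P.IsSolution (G j) (A.run (G j) (σ j) ω)}) :=
        measureReal_mono hcover (measure_ne_top _ _)
      _ ≤ ∑ j ∈ F, randomBits.real {ω | ¬ P.IsSolution (G j) (A.run (G j) (σ j) ω)} :=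
        measureReal_biUnion_finset_le _ _
      _ ≤ ∑ _j ∈ F, 1 / (n : ℝ) := Finset.sum_le_sum fun j hj => hA _ (hG j hj) _
      _ = F.card * (1 / n) := by rw [Finset.sum_const, nsmul_eq_mul]
  have h2 : (F.card : ℝ) < n := by exact_mod_cast hF
  rw [mul_one_div, le_div_iff₀ hn] at h1
  linarith

/-! ### Trees of words -/

/-- A prefix-closed set of words that contains with a word all its siblings; the last letter is
the head. -/
structure IsFullTree {d : ℕ} (T : Finset (List (Fin d))) : Prop where
  nil_mem : [] ∈ T
  tail_mem : ∀ i w, i :: w ∈ T → w ∈ T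
  sibling_mem : ∀ i w, i :: w ∈ T → ∀ j, j :: w ∈ T

/-- Leaves are expanded one at a time, of positive weight as long as there are any. Each such
expansion lowers the total weight of the leaves, so after `m` expansions it is 0. Surplus expansions
go to arbitrary leaves, which makes the size exact. -/
lemma exists_isFullTree {d : ℕ} (hd : 0 < d) (wt : List (Fin d) → ℕ)
    (hwt : ∀ w, ∑ i, wt (i :: w) ≤ wt w - 1) {m : ℕ} (hm : wt [] ≤ m) :
    ∃ T : Finset (List (Fin d)), IsFullTree T ∧ T.card = 1 + m * d ∧
      ∀ w ∈ T, 1 ≤ wt w → ∀ i, i :: w ∈ T := by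
  classical
  let leaves : Finset (List (Fin d)) → Finset (List (Fin d)) := fun T =>
    T.filter fun w => ∀ i, i :: w ∉ T
  have key : ∀ m, ∃ T : Finset (List (Fin d)), IsFullTree T ∧ T.card = 1 + m * d ∧
      ∑ w ∈ leaves T, wt w ≤ wt [] - m := by
    intro m
    induction m with
    | zero =>
      refine ⟨{[]}, ⟨by simp, by simp, by simp⟩, by simp, ?_⟩
      refine (Finset.sum_le_sum_of_subset (Finset.filter_subset _ _)).trans ?_
      simp
    | succ m ih =>
      obtain ⟨T, hT, hc, hs⟩ := ih
      -- a leaf, of positive weight if possible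
      obtain ⟨w, hw, hw1⟩ : ∃ w ∈ leaves T, (∀ u ∈ leaves T, wt w = 0 → wt u = 0) := by
        by_cases h : ∃ w ∈ leaves T, wt w ≠ 0
        · obtain ⟨w, hw, h0⟩ := h
          exact ⟨w, hw, fun _ _ h => absurd h h0⟩
        · push Not at h
          -- Any leaf will do now; a longest word is one.
          obtain ⟨w, hw, hmax⟩ := T.exists_max_image List.length ⟨[], hT.nil_mem⟩
          refine ⟨w, Finset.mem_filter.2 ⟨hw, fun i hi => ?_⟩, fun u hu _ => h u hu⟩
          have := hmax _ hi
          simp at this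
      obtain ⟨hwT, hleaf⟩ := Finset.mem_filter.1 hw
      let N : Finset (List (Fin d)) := Finset.univ.image fun i : Fin d => i :: w
      have hN : ∀ u, u ∈ N ↔ ∃ i, i :: w = u := by simp [N]
      have hdisj : Disjoint T N := by
        rw [Finset.disjoint_left]
        rintro u hu hu'
        obtain ⟨i, rfl⟩ := (hN u).1 hu'
        exact hleaf i hu
      have hNc : N.card = d := by
        rw [Finset.card_image_of_injective _ (fun i j h => (List.cons.inj h).1), Finset.card_univ,
          Fintype.card_fin]
      refine ⟨T ∪ N, ⟨Finset.mem_union_left _ hT.nil_mem, ?_, ?_⟩, ?_, ?_⟩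
      · intro i u hu
        rcases Finset.mem_union.1 hu with h | h
        · exact Finset.mem_union_left _ (hT.tail_mem i u h)
        · obtain ⟨j, hj⟩ := (hN _).1 h
          rw [← (List.cons.inj hj).2]
          exact Finset.mem_union_left _ hwT
      · intro i u hu j
        rcases Finset.mem_union.1 hu with h | h
        · exact Finset.mem_union_left _ (hT.sibling_mem i u h j)
        · obtain ⟨i', hi'⟩ := (hN _).1 h
          rw [← (List.cons.inj hi').2]
          exact Finset.mem_union_right _ ((hN _).2 ⟨j, rfl⟩)
      · rw [Finset.card_union_of_disjoint hdisj, hc, hNc]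
        ring
      · have hsub : leaves (T ∪ N) ⊆ (leaves T).erase w ∪ N := by
          intro u hu
          obtain ⟨h1, h2⟩ := Finset.mem_filter.1 hu
          rcases Finset.mem_union.1 h1 with h | h
          · refine Finset.mem_union_left _ (Finset.mem_erase.2 ⟨?_, Finset.mem_filter.2 ⟨h, fun i hi =>
              h2 i (Finset.mem_union_left _ hi)⟩⟩)
            rintro rfl
            exact h2 ⟨0, hd⟩ (Finset.mem_union_right _ ((hN _).2 ⟨_, rfl⟩))
          · exact Finset.mem_union_right _ h
        have h1 : ∑ u ∈ N, wt u ≤ wt w - 1 := by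
          rw [Finset.sum_image (fun i _ j _ h => (List.cons.inj h).1)]
          exact hwt w
        have h2 := Finset.sum_erase_add (leaves T) wt hw
        have h3 : ∑ u ∈ leaves (T ∪ N), wt u ≤ ∑ u ∈ (leaves T).erase w, wt u + ∑ u ∈ N, wt u :=
          (Finset.sum_le_sum_of_subset hsub).trans (by
            have := Finset.sum_union_inter (s₁ := (leaves T).erase w) (s₂ := N) (f := wt)
            omega)
        rcases Nat.eq_zero_or_pos (wt w) with h0 | h0
        · have h4 : ∑ u ∈ leaves T, wt u = 0 := Finset.sum_eq_zero fun u hu => hw1 u hu h0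
          omega
        · omega
  obtain ⟨T, hT, hc, hs⟩ := key m
  refine ⟨T, hT, hc, fun w hw h1 i => ?_⟩
  by_contra hi
  have hl : w ∈ leaves T := Finset.mem_filter.2 ⟨hw, fun j hj => hi (hT.sibling_mem j w hj i)⟩
  have := Finset.single_le_sum (f := wt) (fun _ _ => Nat.zero_le _) hl
  omega

/-- The vertex below a word; `none` is an additional vertex below the empty word. -/
def wordParent {d : ℕ} : List (Fin d) → Option (List (Fin d))
  | [] => none
  | _ :: w => some w

/-- Adjacency in the tree of words. -/
def WordAdj {d : ℕ} (a b : Option (List (Fin d))) : Prop :=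
  (∃ w, a = some w ∧ b = wordParent w) ∨ ∃ w, b = some w ∧ a = wordParent w

lemma wordParent_ne {d : ℕ} (w : List (Fin d)) : wordParent w ≠ some w := by
  cases w with
  | nil => simp [wordParent]
  | cons i w =>
    intro h
    have := congrArg List.length (Option.some.inj h)
    simp at this

lemma WordAdj.symm {d : ℕ} {a b : Option (List (Fin d))} (h : WordAdj a b) : WordAdj b a :=
  h.elim Or.inr Or.inl

lemma wordAdj_none {d : ℕ} {b : Option (List (Fin d))} : WordAdj none b ↔ b = some [] := by
  constructor
  · rintro (⟨w, h, -⟩ | ⟨w, rfl, h⟩)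
    · cases h
    · cases w with
      | nil => rfl
      | cons i w => cases h
  · rintro rfl
    exact Or.inr ⟨[], rfl, rfl⟩

lemma wordAdj_some {d : ℕ} {w : List (Fin d)} {b : Option (List (Fin d))} :
    WordAdj (some w) b ↔ b = wordParent w ∨ ∃ i, b = some (i :: w) := by
  constructor
  · rintro (⟨w', h, rfl⟩ | ⟨w', rfl, h⟩)
    · rw [Option.some.inj h]
      exact Or.inl rfl
    · cases w' with
      | nil => cases h
      | cons i w' =>
        rw [Option.some.inj h]
        exact Or.inr ⟨i, rfl⟩
  · rintro (rfl | ⟨i, rfl⟩)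
    · exact Or.inl ⟨w, rfl, rfl⟩
    · exact Or.inr ⟨i :: w, rfl, rfl⟩

/-- `G` is a finite tree of words; all words of positive weight are inner vertices. -/
structure IsWordTree {n d : ℕ} (wt : List (Fin d) → ℕ) (G : SimpleGraph (Fin n))
    (φ : Fin n → Option (List (Fin d))) : Prop where
  injective : Function.Injective φ
  adj_iff : ∀ x y, G.Adj x y ↔ WordAdj (φ x) (φ y)
  nil : ∃ x, φ x = some []
  parent : ∀ x w, φ x = some w → ∃ y, φ y = wordParent w
  child : ∀ x w, φ x = some w → 1 ≤ wt w → ∀ i, ∃ y, φ y = some (i :: w)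
  degree : ∀ x w, φ x = some w → 1 ≤ wt w → (nbrs G x).card = d + 1

/-- The vertex `none` serves as parent of the empty word, so that every expanded word has degree d +
1. The edges join each other vertex to its parent, hence there are at most n - 1 of them. -/
theorem exists_isWordTree {d : ℕ} (hd : 0 < d) (wt : List (Fin d) → ℕ)
    (hwt : ∀ w, ∑ i, wt (i :: w) ≤ wt w - 1) {m n : ℕ} (hm : wt [] ≤ m) (hn : n = 2 + m * d) :
    ∃ (G : SimpleGraph (Fin n)) (φ : Fin n → Option (List (Fin d))),
      IsRegularTree (d + 1) G ∧ IsWordTree wt G φ := by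
  classical
  obtain ⟨T, hT, hc, hin⟩ := exists_isFullTree hd wt hwt hm
  have hcard : Fintype.card {a // a ∈ Finset.insertNone T} = n := by
    rw [Fintype.card_coe, Finset.card_insertNone, hc, hn]
    ring
  let ε : Fin n ≃ {a // a ∈ Finset.insertNone T} := (Fintype.equivFinOfCardEq hcard).symm
  let φ : Fin n → Option (List (Fin d)) := fun x => (ε x).1
  have hinj : Function.Injective φ := Subtype.val_injective.comp ε.injective
  have hran : ∀ a, (∃ x, φ x = a) ↔ ∀ w, a = some w → w ∈ T := by
    intro a
    constructor
    · rintro ⟨x, rfl⟩ w hw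
      exact Finset.mem_insertNone.1 (ε x).2 w hw
    · intro h
      exact ⟨ε.symm ⟨a, Finset.mem_insertNone.2 h⟩, by simp [φ]⟩
  have hmem : ∀ x w, φ x = some w → w ∈ T := fun x w h => (hran _).1 ⟨x, rfl⟩ w h
  let G : SimpleGraph (Fin n) :=
    { Adj := fun x y => WordAdj (φ x) (φ y)
      symm := ⟨fun x y h => h.symm⟩
      loopless := ⟨fun x h => by
        rcases h with ⟨w, h1, h2⟩ | ⟨w, h1, h2⟩
        · exact wordParent_ne w (h2.symm.trans h1)
        · exact wordParent_ne w (h2.symm.trans h1)⟩ }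
  have hadj : ∀ x y, G.Adj x y ↔ WordAdj (φ x) (φ y) := fun x y => Iff.rfl
  obtain ⟨x₀, hx₀⟩ : ∃ x, φ x = none := (hran none).2 (by simp)
  have hpar : ∀ x w, φ x = some w → ∃ y, φ y = wordParent w := by
    intro x w hx
    have := hmem x w hx
    cases w with
    | nil => exact ⟨x₀, hx₀⟩
    | cons i w =>
      refine (hran _).2 fun w' hw' => ?_
      rw [← Option.some.inj hw']
      exact hT.tail_mem i w this
  have hchild : ∀ x w, φ x = some w → 1 ≤ wt w → ∀ i, ∃ y, φ y = some (i :: w) := by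
    intro x w hx h i
    refine (hran _).2 fun w' hw' => ?_
    rw [← Option.some.inj hw']
    exact hin w (hmem x w hx) h i
  have hdeg : ∀ x w, φ x = some w → (∀ i, i :: w ∈ T) → (nbrs G x).card = d + 1 := by
    intro x w hx h
    have : (nbrs G x).image φ = insert (wordParent w) (Finset.univ.image fun i => some (i :: w)) := by
      ext a
      simp only [Finset.mem_image, mem_nbrs, hadj, hx, wordAdj_some, Finset.mem_insert,
        Finset.mem_univ, true_and]
      constructor
      · rintro ⟨y, h | ⟨i, h⟩, rfl⟩
        · exact Or.inl h
        · exact Or.inr ⟨i, h.symm⟩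
      · rintro (rfl | ⟨i, rfl⟩)
        · obtain ⟨y, hy⟩ := hpar x w hx
          exact ⟨y, Or.inl hy, hy⟩
        · obtain ⟨y, hy⟩ := (hran (some (i :: w))).2 (by rintro w' h'; rw [← Option.some.inj h']; exact h i)
          exact ⟨y, Or.inr ⟨i, hy⟩, hy⟩
    rw [← Finset.card_image_of_injective _ hinj, this, Finset.card_insert_of_notMem,
      Finset.card_image_of_injective, Finset.card_univ, Fintype.card_fin]
    · exact fun i j h => (List.cons.inj (Option.some.inj h)).1
    · simp only [Finset.mem_image, Finset.mem_univ, true_and, not_exists]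
      intro i hi
      cases w with
      | nil => cases hi
      | cons j w =>
        have := congrArg List.length (Option.some.inj hi)
        simp only [List.length_cons] at this
        omega
  have hleaf : ∀ x w, φ x = some w → (¬ ∀ i, i :: w ∈ T) → (nbrs G x).card = 1 := by
    intro x w hx h
    obtain ⟨y, hy⟩ := hpar x w hx
    rw [Finset.card_eq_one]
    refine ⟨y, ?_⟩
    ext z
    rw [mem_nbrs, hadj, hx, wordAdj_some, Finset.mem_singleton]
    constructor
    · rintro (hz | ⟨i, hz⟩)
      · exact hinj (hz.trans hy.symm)
      · exact absurd (fun j => hT.sibling_mem i w (hmem z _ hz) j) h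
    · rintro rfl
      exact Or.inl hy
  have hreach : ∀ w x, φ x = some w → G.Reachable x x₀ := by
    intro w
    induction w with
    | nil =>
      intro x hx
      exact SimpleGraph.Adj.reachable ((hadj _ _).2 (by rw [hx, hx₀]; exact Or.inl ⟨[], rfl, rfl⟩))
    | cons i w ih =>
      intro x hx
      obtain ⟨y, hy⟩ := hpar x _ hx
      exact (SimpleGraph.Adj.reachable ((hadj x y).2 (by rw [hx, hy]; exact Or.inl ⟨_, rfl, rfl⟩))).trans
        (ih y hy)
  have hreach' : ∀ x, G.Reachable x x₀ := by
    intro x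
    cases h : φ x with
    | none => rw [hinj (h.trans hx₀.symm)]
    | some w => exact hreach w x h
  have hconn : G.Connected :=
    { preconnected := fun x y => (hreach' x).trans (hreach' y).symm
      nonempty := ⟨x₀⟩ }
  have htree : G.IsTree := by
    refine SimpleGraph.isTree_of_connected_of_card_le hconn ?_
    have hp : ∀ x, ∃ y, ∀ w, φ x = some w → φ y = wordParent w := by
      intro x
      cases h : φ x with
      | none => exact ⟨x, by simp⟩
      | some w =>
        obtain ⟨y, hy⟩ := hpar x w h
        exact ⟨y, by rintro w' h'; rwa [← Option.some.inj h']⟩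
    choose π hπ using hp
    have hsub : G.edgeSet ⊆ ((Finset.univ.erase x₀).image fun x => s(x, π x) : Finset _) := by
      intro ed hed
      induction ed with
      | _ x y =>
        rw [Finset.mem_coe, Finset.mem_image]
        rcases hed with ⟨w, h1, h2⟩ | ⟨w, h1, h2⟩
        · refine ⟨x, Finset.mem_erase.2 ⟨?_, Finset.mem_univ _⟩, ?_⟩
          · rintro rfl
            rw [hx₀] at h1
            cases h1
          · rw [hinj ((hπ x w h1).trans h2.symm)]
        · refine ⟨y, Finset.mem_erase.2 ⟨?_, Finset.mem_univ _⟩, ?_⟩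
          · rintro rfl
            rw [hx₀] at h1
            cases h1
          · rw [hinj ((hπ y w h1).trans h2.symm), Sym2.eq_swap]
    have h1 := Set.ncard_le_ncard hsub (Set.toFinite _)
    rw [Set.ncard_coe_finset] at h1
    have h2 := h1.trans Finset.card_image_le
    rw [Finset.card_erase_of_mem (Finset.mem_univ _), Finset.card_univ, Fintype.card_fin] at h2
    rw [Nat.card_coe_set_eq, Nat.card_eq_fintype_card, Fintype.card_fin]
    omega
  refine ⟨G, φ, ⟨htree, fun x => ?_⟩, hinj, hadj, (hran _).2 (by rintro w h; rw [← Option.some.inj h]; exact hT.nil_mem), hpar, hchild, fun x w hx h =>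
    hdeg x w hx (hin w (hmem x w hx) h)⟩
  cases h : φ x with
  | none =>
    left
    obtain ⟨y, hy⟩ := (hran (some [])).2 (by rintro w h; rw [← Option.some.inj h]; exact hT.nil_mem)
    rw [Finset.card_eq_one]
    refine ⟨y, ?_⟩
    ext z
    rw [mem_nbrs, hadj, h, wordAdj_none, Finset.mem_singleton]
    exact ⟨fun hz => hinj (hz.trans hy.symm), fun hz => hz ▸ hy⟩
  | some w =>
    by_cases hw : ∀ i, i :: w ∈ T
    · exact Or.inr (hdeg x w h hw)
    · exact Or.inl (hleaf x w h hw)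

/-! ### The caterpillar -/

/-- The position of a word relative to the line of the words `0 ⋯ 0`: the length of its initial
segment on the line, its level, and its height above the line. -/
structure Spot where
  pos : ℕ
  level : ℕ
  height : ℕ

open scoped Classical in
/-- The position after adding a letter, which is zero or not. -/
noncomputable def Spot.next (R : ℕ) (μ : ℕ → ℕ) (z : Prop) (s : Spot) : Spot :=
  if s.height = 0 then
    if z then ⟨s.pos + 1, μ (s.pos + 1), 0⟩ else ⟨s.pos, s.level - 1, 1⟩
  -- The letter 0 keeps a level divisible by `R`, all other steps lower it. So a vertex of level at
  -- least `j * R` has, besides its parent, a child of level at least `j * R`.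
  else ⟨s.pos, if z ∧ R ∣ s.level then s.level else s.level - 1, s.height + 1⟩

/-- The position of a word. -/
noncomputable def spot {e : ℕ} (R : ℕ) (μ : ℕ → ℕ) : List (Fin (e + 1)) → Spot
  | [] => ⟨0, μ 0, 0⟩
  | i :: w => (spot R μ w).next R μ (i = 0)

section

variable {e R M J : ℕ} {μ : ℕ → ℕ}

lemma Spot.next_cases (s : Spot) (z : Prop) :
    (s.height = 0 ∧ z ∧ s.next R μ z = ⟨s.pos + 1, μ (s.pos + 1), 0⟩) ∨
    ((s.next R μ z).pos = s.pos ∧ (s.next R μ z).height = s.height + 1 ∧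
      s.level ≤ (s.next R μ z).level + 1 ∧ (s.next R μ z).level ≤ s.level) := by
  unfold Spot.next
  split_ifs with h1 h2
  · exact Or.inl ⟨h1, h2, rfl⟩
  · exact Or.inr ⟨rfl, by simp [h1], by dsimp only; omega, Nat.sub_le _ _⟩
  · exact Or.inr ⟨rfl, rfl, Nat.le_succ _, le_rfl⟩
  · exact Or.inr ⟨rfl, rfl, by dsimp only; omega, Nat.sub_le _ _⟩

lemma spot_level {w : List (Fin (e + 1))} (h : (spot R μ w).height = 0) :
    (spot R μ w).level = μ (spot R μ w).pos := by
  cases w with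
  | nil => rfl
  | cons i w =>
    rw [spot] at h ⊢
    rcases Spot.next_cases (R := R) (μ := μ) (spot R μ w) (i = 0) with ⟨-, -, h1⟩ | ⟨-, h1, -⟩
    · rw [h1]
    · omega

lemma spot_replicate (j : ℕ) :
    spot R μ (List.replicate j (0 : Fin (e + 1))) = ⟨j, μ j, 0⟩ := by
  induction j with
  | zero => rfl
  | succ j ih => rw [List.replicate_succ, spot, ih, Spot.next, if_pos rfl, if_pos rfl]

lemma eq_replicate_of_height {w : List (Fin (e + 1))} (h : (spot R μ w).height = 0) :
    w = List.replicate (spot R μ w).pos 0 := by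
  induction w with
  | nil => rfl
  | cons i w ih =>
    rw [spot] at h ⊢
    rcases Spot.next_cases (R := R) (μ := μ) (spot R μ w) (i = 0) with ⟨h1, h2, h3⟩ | ⟨-, h1, -⟩
    · rw [h3, List.replicate_succ, ← ih h1, h2]
    · omega

/-- The number of inner vertices of a side tree of the given height and level. -/
noncomputable def sideWeight (e R : ℕ) : ℕ → ℕ → ℕ
  | 0, _ => 0
  | s + 1, v => if v = 0 then 0 else
      1 + sideWeight e R s (if R ∣ v then v else v - 1) + e * sideWeight e R s (v - 1)

/-- The number of inner vertices of the caterpillar from the position `j` on. -/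
noncomputable def lineWeight (e R M J : ℕ) (μ : ℕ → ℕ) (j : ℕ) : ℕ :=
  ∑ j' ∈ Finset.Ico j J, (1 + e * sideWeight e R M (μ j' - 1))

/-- The number of inner vertices above a word. -/
noncomputable def wordWeight (R M J : ℕ) (μ : ℕ → ℕ) (w : List (Fin (e + 1))) : ℕ :=
  if (spot R μ w).height = 0 then lineWeight e R M J μ (spot R μ w).pos
  else sideWeight e R (M + 1 - (spot R μ w).height) (spot R μ w).level

lemma sideWeight_zero (s : ℕ) : sideWeight e R s 0 = 0 := by
  cases s <;> simp [sideWeight]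

/-- The weights satisfy by definition the recursion for numbers of inner vertices. On the line from
`J` on, and in side trees above height `M`, both sides vanish. -/
lemma sum_wordWeight_le (hμ : ∀ j, J ≤ j → μ j = 0) (w : List (Fin (e + 1))) :
    ∑ i, wordWeight R M J μ (i :: w) ≤ wordWeight R M J μ w - 1 := by
  rw [Fin.sum_univ_succ]
  have hz : ∀ i : Fin e, (i.succ = 0) = False := fun i => eq_false (Fin.succ_ne_zero i)
  simp only [wordWeight, spot, hz]
  have hl := spot_level (R := R) (μ := μ) (w := w)
  generalize spot R μ w = s at hl
  rw [Finset.sum_const, Finset.card_univ, Fintype.card_fin, smul_eq_mul]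
  unfold Spot.next
  by_cases h : s.height = 0
  · simp only [h, if_true, if_false, Nat.add_sub_cancel]
    rcases Nat.lt_or_ge s.pos J with hJ | hJ
    · rw [lineWeight, lineWeight, Finset.sum_eq_sum_Ico_succ_bot hJ, hl h]
      simp only [one_ne_zero, if_false]
      omega
    · rw [lineWeight, lineWeight, Finset.Ico_eq_empty (by omega), hl h, hμ _ hJ]
      simp [sideWeight_zero]
  · simp only [h, if_false, Nat.succ_ne_zero, true_and, false_and]
    rcases Nat.lt_or_ge M s.height with hM | hM
    · rw [show M + 1 - (s.height + 1) = 0 by omega]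
      simp [sideWeight]
    · rw [show M + 1 - s.height = (M + 1 - (s.height + 1)) + 1 by omega]
      generalize M + 1 - (s.height + 1) = q
      rw [sideWeight]
      by_cases h0 : s.level = 0
      · simp [h0, sideWeight_zero]
      · rw [if_neg h0]
        split_ifs <;> omega

lemma wordWeight_pos_line {w : List (Fin (e + 1))} (h : (spot R μ w).height = 0)
    (hJ : (spot R μ w).pos < J) : 1 ≤ wordWeight R M J μ w := by
  rw [wordWeight, if_pos h, lineWeight, Finset.sum_eq_sum_Ico_succ_bot hJ]
  omega

lemma wordWeight_pos_side {w : List (Fin (e + 1))} (h : (spot R μ w).height ≠ 0)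
    (hM : (spot R μ w).height ≤ M) (hl : 1 ≤ (spot R μ w).level) : 1 ≤ wordWeight R M J μ w := by
  rw [wordWeight, if_neg h,
    show M + 1 - (spot R μ w).height = (M - (spot R μ w).height) + 1 by omega, sideWeight,
    if_neg (by omega)]
  omega

end

/-- The levels along the line of the caterpillar. -/
def lineLevel (k R Z J j : ℕ) : ℕ :=
  -- A tent over the constant `k * R` with its peak (k+1) R at `Z`, the place of the core 0. Only
  -- about 2R positions carry the more expensive side trees.
  if j < J then k * R + (R - ((j - Z) + (Z - j))) else 0

lemma lineLevel_of_le {k R Z J j : ℕ} (h : J ≤ j) : lineLevel k R Z J j = 0 :=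
  if_neg (by omega)

lemma le_lineLevel {k R Z J j : ℕ} (h : j < J) : k * R ≤ lineLevel k R Z J j := by
  rw [lineLevel, if_pos h]
  omega

lemma lineLevel_lipschitz {k R Z J j j' : ℕ} (h : j < J) (h' : j' < J)
    (hj : j ≤ j' + 1) (hj' : j' ≤ j + 1) : lineLevel k R Z J j ≤ lineLevel k R Z J j' + 1 := by
  rw [lineLevel, lineLevel, if_pos h, if_pos h']
  omega

section

variable {n e k R M Z J : ℕ} {G : SimpleGraph (Fin n)} {φ : Fin n → Option (List (Fin (e + 1)))}

/-- The position of a vertex of a word tree; the additional vertex is placed far away. -/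
noncomputable def vertexSpot (R M : ℕ) (μ : ℕ → ℕ) : Option (List (Fin (e + 1))) → Spot
  | none => ⟨0, 0, M + 1⟩
  | some w => spot R μ w

/-- The distance to the position `j` of the line is at most `r`. -/
def Spot.Near (s : Spot) (j r : ℕ) : Prop :=
  s.pos + s.height ≤ j + r ∧ j + s.height ≤ s.pos + r

/-- An edge changes the distance from a position of the line by at most one. The bounds `r ≤ M < j`
exclude the step between the empty word and the additional vertex, whose spot is only a placeholder.
-/
lemma IsWordTree.near_step {μ : ℕ → ℕ}
    (hG : IsWordTree (wordWeight R M J μ) G φ) {x y : Fin n} (h : G.Adj x y) {j r : ℕ}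
    (hx : (vertexSpot R M μ (φ x)).Near j r) (hr : r ≤ M) (hj : M < j) :
    (vertexSpot R M μ (φ y)).Near j (r + 1) := by
  have step : ∀ (i : Fin (e + 1)) w, ((spot R μ w).Near j r → (spot R μ (i :: w)).Near j (r + 1)) ∧
      ((spot R μ (i :: w)).Near j r → (spot R μ w).Near j (r + 1)) := by
    intro i w
    rw [spot]
    unfold Spot.Near
    rcases Spot.next_cases (R := R) (μ := μ) (spot R μ w) (i = 0) with ⟨h1, -, h2⟩ | ⟨h1, h2, -⟩
    · rw [h2, h1]
      dsimp only
      constructor <;> omega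
    · rw [h1, h2]
      constructor <;> omega
  rcases (hG.adj_iff x y).1 h with ⟨w, h1, h2⟩ | ⟨w, h1, h2⟩
  · cases w with
    | nil =>
      rw [h1] at hx
      have : (⟨0, μ 0, 0⟩ : Spot).Near j r := hx
      unfold Spot.Near at this
      dsimp only at this
      omega
    | cons i w =>
      rw [h1] at hx
      rw [h2]
      exact (step i w).2 hx
  · cases w with
    | nil =>
      rw [h2] at hx
      have : (⟨0, 0, M + 1⟩ : Spot).Near j r := hx
      unfold Spot.Near at this
      dsimp only at this
      omega
    | cons i w =>
      rw [h2] at hx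
      rw [h1]
      exact (step i w).1 hx

lemma IsWordTree.near_ball {μ : ℕ → ℕ}
    (hG : IsWordTree (wordWeight R M J μ) G φ) {x : Fin n} {j : ℕ}
    (hx : (vertexSpot R M μ (φ x)).Near j 0) (hj : M < j) :
    ∀ y ∈ G.ballOf {x} M, (vertexSpot R M μ (φ y)).Near j M := by
  refine SimpleGraph.ballOf_induction (fun r => {y | (vertexSpot R M μ (φ y)).Near j r}) ?_ ?_ ?_
  · rintro _ rfl
    exact hx
  · rintro r - y ⟨h1, h2⟩
    exact ⟨by omega, by omega⟩
  · exact fun r hr y hy z hyz => hG.near_step hyz hy hr.le hj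

/-- The two neighbours of high level are the neighbours on the line for a vertex of the line, and
the parent and the child with letter 0 in a side tree. -/
lemma IsWordTree.levelAt (hG : IsWordTree (wordWeight R M J (lineLevel k R Z J)) G φ)
    (hR : 1 ≤ R) {x : Fin n} {j : ℕ}
    (hx : (vertexSpot R M (lineLevel k R Z J) (φ x)).Near j M) (hj : M < j) (hjJ : j + M + 1 < J) :
    LevelAt (e + 1 + 1) k R G (fun y => (vertexSpot R M (lineLevel k R Z J) (φ y)).level) x := by
  set μ := lineLevel k R Z J with hμ
  obtain ⟨hx1, hx2⟩ := hx
  cases hφ : φ x with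
  | none =>
    rw [hφ] at hx1 hx2
    change 0 + (M + 1) ≤ _ at hx1
    change _ + (M + 1) ≤ 0 + M at hx2
    omega
  | some w =>
    rw [hφ] at hx1 hx2
    change (spot R μ w).pos + (spot R μ w).height ≤ _ at hx1
    change _ + (spot R μ w).height ≤ (spot R μ w).pos + M at hx2
    cases w with
    | nil =>
      change _ ≤ 0 + M at hx2
      omega
    | cons i w =>
      have hadj : ∀ y, G.Adj x y → φ y = some w ∨ ∃ i', φ y = some (i' :: i :: w) := by
        intro y hy
        have := (hG.adj_iff x y).1 hy
        rw [hφ, wordAdj_some] at this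
        exact this
      have hpar : ∃ y, φ y = some w := hG.parent x _ hφ
      have hlev : ∀ {y u}, φ y = some u → (vertexSpot R M μ (φ y)).level = (spot R μ u).level :=
        fun h => by rw [h]; rfl
      have hadj1 : ∀ y, φ y = some w → G.Adj x y := fun y hy =>
        (hG.adj_iff x y).2 (by rw [hφ, hy]; exact Or.inl ⟨_, rfl, rfl⟩)
      have hadj2 : ∀ y i', φ y = some (i' :: i :: w) → G.Adj x y := fun y i' hy =>
        (hG.adj_iff x y).2 (by rw [hφ, hy]; exact Or.inr ⟨_, rfl, rfl⟩)
      have hneq : ∀ {y y' i'}, φ y = some w → φ y' = some (i' :: i :: w) → y ≠ y' := by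
        rintro y _ i' h1 h2 rfl
        have := congrArg List.length (Option.some.inj (h1.symm.trans h2))
        simp only [List.length_cons] at this
        omega
      have hs : spot R μ (i :: w) = (spot R μ w).next R μ (i = 0) := rfl
      rcases Spot.next_cases (R := R) (μ := μ) (spot R μ w) (i = 0) with ⟨h1, h2, h3⟩ | ⟨h1, h2, h3, h4⟩
      · -- a vertex of the line
        rw [← hs] at h3
        have hlw := spot_level h1
        set p := (spot R μ w).pos with hp
        rw [h3] at hx1 hx2
        dsimp only at hx1 hx2
        have hwt : 1 ≤ wordWeight R M J μ (i :: w) :=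
          wordWeight_pos_line (by rw [h3]) (by rw [h3]; dsimp only; omega)
        have hlx : (vertexSpot R M μ (φ x)).level = μ (p + 1) := by rw [hlev hφ, h3]
        have hl0 : (spot R μ (0 :: i :: w)).level = μ (p + 2) := by
          rw [spot, h3, Spot.next, if_pos rfl, if_pos rfl]
        refine ⟨fun _ => hG.degree x _ hφ hwt, ?_, ?_⟩
        · intro y hy
          rw [hlx]
          rcases hadj y hy with h | ⟨i', h⟩
          · rw [hlev h, hlw]
            exact lineLevel_lipschitz (by omega) (by omega) (by omega) (by omega)
          · rw [hlev h]
            rcases Spot.next_cases (R := R) (μ := μ) (spot R μ (i :: w)) (i' = 0) with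
              ⟨-, -, h5⟩ | ⟨-, -, h5, -⟩
            · rw [spot, h5, h3]
              change μ (p + 1) ≤ μ (p + 1 + 1) + 1
              exact lineLevel_lipschitz (by omega) (by omega) (by omega) (by omega)
            · rw [h3] at h5
              rw [spot, h3]
              exact h5
        · intro j' hj1 hjk _
          have hkR : j' * R ≤ k * R := Nat.mul_le_mul_right R hjk
          obtain ⟨y, hy⟩ := hpar
          obtain ⟨y', hy'⟩ := hG.child x _ hφ hwt 0
          refine ⟨y, y', hneq hy hy', hadj1 y hy, hadj2 y' 0 hy', ?_, ?_⟩
          · rw [hlev hy, hlw]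
            exact hkR.trans (le_lineLevel (by omega))
          · rw [hlev hy', hl0]
            exact hkR.trans (le_lineLevel (by omega))
      · -- a vertex of a side tree
        rw [← hs] at h1 h2 h3 h4
        have hwt : 1 ≤ (spot R μ (i :: w)).level → 1 ≤ wordWeight R M J μ (i :: w) := fun h =>
          wordWeight_pos_side (by omega) (by omega) h
        refine ⟨fun h => hG.degree x _ hφ (hwt (by rwa [← hlev hφ])), ?_, ?_⟩
        · intro y hy
          rw [hlev hφ]
          rcases hadj y hy with h | ⟨i', h⟩
          · rw [hlev h]
            omega
          · rw [hlev h]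
            rcases Spot.next_cases (R := R) (μ := μ) (spot R μ (i :: w)) (i' = 0) with
              ⟨h5, -⟩ | ⟨-, -, h5, -⟩
            · omega
            · exact h5
        · intro j' hj1 hjk hjl
          rw [hlev hφ] at hjl
          have hR' : R ≤ j' * R := Nat.le_mul_of_pos_left R hj1
          obtain ⟨y, hy⟩ := hpar
          obtain ⟨y', hy'⟩ := hG.child x _ hφ (hwt (by omega)) 0
          refine ⟨y, y', hneq hy hy', hadj1 y hy, hadj2 y' 0 hy', ?_, ?_⟩
          · rw [hlev hy]
            omega
          · rw [hlev hy', spot, Spot.next, if_neg (by omega)]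
            dsimp only
            split_ifs with hd
            · exact hjl
            · have : j' * R ≠ (spot R μ (i :: w)).level := fun h =>
                hd ⟨rfl, h ▸ Nat.dvd_mul_left R j'⟩
              omega

/-- The initial stage. -/
theorem exists_root {ρ D : ℕ} {m : ℕ} (hR : ρ + 1 ≤ R) (hM : M = (k + 1) * (ρ + D + 3))
    (hZ : Z = 2 * M + 4) (hJ : J = (k + 2) * Z)
    (hm : lineWeight e R M J (lineLevel k R Z J) 0 ≤ m) (hn : n = 2 + m * (e + 1)) :
    ∃ (b : Board n) (S : Stage n), b.IsValid k ∧ S.Good b (e + 2) k R ρ D (k + 1) ∧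
      S.trunk.card = 1 := by
  set μ := lineLevel k R Z J with hμ
  obtain ⟨G, φ, htree, hG⟩ := exists_isWordTree (Nat.succ_pos e) (wordWeight R M J μ)
    (sum_wordWeight_le fun j hj => lineLevel_of_le hj) (m := m)
    (by rw [wordWeight, if_pos (show (spot R μ []).height = 0 from rfl)]; exact hm) hn
  have hline : ∀ j, ∃ x, j ≤ J → φ x = some (List.replicate j 0) := by
    intro j
    induction j with
    | zero =>
      obtain ⟨x, hx⟩ := hG.nil
      exact ⟨x, fun _ => hx⟩
    | succ j ih =>
      obtain ⟨x, hx⟩ := ih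
      rcases Nat.lt_or_ge j J with hj | hj
      · obtain ⟨y, hy⟩ := hG.child x _ (hx hj.le)
          (wordWeight_pos_line (by rw [spot_replicate]) (by rw [spot_replicate]; exact hj)) 0
        exact ⟨y, fun _ => hy⟩
      · exact ⟨x, fun h => absurd h (by omega)⟩
  choose ln hln using hline
  let sp : Fin n → Spot := fun x => vertexSpot R M μ (φ x)
  have hsp : ∀ j ≤ J, sp (ln j) = ⟨j, μ j, 0⟩ := by
    intro j hj
    change vertexSpot R M μ (φ (ln j)) = _
    rw [hln j hj]
    exact spot_replicate j
  have hlt : ∀ l ≤ k, (l + 1) * Z + Z ≤ J := by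
    intro l hl
    rw [hJ, ← Nat.succ_mul]
    exact Nat.mul_le_mul_right _ (by omega)
  have hmul : ∀ l, (l + 1) * Z = l * Z + Z := fun l => by ring
  have hlm : ∀ l l', l < l' → l * Z + Z ≤ l' * Z := by
    intro l l' h
    rw [← Nat.succ_mul]
    exact Nat.mul_le_mul_right _ h
  -- The clean balls of radius `M` around positions lZ and (l+1)Z end at lZ + M and begin at lZ + M
  -- + 4, because Z = 2M + 4. Both ends of the cut edge fall into the gap and are bad.
  let b : Board n :=
    { core := fun l => ln ((l + 1) * Z)
      region := fun l => {x | l * Z + M + 2 ≤ (sp x).pos}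
      outer := fun l => ln (l * Z + M + 1)
      inner := fun l => ln (l * Z + M + 2) }
  have score : ∀ l ≤ k, sp (b.core l) = ⟨(l + 1) * Z, μ ((l + 1) * Z), 0⟩ := fun l hl =>
    hsp _ (by have := hlt l hl; omega)
  have souter : ∀ l ≤ k, sp (b.outer l) = ⟨l * Z + M + 1, μ (l * Z + M + 1), 0⟩ := fun l hl =>
    hsp _ (by have := hlt l hl; have := hmul l; omega)
  have sinner : ∀ l ≤ k, sp (b.inner l) = ⟨l * Z + M + 2, μ (l * Z + M + 2), 0⟩ := fun l hl =>
    hsp _ (by have := hlt l hl; have := hmul l; omega)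
  have hb : b.IsValid k := by
    constructor
    · intro l h1 h2
      change _ ≤ (sp _).pos
      rw [score l h2]
      dsimp only
      have := hmul l
      omega
    · intro l h1 h2
      change _ ≤ (sp _).pos
      rw [sinner l h2]
    · intro l h1 h2 h
      change _ ≤ (sp _).pos at h
      rw [souter l h2] at h
      dsimp only at h
      omega
    · intro l m h1 h2 h3 h
      change _ ≤ (sp _).pos at h
      rw [score l (by omega)] at h
      dsimp only at h
      have := hmul l
      have := hlm l m h2
      omega
    · intro l m h1 h2 h3 h
      change _ ≤ (sp _).pos at h
      rw [sinner l (by omega)] at h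
      dsimp only at h
      have := hlm l m h2
      omega
    · intro l m h1 h2 h3 h
      change _ ≤ (sp _).pos at h
      rw [souter l (by omega)] at h
      dsimp only at h
      have := hlm l m h2
      omega
  let bad : Set (Fin n) := {x | ∀ l ≤ k, ¬ (sp x).Near ((l + 1) * Z) M}
  have hball : ∀ l ≤ k, ∀ v ∈ G.ballOf {b.core l} M, v ∉ bad := by
    intro l hl v hv h
    refine h l hl (hG.near_ball ?_ ?_ v hv)
    · change (sp (b.core l)).Near _ _
      rw [score l hl]
      exact ⟨le_rfl, le_rfl⟩
    · have := hmul l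
      omega
  have hlevel : ∀ l ≤ k, k * R ≤ (sp (b.core l)).level := by
    intro l hl
    rw [score l hl]
    exact le_lineLevel (by have := hlt l hl; omega)
  have hcross : ∀ l, 1 ≤ l → l ≤ k → ∀ v w, G.Adj v w → v ∉ b.region l → w ∈ b.region l →
      v = b.outer l ∧ w = b.inner l := by
    intro l h1 h2 v w hvw hv hw
    change ¬ (_ ≤ (sp v).pos) at hv
    change _ ≤ (sp w).pos at hw
    change ¬ (_ ≤ (vertexSpot R M μ (φ v)).pos) at hv
    change _ ≤ (vertexSpot R M μ (φ w)).pos at hw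
    have hJl : l * Z + M + 2 ≤ J := by
      have := hlt l h2
      have := hmul l
      omega
    rcases (hG.adj_iff v w).1 hvw with ⟨u, e1, e2⟩ | ⟨u, e1, e2⟩
    · exfalso
      rw [e1] at hv
      rw [e2] at hw
      cases u with
      | nil =>
        change _ ≤ 0 at hw
        omega
      | cons i u =>
        change ¬ (_ ≤ ((spot R μ u).next R μ (i = 0)).pos) at hv
        change _ ≤ (spot R μ u).pos at hw
        rcases Spot.next_cases (R := R) (μ := μ) (spot R μ u) (i = 0) with ⟨-, -, h⟩ | ⟨h, -⟩
        · rw [h] at hv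
          dsimp only at hv
          omega
        · omega
    · rw [e2] at hv
      rw [e1] at hw
      cases u with
      | nil =>
        change _ ≤ 0 at hw
        omega
      | cons i u =>
        change ¬ (_ ≤ (spot R μ u).pos) at hv
        change _ ≤ ((spot R μ u).next R μ (i = 0)).pos at hw
        rcases Spot.next_cases (R := R) (μ := μ) (spot R μ u) (i = 0) with ⟨h3, h4, h⟩ | ⟨h, -⟩
        · rw [h] at hw
          dsimp only at hw
          have hp : (spot R μ u).pos = l * Z + M + 1 := by omega
          have hu := eq_replicate_of_height h3
          rw [hp] at hu
          constructor
          · refine hG.injective (e2.trans ?_)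
            rw [hln _ (by omega), hu]
            rfl
          · refine hG.injective (e1.trans ?_)
            rw [hln _ (by omega), h4, hu]
            rfl
        · omega
  have hnear : ∀ x, x ∉ bad → LevelAt (e + 2) k R G (fun y => (sp y).level) x := by
    intro x hx
    have : ∃ l ≤ k, (sp x).Near ((l + 1) * Z) M := by
      by_contra h
      push Not at h
      exact hx h
    obtain ⟨l, hl, h⟩ := this
    refine hG.levelAt (by omega) h ?_ ?_
    · have := hmul l
      omega
    · have := hlt l hl
      omega
  have hMR : (k + 1) * (ρ + D + 3) = M := hM.symm
  have hrev := exists_perm_extend (Equiv.refl (Fin n)) (Nat.zero_le n)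
    ((G.ballOf (({b.core 0} : Finset (Fin n)) : Set (Fin n)) ρ ∪
      {v | ∃ l, 1 ≤ l ∧ l ≤ k ∧ v = b.core l}).toFinite.toFinset) (fun j hj => absurd hj (by omega))
  obtain ⟨σ, p, -, hp, -, hσ⟩ := hrev
  refine ⟨b, ⟨G, fun y => (sp y).level, bad, {b.core 0}, 0, σ, p⟩, hb, ?_, Finset.card_singleton _⟩
  refine ⟨htree, hnear, ?_, Finset.mem_singleton_self _, ?_, ?_, by simp, ?_, ?_, hp, ?_⟩
  · intro v hv
    rw [Finset.coe_singleton, Set.mem_singleton_iff] at hv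
    subst hv
    exact ⟨SimpleGraph.Walk.nil, by simp⟩
  · intro v hv
    rw [Finset.mem_singleton] at hv
    subst hv
    change _ ≤ (sp _).level
    rw [score 0 (by omega)]
    have := hlt 0 (by omega)
    change _ ≤ lineLevel k R Z J _
    rw [lineLevel, if_pos (by omega), Nat.zero_add, Nat.one_mul, Nat.sub_self, Nat.add_zero,
      Nat.sub_zero, Nat.succ_mul]
  · intro v hv
    rw [Finset.coe_singleton, hMR] at hv
    exact hball 0 (by omega) v hv
  · intro l h1 h2
    change l ≤ 0 at h2
    omega
  · intro l h1 h2
    change 0 < l at h1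
    have hJl : l * Z + M + 2 ≤ J := by
      have := hlt l h2
      have := hmul l
      omega
    rw [hMR]
    refine ⟨hcross l h1 h2, ?_, ?_, ?_, hball l h2, hlevel l h2, ?_⟩
    · refine (hG.adj_iff _ _).2 ?_
      rw [hln _ (by omega), hln _ hJl]
      exact Or.inr ⟨_, rfl, rfl⟩
    · intro l' hl' h
      rw [souter l h2] at h
      obtain ⟨h3, h4⟩ := h
      dsimp only at h3 h4
      have := hmul l'
      rcases Nat.lt_or_ge l' l with h5 | h5
      · have := hlm l' l h5
        omega
      · have := Nat.mul_le_mul_right Z h5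
        omega
    · intro l' hl' h
      rw [sinner l h2] at h
      obtain ⟨h3, h4⟩ := h
      dsimp only at h3 h4
      have := hmul l'
      rcases Nat.lt_or_ge l' l with h5 | h5
      · have := hlm l' l h5
        omega
      · have := Nat.mul_le_mul_right Z h5
        omega
    · intro v hv h
      rw [Finset.mem_singleton] at hv
      subst hv
      change _ ≤ (sp _).pos at h
      rw [score 0 (by omega)] at h
      dsimp only at h
      have := hlm 0 l h1
      omega
  · intro v
    rw [← hσ v, Set.Finite.mem_toFinset]
    rfl

end

/-- At a level divisible by `R` there is a path of at most `s` vertices of this level, with subtrees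
of smaller level attached: one factor s + 1 for each multiple of `R`. At other levels all subtrees
have smaller level, which the constant (e+2)^v absorbs. -/
lemma sideWeight_le {e R : ℕ} (hR : 1 ≤ R) (s v : ℕ) :
    sideWeight e R s v ≤ (e + 2) ^ v * (s + 1) ^ (v / R) := by
  induction s generalizing v with
  | zero => exact Nat.zero_le _
  | succ s ih =>
    rw [sideWeight]
    split_ifs with h0 h1
    · exact Nat.zero_le _
    · obtain ⟨q, rfl⟩ := h1
      have hq : 1 ≤ q := Nat.one_le_iff_ne_zero.2 (by rintro rfl; simp at h0)
      obtain ⟨q, rfl⟩ := Nat.exists_eq_add_of_le' hq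
      have e1 : R * (q + 1) / R = q + 1 := Nat.mul_div_cancel_left _ (by omega)
      have e2 : (R * (q + 1) - 1) / R = q := by
        rw [Nat.mul_add, Nat.mul_one, show R * q + R - 1 = R - 1 + R * q by omega,
          Nat.add_mul_div_left _ _ (by omega), Nat.div_eq_of_lt (by omega), Nat.zero_add]
      have a1 := ih (R * (q + 1))
      have a2 := ih (R * (q + 1) - 1)
      rw [e1] at a1 ⊢
      rw [e2] at a2
      have e3 : (e + 2) ^ (R * (q + 1)) = (e + 2) ^ (R * (q + 1) - 1) * (e + 2) := by
        rw [← pow_succ, Nat.sub_add_cancel (by omega)]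
      rw [e3] at a1 ⊢
      have hX : 1 ≤ (e + 2) ^ (R * (q + 1) - 1) := Nat.one_le_pow _ _ (by omega)
      have hY : 1 ≤ (s + 1) ^ q := Nat.one_le_pow _ _ (by omega)
      have hYY : (s + 1) ^ q ≤ (s + 2) ^ q := Nat.pow_le_pow_left (by omega) q
      generalize (e + 2) ^ (R * (q + 1) - 1) = X at *
      rw [pow_succ] at a1 ⊢
      have a3 : X * (e + 2) * ((s + 1) ^ q * (s + 2)) ≤ X * (e + 2) * ((s + 2) ^ q * (s + 2)) :=
        Nat.mul_le_mul_left _ (Nat.mul_le_mul_right _ hYY)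
      have hXY : 1 ≤ X * (s + 1) ^ q := Nat.mul_pos hX hY
      have a4 := Nat.mul_le_mul_left e a2
      generalize (s + 1) ^ q = Y at *
      have a5 : X * (e + 2) * (Y * (s + 2)) =
          X * (e + 2) * (Y * (s + 1)) + (e * (X * Y) + 2 * (X * Y)) := by ring
      rw [show s + 1 + 1 = s + 2 from rfl]
      omega
    · have a2 := ih (v - 1)
      have hdiv : (v - 1) / R ≤ v / R := Nat.div_le_div_right (Nat.sub_le _ _)
      have e3 : (e + 2) ^ v = (e + 2) ^ (v - 1) * (e + 2) := by
        rw [← pow_succ, Nat.sub_add_cancel (by omega)]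
      have a3 : (e + 2) ^ (v - 1) * (s + 1) ^ ((v - 1) / R) ≤
          (e + 2) ^ (v - 1) * (s + 1 + 1) ^ (v / R) :=
        Nat.mul_le_mul_left _ ((Nat.pow_le_pow_right (by omega) hdiv).trans
          (Nat.pow_le_pow_left (by omega) _))
      have hX : 1 ≤ (e + 2) ^ (v - 1) * (s + 1 + 1) ^ (v / R) := by
        exact Nat.one_le_iff_ne_zero.2 (by positivity)
      have a4 := a2.trans a3
      rw [e3]
      generalize sideWeight e R s (v - 1) = N at *
      have a5 : (e + 2) ^ (v - 1) * (e + 2) * (s + 1 + 1) ^ (v / R) =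
        e * ((e + 2) ^ (v - 1) * (s + 1 + 1) ^ (v / R)) +
          2 * ((e + 2) ^ (v - 1) * (s + 1 + 1) ^ (v / R)) := by ring
      rw [a5]
      have a6 := Nat.mul_le_mul_left e a4
      omega

/-- O(M) positions carry side trees of level below k R, of size O(M^(k-1)); the 2R positions around
`Z` carry side trees of level below (k+1) R, of size O(M^k). -/
lemma lineWeight_le {e k R M Z J : ℕ} (hk : 1 ≤ k) (hR : 1 ≤ R) (hZ : Z = 2 * M + 4)
    (hJ : J = (k + 2) * Z) :
    lineWeight e R M J (lineLevel k R Z J) 0 ≤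
      (4 * (k + 2) + 2 * R) * ((e + 1) * (e + 2) ^ ((k + 1) * R)) * (M + 1) ^ k := by
  set E := (e + 2) ^ ((k + 1) * R) with hE
  have hE1 : 1 ≤ E := Nat.one_le_pow _ _ (by omega)
  have hMk : 1 ≤ (M + 1) ^ (k - 1) := Nat.one_le_pow _ _ (by omega)
  -- a bound for a single position
  have hside : ∀ q v, q ≤ k → v < (q + 1) * R → sideWeight e R M v ≤ E * (M + 1) ^ q := by
    intro q v hq hv
    refine (sideWeight_le hR M v).trans (Nat.mul_le_mul (Nat.pow_le_pow_right (by omega) ?_)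
      (Nat.pow_le_pow_right (by omega) ?_))
    · exact hv.le.trans (Nat.mul_le_mul_right R (by omega))
    · exact Nat.lt_succ_iff.1 ((Nat.div_lt_iff_lt_mul (by omega)).2 hv)
  have hterm : ∀ j ∈ Finset.Ico 0 J, 1 + e * sideWeight e R M (lineLevel k R Z J j - 1) ≤
      (e + 1) * E * (M + 1) ^ (k - 1) +
        if j ∈ Finset.Ico (Z - R) (Z + R) then (e + 1) * E * (M + 1) ^ k else 0 := by
    intro j hj
    rw [Finset.mem_Ico] at hj
    have hkR : (k - 1 + 1) * R = k * R := by rw [Nat.sub_add_cancel hk]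
    have hkR' : (k + 1) * R = k * R + R := by ring
    have hkR1 : R ≤ k * R := Nat.le_mul_of_pos_left R hk
    rw [lineLevel, if_pos hj.2]
    have h1 : 1 ≤ E * (M + 1) ^ (k - 1) := Nat.mul_pos hE1 hMk
    split_ifs with h
    · have h2 := Nat.mul_le_mul_left e (hside k (k * R + (R - ((j - Z) + (Z - j))) - 1) le_rfl (by omega))
      calc _ ≤ E * (M + 1) ^ (k - 1) + e * (E * (M + 1) ^ k) := Nat.add_le_add h1 h2
        _ ≤ (e + 1) * E * (M + 1) ^ (k - 1) + (e + 1) * E * (M + 1) ^ k := by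
          refine Nat.add_le_add ?_ ?_
          · exact Nat.mul_le_mul_right _ (Nat.le_mul_of_pos_left _ (by omega))
          · rw [← Nat.mul_assoc]
            exact Nat.mul_le_mul_right _ (Nat.mul_le_mul_right _ (by omega))
    · rw [Finset.mem_Ico] at h
      have h2 := Nat.mul_le_mul_left e (hside (k - 1) (k * R + (R - ((j - Z) + (Z - j))) - 1) (by omega)
        (by rw [hkR]; omega))
      calc _ ≤ E * (M + 1) ^ (k - 1) + e * (E * (M + 1) ^ (k - 1)) := Nat.add_le_add h1 h2
        _ = _ := by ring
  refine (Finset.sum_le_sum hterm).trans ?_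
  rw [Finset.sum_add_distrib, Finset.sum_const, Nat.card_Ico, smul_eq_mul, ← Finset.sum_filter,
    Finset.sum_const, smul_eq_mul]
  have hc : ((Finset.Ico 0 J).filter (fun j => j ∈ Finset.Ico (Z - R) (Z + R))).card ≤ 2 * R := by
    refine (Finset.card_le_card (fun j hj => (Finset.mem_filter.1 hj).2)).trans ?_
    rw [Nat.card_Ico]
    omega
  have hJ' : J - 0 ≤ 4 * (k + 2) * (M + 1) := by
    rw [hJ, hZ, Nat.sub_zero, show 4 * (k + 2) * (M + 1) = (k + 2) * (4 * (M + 1)) by ring]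
    exact Nat.mul_le_mul_left _ (by omega)
  have hpow : (M + 1) ^ k = (M + 1) * (M + 1) ^ (k - 1) := by
    rw [← pow_succ', Nat.sub_add_cancel hk]
  calc _ ≤ 4 * (k + 2) * (M + 1) * ((e + 1) * E * (M + 1) ^ (k - 1)) +
        2 * R * ((e + 1) * E * (M + 1) ^ k) :=
        Nat.add_le_add (Nat.mul_le_mul_right _ hJ') (Nat.mul_le_mul_right _ hc)
    _ = _ := by rw [hpow]; ring

/-- Trees of degree at least three: fast algorithms lead to good sequences of length `k + 1`. -/
theorem UnrootedLCL.lt_depth_of_three_le {L : Type*} [Finite L] (P : UnrootedLCL L) (hΔ : 3 ≤ P.Δ)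
    {k : ℕ} (hk : 1 ≤ k) : ∃ C : ℕ, ∀ (A : RandOnlineLocalAlg L) (n : ℕ),
      (∀ G : SimpleGraph (Fin n), IsRegularTree P.Δ G → ∀ σ : Equiv.Perm (Fin n),
        randomBits.real {ω | ¬ P.IsSolution G (A.run G σ ω)} ≤ 1 / (n : ℝ)) →
      (∃ G : SimpleGraph (Fin n), IsRegularTree P.Δ G) →
      C * (A.locality n + 1) ^ k ≤ n → ((k + 1 : ℕ) : ℕ∞) ≤ P.depth := by
  obtain ⟨e, he⟩ : ∃ e, P.Δ = e + 2 := ⟨P.Δ - 2, by omega⟩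
  obtain ⟨γ, hγ⟩ := UnrootedLCL.exists_trim_radius P
  -- The sequence has k + 1 trims, and each costs a distance γ. `R` exceeds ρ so that leaving the
  -- trunk by ρ + 1 steps costs only one multiple of `R`.
  set ρ := (k + 1) * γ with hρ
  set R := ρ + 1 with hR
  set C₀ := (4 * (k + 2) + 2 * R) * ((e + 1) * (e + 2) ^ ((k + 1) * R)) with hC₀
  set C₁ := C₀ * ((k + 1) * (ρ + 6)) ^ k with hC₁
  -- The first two summands make room for the caterpillar, the last one for the union bound.
  refine ⟨C₁ * (e + 1) + 2 + (Stage.growth P.Δ k ρ ^ k + 1), fun A n hA hG hn => ?_⟩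
  set T := A.locality n with hT
  have hT1 : 1 ≤ (T + 1) ^ k := Nat.one_le_pow _ _ (by omega)
  have hn' : C₁ * (T + 1) ^ k * (e + 1) + 2 + Stage.growth P.Δ k ρ ^ k * (T + 1) ^ k + 1 ≤ n := by
    refine le_trans ?_ hn
    have : (C₁ * (e + 1) + 2 + (Stage.growth P.Δ k ρ ^ k + 1)) * (T + 1) ^ k =
      C₁ * (T + 1) ^ k * (e + 1) + 2 * (T + 1) ^ k + Stage.growth P.Δ k ρ ^ k * (T + 1) ^ k +
        (T + 1) ^ k := by ring
    rw [this]
    omega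
  obtain ⟨G₀, hG₀⟩ := hG
  obtain ⟨m, hm⟩ := hG₀.dvd (by rw [Fintype.card_fin]; omega)
  rw [Fintype.card_fin, he, show e + 2 - 1 = e + 1 by omega, Nat.mul_comm] at hm
  have hmn : n = 2 + m * (e + 1) := by omega
  have hC : C₁ * (T + 1) ^ k ≤ m := by
    refine Nat.le_of_mul_le_mul_right (c := e + 1) ?_ (Nat.succ_pos e)
    omega
  set M := (k + 1) * (ρ + (T + 2) + 3) with hM
  have hM1 : M + 1 ≤ (k + 1) * (ρ + 6) * (T + 1) := by
    have h1 : ρ + 6 + T ≤ (ρ + 6) * (T + 1) := by nlinarith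
    calc M + 1 ≤ (k + 1) * (ρ + 6 + T) := by rw [hM]; nlinarith
      _ ≤ _ := by rw [Nat.mul_assoc]; exact Nat.mul_le_mul_left _ h1
  have hw : lineWeight e R M ((k + 2) * (2 * M + 4))
      (lineLevel k R (2 * M + 4) ((k + 2) * (2 * M + 4))) 0 ≤ m := by
    refine (lineWeight_le hk (by omega) rfl rfl).trans (le_trans ?_ hC)
    rw [← hC₀, hC₁, Nat.mul_assoc C₀, ← mul_pow]
    exact Nat.mul_le_mul_left _ (Nat.pow_le_pow_left hM1 k)
  obtain ⟨b, S, hb, hS, hc⟩ := exists_root (k := k) (ρ := ρ) (D := T + 2) le_rfl hM rfl rfl hw hmn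
  rw [← he] at hS
  obtain ⟨F, hF, hcard⟩ := Stage.exists_isFamily hb hΔ le_rfl hS hc
  have hFn : (F 1).card < n := by
    have h1 : (T + 1) ^ (k - 1) ≤ (T + 1) ^ k := Nat.pow_le_pow_right (by omega) (Nat.sub_le _ _)
    have h2 := Nat.mul_le_mul_left (Stage.growth P.Δ k ρ ^ k) h1
    omega
  obtain ⟨ω, hω⟩ := RandOnlineLocalAlg.exists_bits hA (F 1) (fun S => S.graph) (fun S => S.order)
    (fun S hS => (hF.good 1 le_rfl (by omega) S hS).tree) hFn
  exact hF.le_depth hω hk (by omega) le_rfl hγ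

/-! ### Paths -/

/-- The path in which the vertex `x` has the position `π x`. -/
def lineGraph {n : ℕ} (π : Fin n → ℕ) : SimpleGraph (Fin n) where
  Adj x y := π x + 1 = π y ∨ π y + 1 = π x
  symm := ⟨fun _ _ h => h.symm⟩
  loopless := ⟨fun x h => by omega⟩

/-- The positions of the vertices are the numbers below `n`. -/
structure IsPosition {n : ℕ} (π : Fin n → ℕ) : Prop where
  injective : Function.Injective π
  lt : ∀ x, π x < n

namespace IsPosition

variable {n : ℕ} {π : Fin n → ℕ}

lemma exists_eq (h : IsPosition π) {s : ℕ} (hs : s < n) : ∃ x, π x = s := by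
  have hinj : Function.Injective fun x : Fin n => (⟨π x, h.lt x⟩ : Fin n) := fun x y hxy =>
    h.injective (Fin.mk.inj_iff.1 hxy)
  obtain ⟨x, hx⟩ := (Finite.injective_iff_surjective.1 hinj) ⟨s, hs⟩
  exact ⟨x, Fin.mk.inj_iff.1 hx⟩

lemma exists_walk (h : IsPosition π) {x : Fin n} (d : ℕ) :
    ∀ y, π y = π x + d → ∃ p : (lineGraph π).Walk x y, p.length = d := by
  induction d with
  | zero =>
    intro y hy
    obtain rfl : x = y := h.injective hy.symm
    exact ⟨SimpleGraph.Walk.nil, rfl⟩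
  | succ d ih =>
    intro y hy
    have hlt := h.lt y
    obtain ⟨z, hz⟩ := h.exists_eq (s := π x + d) (by omega)
    obtain ⟨p, hp⟩ := ih z hz
    have hzy : (lineGraph π).Adj z y := Or.inl (by omega)
    exact ⟨p.concat hzy, by rw [SimpleGraph.Walk.length_concat, hp]⟩

lemma le_of_walk {x y : Fin n} (p : (lineGraph π).Walk x y) :
    π y ≤ π x + p.length ∧ π x ≤ π y + p.length := by
  induction p with
  | nil => simp
  | cons hh p ih =>
    rw [SimpleGraph.Walk.length_cons]
    rcases hh with hh | hh <;> omega

lemma mem_ballOf_le {x y : Fin n} {r : ℕ} (hy : y ∈ (lineGraph π).ballOf {x} r) :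
    π y ≤ π x + r ∧ π x ≤ π y + r := by
  obtain ⟨_, rfl, p, hp⟩ := hy
  have := le_of_walk p
  omega

lemma connected (h : IsPosition π) (hn : 0 < n) : (lineGraph π).Connected := by
  have : Nonempty (Fin n) := ⟨⟨0, hn⟩⟩
  refine ⟨fun x y => ?_⟩
  rcases Nat.le_total (π x) (π y) with hxy | hxy
  · obtain ⟨p, -⟩ := h.exists_walk (x := x) (π y - π x) y (by omega)
    exact ⟨p⟩
  · obtain ⟨p, -⟩ := h.exists_walk (x := y) (π x - π y) x (by omega)
    exact ⟨p.reverse⟩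

lemma dist_eq (h : IsPosition π) (x y : Fin n) :
    (lineGraph π).dist x y = (π y - π x) + (π x - π y) := by
  have hn : 0 < n := x.pos
  obtain ⟨p, hp⟩ := (h.connected hn).exists_walk_length_eq_dist x y
  have h1 := le_of_walk p
  rcases Nat.le_total (π x) (π y) with hxy | hxy
  · obtain ⟨q, hq⟩ := h.exists_walk (x := x) (π y - π x) y (by omega)
    have := SimpleGraph.dist_le q
    omega
  · obtain ⟨q, hq⟩ := h.exists_walk (x := y) (π x - π y) x (by omega)
    have := SimpleGraph.dist_le q.reverse
    rw [SimpleGraph.Walk.length_reverse] at this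
    omega

lemma isTree (h : IsPosition π) (hn : 0 < n) : (lineGraph π).IsTree := by
  classical
  refine SimpleGraph.isTree_of_connected_of_card_le (h.connected hn) ?_
  obtain ⟨x₀, hx₀⟩ := h.exists_eq hn
  have hp : ∀ x, ∃ y, x ≠ x₀ → π y + 1 = π x := by
    intro x
    have hlt := h.lt x
    obtain ⟨y, hy⟩ := h.exists_eq (s := π x - 1) (by omega)
    refine ⟨y, fun hne => ?_⟩
    have : π x ≠ 0 := fun h0 => hne (h.injective (h0.trans hx₀.symm))
    omega
  choose pr hpr using hp
  have hsub : (lineGraph π).edgeSet ⊆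
      ((Finset.univ.erase x₀).image fun x => s(x, pr x) : Finset _) := by
    intro ed hed
    have key : ∀ x y, π x + 1 = π y → s(y, x) ∈
        ((Finset.univ.erase x₀).image fun x => s(x, pr x) : Finset _) := by
      intro x y hxy
      have hy : y ≠ x₀ := by
        rintro rfl
        omega
      have : pr y = x := h.injective (by have := hpr y hy; omega)
      exact Finset.mem_image.2 ⟨y, Finset.mem_erase.2 ⟨hy, Finset.mem_univ _⟩, by rw [this]⟩
    induction ed with
    | _ x y =>
      rw [Finset.mem_coe]
      rcases hed with hxy | hxy
      · rw [Sym2.eq_swap]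
        exact key x y hxy
      · exact key y x hxy
  have h1 := Set.ncard_le_ncard hsub (Set.toFinite _)
  rw [Set.ncard_coe_finset] at h1
  have h2 := h1.trans Finset.card_image_le
  rw [Finset.card_erase_of_mem (Finset.mem_univ _), Finset.card_univ, Fintype.card_fin] at h2
  rw [Nat.card_coe_set_eq, Nat.card_eq_fintype_card, Fintype.card_fin]
  omega

lemma nbrs_eq (h : IsPosition π) {a x b : Fin n} (ha : π a + 1 = π x) (hb : π x + 1 = π b) :
    nbrs (lineGraph π) x = {a, b} := by
  ext y
  rw [mem_nbrs, Finset.mem_insert, Finset.mem_singleton]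
  constructor
  · rintro (hy | hy)
    · exact Or.inr (h.injective (by omega))
    · exact Or.inl (h.injective (by omega))
  · rintro (rfl | rfl)
    · exact Or.inr ha
    · exact Or.inl hb

lemma card_nbrs_inner (h : IsPosition π) {x : Fin n} (h0 : 0 < π x) (h1 : π x + 1 < n) :
    (nbrs (lineGraph π) x).card = 2 := by
  obtain ⟨a, ha⟩ := h.exists_eq (s := π x - 1) (by omega)
  obtain ⟨b, hb⟩ := h.exists_eq h1
  rw [h.nbrs_eq (a := a) (b := b) (by omega) hb.symm, Finset.card_pair]
  rintro rfl
  omega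

lemma card_nbrs_end (h : IsPosition π) (hn : 2 ≤ n) {x : Fin n} (hx : π x = 0 ∨ π x + 1 = n) :
    (nbrs (lineGraph π) x).card = 1 := by
  rw [Finset.card_eq_one]
  have : ∃ y, (lineGraph π).Adj x y ∧ ∀ z, (lineGraph π).Adj x z → π z = π y := by
    rcases hx with hx | hx
    · obtain ⟨y, hy⟩ := h.exists_eq (s := 1) (by omega)
      refine ⟨y, Or.inl (by omega), fun z hz => ?_⟩
      rcases hz with hz | hz <;> omega
    · obtain ⟨y, hy⟩ := h.exists_eq (s := n - 2) (by omega)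
      refine ⟨y, Or.inr (by omega), fun z hz => ?_⟩
      have := h.lt z
      rcases hz with hz | hz <;> omega
  obtain ⟨y, hy, hz⟩ := this
  refine ⟨y, ?_⟩
  ext z
  rw [mem_nbrs, Finset.mem_singleton]
  exact ⟨fun hxz => h.injective (hz z hxz), fun e => e ▸ hy⟩

lemma isRegularTree (h : IsPosition π) (hn : 2 ≤ n) : IsRegularTree 2 (lineGraph π) := by
  refine ⟨h.isTree (by omega), fun x => ?_⟩
  have := h.lt x
  by_cases hx : π x = 0 ∨ π x + 1 = n
  · exact Or.inl (h.card_nbrs_end hn hx)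
  · push Not at hx
    exact Or.inr (h.card_nbrs_inner (by omega) (by omega))

lemma nodeConfig_eq (h : IsPosition π) {L : Type*} (ℓ : Fin n → Fin n → L) {a x b : Fin n}
    (ha : π a + 1 = π x) (hb : π x + 1 = π b) :
    nodeConfig (lineGraph π) ℓ x = {ℓ x a, ℓ x b} := by
  classical
  rw [nodeConfig, h.nbrs_eq ha hb]
  have hab : a ≠ b := by
    rintro rfl
    omega
  rw [Finset.insert_val, Multiset.ndinsert_of_notMem (by simpa using hab)]
  simp

end IsPosition

/-! ### Good sequences of problems of degree two -/

namespace UnrootedLCL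

variable {L : Type*} {P : UnrootedLCL L}

lemma pair_eq_of_le (hΔ : P.Δ = 2) {C : Sym L P.Δ} {x y : L}
    (h : ({x, y} : Multiset L) ≤ (C : Multiset L)) : (C : Multiset L) = {x, y} := by
  refine (Multiset.eq_of_le_of_card_le h ?_).symm
  have : Multiset.card (C : Multiset L) = P.Δ := C.2
  rw [this, hΔ]
  simp

lemma sym2_eq_of_pair_eq {x y x' y' : L} (h : ({x, y} : Multiset L) = {x', y'}) :
    s(x, y) = s(x', y') := by
  rw [Sym2.eq_iff]
  rw [Multiset.insert_eq_cons, Multiset.insert_eq_cons, Multiset.cons_eq_cons] at h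
  rcases h with ⟨rfl, h⟩ | ⟨-, cs, h1, h2⟩
  · exact Or.inl ⟨rfl, Multiset.singleton_inj.1 h⟩
  · have h3 := (Multiset.singleton_eq_cons_iff _).1 h1
    have h4 := (Multiset.singleton_eq_cons_iff _).1 h2
    exact Or.inr ⟨h4.1.symm, h3.1⟩

lemma WalkIn.exists_fun {W : Set (Sym L P.Δ)} {U : Set (L × L)} {m : ℕ} {u v : L × L}
    (h : P.WalkIn W U m u v) : ∃ f : ℕ → L × L, f 0 = u ∧ f m = v ∧ (∀ s ≤ m, f s ∈ U) ∧
      ∀ s < m, P.autAdj W (f s) (f (s + 1)) := by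
  induction m generalizing u with
  | zero =>
    obtain ⟨hu, rfl⟩ := h
    exact ⟨fun _ => u, rfl, rfl, fun _ _ => hu, fun s hs => absurd hs (by omega)⟩
  | succ m ih =>
    obtain ⟨hu, x, hx, hxv⟩ := h
    obtain ⟨f, h0, hm, hf, hf'⟩ := ih hxv
    refine ⟨fun s => if s = 0 then u else f (s - 1), by simp, by simpa using hm, ?_, ?_⟩
    · intro s hs
      dsimp only
      split_ifs with h
      · exact hu
      · exact hf _ (by omega)
    · intro s hs
      rcases Nat.eq_zero_or_pos s with rfl | h
      · simpa [h0] using hx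
      · have := hf' (s - 1) (by omega)
        rw [Nat.sub_add_cancel h] at this
        simpa [h.ne'] using this

/-- A closed walk through `(x, y)` gives labelings of all complete trees of degree two with the
configuration `{x, y}` at the root. -/
lemma hasTree_of_walk (hΔ : P.Δ = 2) {W : Set (Sym L P.Δ)} {U : Set (L × L)}
    (hW : W ⊆ P.nodeConstraints) (hU : U ⊆ P.autNodes W) {m : ℕ} (hm : 0 < m) {p : L × L}
    (h : P.WalkIn W U m p p) {C : Sym L P.Δ} (hC : (C : Multiset L) = {p.1, p.2}) {i : ℕ}
    (hi : 1 ≤ i) : P.HasTree W C i := by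
  obtain ⟨f, h0, hmf, hfU, hf⟩ := h.exists_fun
  -- The closed walk is repeated periodically, with the phase chosen so that `p` appears at the
  -- centre `i`, because i + (m - 1) i = m i.
  let g : ℕ → L × L := fun s => f ((s + (m - 1) * i) % m)
  have hgU : ∀ s, g s ∈ U := fun s => hfU _ (Nat.mod_lt _ hm).le
  have hgi : g i = p := by
    have : i + (m - 1) * i = m * i := by
      obtain ⟨m, rfl⟩ := Nat.exists_eq_add_of_le' hm
      rw [Nat.add_sub_cancel]
      ring
    simp only [g, this, Nat.mul_mod_right, h0]
  have hgs : ∀ s, P.autAdj W (g s) (g (s + 1)) := by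
    intro s
    simp only [g]
    rw [show s + 1 + (m - 1) * i = s + (m - 1) * i + 1 by omega]
    generalize s + (m - 1) * i = q
    have hq := Nat.mod_lt q hm
    have h1 := hf (q % m) hq
    rcases Nat.lt_or_ge (q % m + 1) m with h | h
    · rwa [← Nat.mod_eq_of_lt h, Nat.mod_add_mod] at h1
    · have e : q % m + 1 = m := by omega
      have e' : (q + 1) % m = 0 := by rw [← Nat.mod_add_mod, e, Nat.mod_self]
      rwa [e, hmf, ← h0, ← e'] at h1
  let n := 2 * i + 1
  let π : Fin n → ℕ := fun x => x.val
  have hπ : IsPosition π := ⟨Fin.val_injective, fun x => x.2⟩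
  let ℓ : Fin n → Fin n → L := fun x y => if π y < π x then (g (π x)).1 else (g (π x)).2
  have hcfg : ∀ x, 0 < π x → π x + 1 < n →
      nodeConfig (lineGraph π) ℓ x = {(g (π x)).1, (g (π x)).2} := by
    intro x h1 h2
    obtain ⟨a, ha⟩ := hπ.exists_eq (s := π x - 1) (by omega)
    obtain ⟨b, hb⟩ := hπ.exists_eq h2
    rw [hπ.nodeConfig_eq ℓ (a := a) (b := b) (by omega) hb.symm]
    simp only [ℓ]
    rw [if_pos (by omega), if_neg (by omega)]
  have hcfg' : ∀ x, 0 < π x → π x + 1 < n →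
      ∃ C' ∈ W, (C' : Multiset L) = nodeConfig (lineGraph π) ℓ x := by
    intro x h1 h2
    obtain ⟨C', hC', h⟩ := hU (hgU (π x))
    exact ⟨C', hC', by rw [hcfg x h1 h2, pair_eq_of_le hΔ h]⟩
  have hinner : ∀ x, (nbrs (lineGraph π) x).card = 2 → 0 < π x ∧ π x + 1 < n := by
    intro x hx
    have hlt := hπ.lt x
    by_contra hcon
    have := hπ.card_nbrs_end (by omega) (x := x) (by omega)
    omega
  let r : Fin n := ⟨i, by omega⟩
  have hr : π r = i := rfl
  refine ⟨Fin n, inferInstance, lineGraph π, r, ℓ, ⟨hπ.isTree (by omega), ?_, ?_, ?_⟩, ⟨?_, ?_⟩, ?_, ?_⟩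
  · intro v
    have := hπ.lt v
    rw [hπ.dist_eq]
    omega
  · intro v hv
    have := hπ.lt v
    rw [hπ.dist_eq] at hv
    rw [hΔ]
    exact hπ.card_nbrs_inner (by omega) (by omega)
  · intro v hv
    have := hπ.lt v
    rw [hπ.dist_eq] at hv
    exact hπ.card_nbrs_end (by omega) (by omega)
  · intro v hv
    rw [hΔ] at hv
    obtain ⟨h1, h2⟩ := hinner v hv
    obtain ⟨C', hC', h⟩ := hcfg' v h1 h2
    exact ⟨C', hW hC', h⟩
  · intro u v huv
    have key : ∀ u v : Fin n, π u + 1 = π v → s(ℓ u v, ℓ v u) ∈ P.edgeConstraints := by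
      intro u v huv
      have := (hgs (π u)).2.2
      simp only [ℓ]
      rw [if_neg (by omega), if_pos (by omega), ← huv]
      exact this
    rcases huv with huv | huv
    · exact key u v huv
    · rw [Sym2.eq_swap]
      exact key v u huv
  · rw [hcfg r (by omega) (by omega), hr, hgi, hC]
  · intro v _ hv
    have := hπ.lt v
    rw [hπ.dist_eq] at hv
    exact hcfg' v (by omega) (by omega)

/-- For problems of degree two a flexible component can be used again and again. -/
theorem depth_eq_top_of_flexSCC (hΔ : P.Δ = 2) {W : Set (Sym L P.Δ)} {D : Set (Sym2 L)}
    (hW : W = P.trim (P.restrict P.nodeConstraints Set.univ)) (hD : D ∈ P.flexSCC W) :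
    P.depth = ⊤ := by
  obtain ⟨⟨u, hu, hscc⟩, K, hK, hflex⟩ := hD
  set U := P.pairNodes D with hUdef
  set X := P.restrict W D with hX
  have hWV : W ⊆ P.nodeConstraints := by
    rw [hW]
    exact (trim_subset _).trans (restrict_subset _ _)
  have hXV : X ⊆ P.nodeConstraints := (restrict_subset _ _).trans hWV
  have hUW : U ⊆ P.autNodes W := by
    rw [hscc]
    exact fun p hp => hp.1
  have huU : u ∈ U := by
    rw [hscc]
    exact ⟨hu, .refl, .refl⟩
  -- For Δ = 2 a configuration is a single pair, so restriction to 𝒟 leaves exactly the component.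
  -- This makes `X` stable under `trim` and further restriction to 𝒟.
  have hUX : P.autNodes X = U := by
    ext p
    constructor
    · rintro ⟨C, hC, hp⟩
      exact ⟨⟨C, hXV hC, hp⟩, hC.2 _ _ hp⟩
    · intro hp
      obtain ⟨C, hC, hpC⟩ := hUW hp
      refine ⟨C, ⟨hC, fun x y hxy => ?_⟩, hpC⟩
      have := sym2_eq_of_pair_eq ((pair_eq_of_le hΔ hxy).symm.trans (pair_eq_of_le hΔ hpC))
      rw [this]
      exact hp.2
  have hwalk : ∀ m p q, P.WalkIn W U m p q → P.WalkIn X U m p q := by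
    intro m
    induction m with
    | zero => exact fun p q h => h
    | succ m ih =>
      rintro p q ⟨hp, x, hx, hxq⟩
      refine ⟨hp, x, ⟨by rwa [hUX], ?_, hx.2.2⟩, ih x q hxq⟩
      rw [hUX]
      cases m with
      | zero => exact hxq.1
      | succ m => exact hxq.1
  have htrim : P.trim X = X := by
    refine (trim_subset X).antisymm fun C hC => ⟨hC, fun i hi => ?_⟩
    have hcard : Multiset.card (C : Multiset L) = 2 := C.2.trans hΔ
    obtain ⟨x, y, hxy⟩ := Multiset.card_eq_two.1 hcard
    have hp : (x, y) ∈ U := by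
      rw [← hUX]
      exact ⟨C, hC, hxy.ge⟩
    exact hasTree_of_walk hΔ hXV hUX.ge hK (hwalk _ _ _ (hflex K le_rfl _ hp _ hp)) hxy hi
  have hXD : P.restrict X D = X := (restrict_subset X D).antisymm fun C hC => ⟨hC, hC.2⟩
  have hDX : D ∈ P.flexSCC X := by
    refine ⟨⟨u, by rwa [hUX], ?_⟩, K, hK, fun m hm p hp q hq => hwalk _ _ _ (hflex m hm p hp q hq)⟩
    ext p
    constructor
    · intro hp
      exact ⟨by rwa [hUX], (hwalk _ _ _ (hflex K le_rfl u huU p hp)).reflTransGen,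
        (hwalk _ _ _ (hflex K le_rfl p hp u huU)).reflTransGen⟩
    · rintro ⟨hp, -⟩
      rwa [hUX] at hp
  have hXne : X.Nonempty := by
    rw [← hUX] at huU
    obtain ⟨C, hC, -⟩ := huU
    exact ⟨C, hC⟩
  refine ENat.eq_top_iff_forall_ge.2 fun k => ?_
  refine le_trans (by exact_mod_cast Nat.le_succ k) (le_depth (k := k + 1)
    (W := fun i => if i = 0 then P.nodeConstraints else if i = 1 then W else X)
    (D := fun i => if i = 0 then Set.univ else D) ⟨by omega, rfl, rfl, ?_, ?_, ?_⟩)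
  · intro i hi
    rcases i with _ | _ | i
    · simpa using hW
    · simpa using htrim.symm
    · simp [hXD, htrim]
  · intro i h1 h2
    rcases i with _ | _ | i
    · omega
    · exact ⟨⟨u, hu, hscc⟩, K, hK, hflex⟩
    · simpa using hDX
  · intro i h1 h2
    rcases i with _ | _ | i
    · omega
    · exact hXne.mono (restrict_subset _ _)
    · simpa using hXne

end UnrootedLCL

/-! ### Problems of degree two -/

/-- Positions on a path in which the blocks `0, …, 2B` and `2B + 1, …, 4B + 1` may be reversed and
in which there is a gap of `β ≤ 1` vertices between the blocks. -/
def blockPosition (B : ℕ) (r r' : Bool) (β x : ℕ) : ℕ :=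
  if x ≤ 2 * B then (if r then 2 * B - x else x)
  else if x ≤ 4 * B + 1 then (if r' then 6 * B + 2 - x else x) + β
  -- This occurs only for β = 1 and the vertex 4B + 2, which is moved into the gap.
  else if x ≤ 4 * B + 1 + β then 2 * B + 1
  else x

lemma isPosition_blockPosition {n B β : ℕ} (hn : 4 * B + 2 + β ≤ n) (hβ : β ≤ 1) (r r' : Bool) :
    IsPosition fun x : Fin n => blockPosition B r r' β x := by
  constructor
  · intro x y hxy
    have hx := x.2
    have hy := y.2
    apply Fin.ext
    revert hxy
    simp only [blockPosition]
    cases r <;> cases r' <;> simp only [if_true, if_false, Bool.false_eq_true] <;>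
      split_ifs <;> omega
  · intro x
    have hx := x.2
    simp only [blockPosition]
    cases r <;> cases r' <;> simp only [if_true, if_false, Bool.false_eq_true] <;>
      split_ifs <;> omega

/-- Reversing or shifting a block does not change adjacency in its interior, so views inside the
blocks do not tell the paths apart. -/
lemma lineGraph_blockPosition_adj {n B β : ℕ} (r r' : Bool) {u v : Fin n}
    (hu : (0 < u.val ∧ u.val < 2 * B) ∨ (2 * B + 1 < u.val ∧ u.val < 4 * B + 1)) :
    (lineGraph fun x : Fin n => blockPosition B r r' β x).Adj u v ↔
      u.val + 1 = v.val ∨ v.val + 1 = u.val := by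
  change blockPosition B r r' β u + 1 = blockPosition B r r' β v ∨
    blockPosition B r r' β v + 1 = blockPosition B r r' β u ↔ _
  simp only [blockPosition]
  cases r <;> cases r' <;> simp only [if_true, if_false, Bool.false_eq_true] <;>
    split_ifs <;> omega

namespace UnrootedLCL

variable {L : Type*} {P : UnrootedLCL L}

/-- If `ℓ` solves the problem on the path with the block positions, the label pairs at the centers
of the blocks are connected by a walk. -/
lemma walkIn_blockPosition (hΔ : P.Δ = 2) {γ n B β : ℕ} {W : Set (Sym L P.Δ)}
    (hW : W = P.trim (P.restrict P.nodeConstraints Set.univ))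
    (hγ : ∀ (W : Set (Sym L P.Δ)) (C : Sym L P.Δ),
      C ∈ W → (∀ i, 1 ≤ i → i ≤ γ → P.HasTree W C i) → C ∈ P.trim W)
    (hB : γ + 3 ≤ B) (hn : 4 * B + 4 ≤ n) (hβ : β ≤ 1) (r r' : Bool) {ℓ : Fin n → Fin n → L}
    (hℓ : P.IsSolution (lineGraph fun x : Fin n => blockPosition B r r' β x) ℓ)
    {c a b c' a' b' : Fin n} (hc : c.val = B) (ha : a.val + 1 = B) (hb : b.val = B + 1)
    (hc' : c'.val = 3 * B + 1) (ha' : a'.val = 3 * B) (hb' : b'.val = 3 * B + 2) :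
    P.WalkIn W Set.univ (2 * B + 1 + β) (if r then (ℓ c b, ℓ c a) else (ℓ c a, ℓ c b))
      (if r' then (ℓ c' b', ℓ c' a') else (ℓ c' a', ℓ c' b')) ∧
    (ℓ c a, ℓ c b) ∈ P.autNodes W := by
  set π : Fin n → ℕ := fun x => blockPosition B r r' β x with hπdef
  have hπ : IsPosition π := isPosition_blockPosition (by omega) hβ r r'
  have hcfg : ∀ x, B ≤ π x → π x ≤ 3 * B + 1 + β → P.HasConfig (lineGraph π) ℓ W x := by
    intro x h1 h2
    rw [hW]
    refine hasConfig_trim_of_ball hγ (by omega) (hπ.isTree (by omega)) hℓ.2 (restrict_subset _ _) ?_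
    intro u hu
    have := IsPosition.mem_ballOf_le hu
    obtain ⟨C, hC, h⟩ := hℓ.1 u (by rw [hΔ]; exact hπ.card_nbrs_inner (by omega) (by omega))
    exact ⟨C, ⟨hC, fun _ _ _ => trivial⟩, h⟩
  have hpc : π c = B := by
    simp only [π, blockPosition, hc]
    cases r <;> simp only [if_true, if_false, Bool.false_eq_true] <;> split_ifs <;> omega
  have hpc' : π c' = 3 * B + 1 + β := by
    simp only [π, blockPosition, hc']
    cases r' <;> simp only [if_true, if_false, Bool.false_eq_true] <;> split_ifs <;> omega
  have hpa : π a = if r then B + 1 else B - 1 := by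
    simp only [π, blockPosition]
    cases r <;> simp only [if_true, if_false, Bool.false_eq_true] <;> split_ifs <;> omega
  have hpb : π b = if r then B - 1 else B + 1 := by
    simp only [π, blockPosition, hb]
    cases r <;> simp only [if_true, if_false, Bool.false_eq_true] <;> split_ifs <;> omega
  have hpa' : π a' = (if r' then 3 * B + 2 else 3 * B) + β := by
    simp only [π, blockPosition, ha']
    cases r' <;> simp only [if_true, if_false, Bool.false_eq_true] <;> split_ifs <;> omega
  have hpb' : π b' = (if r' then 3 * B else 3 * B + 2) + β := by
    simp only [π, blockPosition, hb']
    cases r' <;> simp only [if_true, if_false, Bool.false_eq_true] <;> split_ifs <;> omega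
  have hinv : ∀ s, ∃ x, s < n → π x = s := by
    intro s
    by_cases hs : s < n
    · obtain ⟨x, hx⟩ := hπ.exists_eq hs
      exact ⟨x, fun _ => hx⟩
    · exact ⟨c, fun h => absurd h hs⟩
  choose inv hinv using hinv
  have heq : ∀ {s x}, s < n → π x = s → inv s = x := fun hs hx =>
    hπ.injective ((hinv _ hs).trans hx.symm)
  constructor
  · have hnb : (lineGraph π).NonBacktracking (2 * B + 1 + β) (fun s => inv (B + s)) := by
      constructor
      · intro s hs
        refine Or.inl ?_
        rw [hinv _ (by omega), hinv _ (by omega)]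
        rfl
      · intro s hs h
        have := congrArg π h
        rw [hinv _ (by omega), hinv _ (by omega)] at this
        omega
    have h0 : inv (B + 0) = c := heq (by omega) (by omega)
    have hm : inv (B + (2 * B + 1 + β)) = c' := heq (by omega) (by omega)
    have key := walkIn_of_path (W := W) hℓ.2 (by omega) hnb (fun s hs => hcfg _
      (by rw [hinv _ (by omega)]; omega) (by rw [hinv _ (by omega)]; omega))
      (e := inv (B - 1)) (f := inv (3 * B + 2 + β))
      (by
        refine Or.inr ?_
        rw [hinv _ (by omega), hinv _ (by omega)]
        omega)
      (by
        intro h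
        have := congrArg π h
        rw [hinv _ (by omega), hinv _ (by omega)] at this
        omega)
      (by
        refine Or.inl ?_
        rw [hinv _ (by omega), hinv _ (by omega)]
        omega)
      (by
        intro h
        have := congrArg π h
        rw [hinv _ (by omega), hinv _ (by omega)] at this
        omega)
    simp only [h0, hm] at key
    rw [show B + (2 * B + 1 + β - 1) = 3 * B + β by omega] at key
    convert key using 1
    · cases r
      · simp only [Bool.false_eq_true, if_false] at hpa hpb ⊢
        rw [heq (by omega) hpa, heq (by omega) hpb]
      · simp only [if_true] at hpa hpb ⊢
        rw [heq (by omega) hpa, heq (by omega) hpb]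
    · cases r'
      · simp only [Bool.false_eq_true, if_false] at hpa' hpb' ⊢
        rw [heq (by omega) hpa', heq (by omega) hpb']
      · simp only [if_true] at hpa' hpb' ⊢
        rw [heq (by omega) hpa', heq (by omega) hpb']
  · refine (hcfg c hpc.ge (by omega)).mem_autNodes ?_ ?_ ?_
    · rintro rfl
      omega
    · exact (lineGraph_blockPosition_adj r r' (by omega)).2 (by omega)
    · exact (lineGraph_blockPosition_adj r r' (by omega)).2 (by omega)

/-- Paths: fast algorithms lead to arbitrarily long good sequences. -/
theorem depth_eq_top_of_eq_two [Finite L] (P : UnrootedLCL L) (hΔ : P.Δ = 2) :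
    ∃ C : ℕ, ∀ (A : RandOnlineLocalAlg L) (n : ℕ),
      (∀ G : SimpleGraph (Fin n), IsRegularTree P.Δ G → ∀ σ : Equiv.Perm (Fin n),
        randomBits.real {ω | ¬ P.IsSolution G (A.run G σ ω)} ≤ 1 / (n : ℝ)) →
      C * (A.locality n + 1) ≤ n → P.depth = ⊤ := by
  obtain ⟨γ, hγ⟩ := exists_trim_radius P
  refine ⟨4 * γ + 16, fun A n hA hn => ?_⟩
  set T := A.locality n with hT
  -- The summand T hides the ends of the blocks from their centres; γ keeps the balls used for
  -- `trim` away from the ends of the path.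
  set B := T + γ + 3 with hB
  have hn' : 4 * B + 4 ≤ n := by
    have : (4 * γ + 16) * (T + 1) = 4 * γ * T + 4 * γ + 16 * T + 16 := by ring
    omega
  set W := P.trim (P.restrict P.nodeConstraints Set.univ) with hW
  let c : Fin n := ⟨B, by omega⟩
  let c' : Fin n := ⟨3 * B + 1, by omega⟩
  obtain ⟨σ, p', -, -, -, hσ⟩ := exists_perm_extend (Equiv.refl (Fin n)) (Nat.zero_le n) {c, c'}
    (fun j hj => absurd hj (by omega))
  let G : Bool × Bool × Fin 2 → SimpleGraph (Fin n) := fun τ =>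
    lineGraph fun x : Fin n => blockPosition B τ.1 τ.2.1 τ.2.2.val x
  have hpos : ∀ τ : Bool × Bool × Fin 2,
      IsPosition fun x : Fin n => blockPosition B τ.1 τ.2.1 τ.2.2.val x := fun τ =>
    isPosition_blockPosition (by omega) (by omega) _ _
  -- Eight instances, from two optional reversals and two gap lengths, with the two centres revealed
  -- first in the same order.
  obtain ⟨ω, hω⟩ := RandOnlineLocalAlg.exists_bits hA Finset.univ G (fun _ => σ)
    (fun τ _ => by rw [hΔ]; exact (hpos τ).isRegularTree (by omega))
    (by simp; omega)
  let τ₀ : Bool × Bool × Fin 2 := (false, false, 0)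
  set ℓ := A.run (G τ₀) σ ω with hℓ
  have hrun : ∀ τ, ∀ v ∈ ({c, c'} : Finset (Fin n)), A.run (G τ) σ ω v = ℓ v := by
    intro τ v hv
    obtain ⟨j, hj, rfl⟩ := (hσ v).1 hv
    refine (A.run_eq (fun _ _ => rfl) (fun u hu v => ?_) ω).symm
    have hu' : (0 < u.val ∧ u.val < 2 * B) ∨ (2 * B + 1 < u.val ∧ u.val < 4 * B + 1) := by
      obtain ⟨y, ⟨j', hj', rfl⟩, q, hq⟩ := hu
      have hmem : σ j' ∈ ({c, c'} : Finset (Fin n)) := (hσ _).2 ⟨j', lt_of_le_of_lt hj' hj, rfl⟩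
      have h1 := IsPosition.le_of_walk q
      have h2 : ∀ x : Fin n, blockPosition B false false 0 x = x := by
        intro x
        simp only [blockPosition]
        split_ifs <;> first | omega | simp_all
      change blockPosition B false false 0 _ ≤ blockPosition B false false 0 _ + _ ∧
        blockPosition B false false 0 _ ≤ blockPosition B false false 0 _ + _ at h1
      rw [h2, h2] at h1
      generalize q.length = d at h1 hq
      rw [Finset.mem_insert, Finset.mem_singleton] at hmem
      rcases hmem with h | h
      · rw [h] at h1
        change u.val ≤ B + _ ∧ B ≤ _ at h1
        omega
      · rw [h] at h1
        change u.val ≤ 3 * B + 1 + _ ∧ 3 * B + 1 ≤ _ at h1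
        omega
    rw [lineGraph_blockPosition_adj _ _ hu', lineGraph_blockPosition_adj _ _ hu']
  have key : ∀ τ : Bool × Bool × Fin 2, _ := fun τ =>
    walkIn_blockPosition hΔ hW hγ (by omega : γ + 3 ≤ B) hn' (by omega) τ.1 τ.2.1
      (hω τ (Finset.mem_univ _)) (c := c) (a := ⟨B - 1, by omega⟩) (b := ⟨B + 1, by omega⟩)
      (c' := c') (a' := ⟨3 * B, by omega⟩) (b' := ⟨3 * B + 2, by omega⟩) rfl
      (by dsimp only; omega) rfl rfl rfl rfl
  simp only [hrun _ c (by simp), hrun _ c' (by simp)] at key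
  refine depth_eq_top_of_flexSCC hΔ hW (sccPairs_mem_flexSCC ?_ (key τ₀).2
    ⟨2 * B + 1, by omega, (key τ₀).1, (key (false, false, 1)).1⟩ ?_ ?_ ?_)
  · exact (trim_subset _).trans (restrict_subset _ _)
  · exact (key (false, true, 0)).1.reflTransGen
  · exact (key (true, false, 0)).1.reflTransGen
  · exact ⟨_, (key (true, true, 0)).1⟩

end UnrootedLCL

/-! ### The theorem -/

theorem mainTheorem2 {L : Type*} [Finite L] [Nonempty L] (P : UnrootedLCL L)
    (k : ℕ) (hk : 0 < k) (hd : P.depth = (k : ℕ∞)) :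
    ∃ c : ℝ, 0 < c ∧ ∀ A : RandOnlineLocalAlg L, A.Solves P →
      ∀ᶠ n : ℕ in atTop, (∃ G : SimpleGraph (Fin n), IsRegularTree P.Δ G) →
        c * (n : ℝ) ^ (1 / (k : ℝ)) ≤ (A.locality n : ℝ) := by
  -- a fast algorithm contradicts the depth
  obtain ⟨C, hC⟩ : ∃ C : ℕ, ∀ (A : RandOnlineLocalAlg L) (n : ℕ), 2 < n →
      (∀ G : SimpleGraph (Fin n), IsRegularTree P.Δ G → ∀ σ : Equiv.Perm (Fin n),
        randomBits.real {ω | ¬ P.IsSolution G (A.run G σ ω)} ≤ 1 / (n : ℝ)) →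
      (∃ G : SimpleGraph (Fin n), IsRegularTree P.Δ G) → ¬ C * (A.locality n + 1) ^ k ≤ n := by
    have hΔ := P.Δ_pos
    rcases Nat.lt_or_ge P.Δ 2 with h1 | h1
    -- For Δ = 1 the number Δ - 1 = 0 would divide n - 2, although n > 2.
    · refine ⟨0, fun A n hn _ ⟨G, hG⟩ _ => ?_⟩
      have := hG.dvd (by rw [Fintype.card_fin]; omega)
      rw [Fintype.card_fin, show P.Δ - 1 = 0 by omega, zero_dvd_iff] at this
      omega
    rcases h1.eq_or_lt with h2 | h2
    · obtain ⟨C, hC⟩ := P.depth_eq_top_of_eq_two h2.symm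
      refine ⟨C, fun A n _ hA _ hle => ?_⟩
      have := hC A n hA ((Nat.mul_le_mul_left C (Nat.le_self_pow hk.ne' _)).trans hle)
      rw [hd] at this
      exact ENat.natCast_ne_top k this
    · obtain ⟨C, hC⟩ := P.lt_depth_of_three_le h2 hk
      refine ⟨C, fun A n _ hA hG hle => ?_⟩
      have := hC A n hA hG hle
      rw [hd, Nat.cast_le] at this
      omega
  have hC1 : (0 : ℝ) < C + 1 := by positivity
  -- If T is less than this multiple of X = n^(1/k) and X ≥ 2(C + 1), then (T + 1)(C + 1) ≤ X/2 +
  -- X/2, hence C (T + 1)^k ≤ n.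
  refine ⟨1 / (2 * (C + 1)), by positivity, fun A hA => ?_⟩
  have hk' : (0 : ℝ) < 1 / (k : ℝ) := by
    have : (0 : ℝ) < k := by exact_mod_cast hk
    positivity
  have hlarge : ∀ᶠ n : ℕ in atTop, 2 * ((C : ℝ) + 1) ≤ (n : ℝ) ^ (1 / (k : ℝ)) :=
    ((tendsto_rpow_atTop hk').comp tendsto_natCast_atTop_atTop).eventually_ge_atTop _
  filter_upwards [hA, hlarge, eventually_gt_atTop 2] with n h1 h2 h3 hG
  by_contra hlt
  rw [not_le] at hlt
  refine hC A n h3 h1 hG ?_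
  set X := (n : ℝ) ^ (1 / (k : ℝ)) with hX
  have hX0 : 0 ≤ X := by positivity
  have hXk : X ^ k = n := by
    rw [hX, ← Real.rpow_natCast, ← Real.rpow_mul (by positivity), one_div,
      inv_mul_cancel₀ (by exact_mod_cast hk.ne'), Real.rpow_one]
  have h4 : ((A.locality n : ℝ) + 1) * (C + 1) ≤ X := by
    have e1 : 1 / (2 * ((C : ℝ) + 1)) * X * (C + 1) = X / 2 := by
      field_simp
    nlinarith
  have h5 : (((A.locality n : ℝ) + 1) * (C + 1)) ^ k ≤ n := by
    rw [← hXk]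
    exact pow_le_pow_left₀ (by positivity) h4 k
  have h6 : (C : ℝ) ≤ ((C : ℝ) + 1) ^ k :=
    (le_add_of_nonneg_right zero_le_one).trans (le_self_pow₀ (by linarith [Nat.cast_nonneg (α := ℝ) C]) hk.ne')
  have h7 : (C : ℝ) * ((A.locality n : ℝ) + 1) ^ k ≤ n := by
    rw [mul_pow, mul_comm] at h5
    exact (mul_le_mul_of_nonneg_right h6 (by positivity)).trans h5
  exact_mod_cast h7
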